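/- **Setting.** Let $K$ be a field of characteristic $0$, let $X$ be a smooth affine variety over $K$ with coordinate ring $\mathcal O=\mathcal O_X(X)$ (a smooth $K$-algebra), and let $\mathcal D=\mathcal D_X(X)\subset \mathrm{End}_K(\mathcal O)$ be the ring of linear differential operators, i.e. the $K$-subalgebra generated by $\mathcal O$ and $\mathrm{Der}_K(\mathcal O)$. Let $\mathrm{DG}\mathcal D\mathrm A$ be the category of differential non-negatively graded, graded-commutative unital $\mathcal D$-algebras: graded-commutative unital $\mathcal O$-algebras $\bigoplus_{n\ge 0}A_n$ whose $\mathcal O$-module structure is extended to a degree-preserving left $\mathcal D$-module structure for which vector fields act as derivations, together with a $\mathcal D$-linear differential of degree $-1$ that is a graded derivation. Morphisms are the $\mathcal D$-linear unital algebra maps of degree $0$ that commute with the differentials. A $\mathcal D$-algebra is an object concentrated in degree $0$ with zero differential. Tensor products $\otimes$ and graded symmetric algebras $\mathcal S$ are taken over $\mathcal O$. A *relative Sullivan $\mathcal D$-algebra* is a morphism $A\to (A\otimes\mathcal SV,d)$, $a\mapsto a\otimes 1$, where $V=\bigoplus_{\alpha\in I}\mathcal D\cdot v_\alpha$ is a free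 graded $\mathcal D$-module with homogeneous basis $(v_\alpha)$ indexed by a well-ordered set $I$ and $d v_\alpha\in A\otimes\mathcal SV_{<\alpha}$ for all $\alpha$, with $V_{<\alpha}=\bigoplus_{\beta<\alpha}\mathcal D\cdot v_\beta$. It is *minimal* if $\alpha\le\beta$ implies $\deg v_\alpha\le\deg v_\beta$. A *trivial fibration* is a morphism that is surjective in all positive degrees and induces an isomorphism in homology. A *cofibrant replacement Koszul–Tate resolution* of a morphism $\varphi:\mathcal J\to\mathcal Q$ is a factorization $\varphi=q\circ j$ with $j:\mathcal J\to \mathcal J\otimes\mathcal SV$ a relative Sullivan $\mathcal D$-algebra and $q:\mathcal J\otimes\mathcal SV\to\mathcal Q$ a trivial fibration. For a $\mathcal D$-algebra $\mathcal J$, a *differential graded $\mathcal J[\mathcal D]$-algebra* is an object $\mathcal C$ of $\mathrm{DG}\mathcal D\mathrm A$ that is also a differential graded $\mathcal J$-algebra, such that vector fields act as derivations on the $\mathcal J$-action; any morphism $f:\mathcal J\to\mathcal C$ in $\mathrm{DG}\mathcal D\mathrm A$ defines such a structure by $a\triangleleft c=f(a)\,c$. Such a $\mathcal C$ is of *Sullivan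 type* if it has an exhaustive increasing filtration $\mathcal C_0\subset\mathcal C_1\subset\cdots$ by differential graded $\mathcal D$-subalgebras such that the structure map $a\mapsto a\triangleleft 1$ sends $\mathcal C_{-1}:=\mathcal J$ to $\mathcal C_0$ and, for every $k\ge0$, there is a projective graded $\mathcal D$-submodule $V_k$ of $\mathcal C_k$ with $d V_k\subset\mathcal C_{k-1}$ (for $k=0$: $dV_0$ lies in the image of $\mathcal J$) and with $\mathcal C_{k-1}\otimes\mathcal SV_k\to\mathcal C_k$, $c\otimes(v_1\odot\cdots\odot v_r)\mapsto c\,v_1\cdots v_r$, an isomorphism. A *$\mathcal D$-geometric Koszul–Tate resolution* of $\varphi:\mathcal J\to\mathcal Q$ is a morphism $\psi:\mathcal C\to\mathcal Q$ of differential graded $\mathcal J[\mathcal D]$-algebras ($\mathcal Q$ being one through $\varphi$) that is a quasi-isomorphism and whose source is of Sullivan type. **Proposition.** Let $\mathcal J$ be a $\mathcal D$-algebra and let $\varphi:\mathcal J\to\mathcal Q$ be a $\mathrm{DG}\mathcal D\mathrm A$-morphism. Then $\varphi$ has a cofibrant replacement Koszul–Tate resolution $\mathcal J\xrightarrow{\,j\,}\mathcal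 J\otimes\mathcal SV\xrightarrow{\,q\,}\mathcal Q$, which can be chosen with $j$ minimal. Moreover, for every cofibrant replacement Koszul–Tate resolution of $\varphi$, the trivial fibration $q:\mathcal J\otimes\mathcal SV\to\mathcal Q$ is a $\mathcal D$-geometric Koszul–Tate resolution of $\varphi$, where $\mathcal J\otimes\mathcal SV$ is a differential graded $\mathcal J[\mathcal D]$-algebra through $j$: it is of Sullivan type, and $q$ is a $\mathcal J$-linear quasi-isomorphism of differential graded $\mathcal J[\mathcal D]$-algebras. -/

import Mathlib

open scoped TensorProduct DirectSum

universe v u w w₁ w₂ w₃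

noncomputable section

/-! # Differential operators of a smooth affine variety -/

/-- The ring `𝒟 = 𝒟_X(X)` of linear differential operators of the smooth affine variety `X` with
coordinate ring `O` over a field `K` of characteristic zero: the `K`-subalgebra of `End_K(O)`
generated by the functions (acting by multiplication) and the vector fields (the `K`-derivations
of `O`). -/
def diffOpSubalgebra (K : Type v) (O : Type u) [Field K] [CommRing O] [Algebra K O] :
    Subalgebra K (Module.End K O) :=
  Algebra.adjoin K (Set.range (fun f : O => LinearMap.mulLeft K f) ∪
    Set.range (fun θ : Derivation K O O => (θ : O →ₗ[K] O)))

/-- The ring `𝒟` as a type of its own. -/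
def DiffOp (K : Type v) (O : Type u) [Field K] [CommRing O] [Algebra K O] : Type u :=
  ↥(diffOpSubalgebra K O)

namespace DiffOp

variable (K : Type v) (O : Type u) [Field K] [CommRing O] [Algebra K O]

instance instRing : Ring (DiffOp K O) := inferInstanceAs (Ring ↥(diffOpSubalgebra K O))

instance instAlgebra : Algebra K (DiffOp K O) :=
  inferInstanceAs (Algebra K ↥(diffOpSubalgebra K O))

variable {O}

/-- A function as a differential operator of order zero. -/
def ofFun : O →+* DiffOp K O where
  toFun f := ⟨LinearMap.mulLeft K f, Algebra.subset_adjoin (Or.inl ⟨f, rfl⟩)⟩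
  map_one' := Subtype.ext (LinearMap.ext fun x => one_mul x)
  map_mul' f g := Subtype.ext (LinearMap.ext fun x => mul_assoc f g x)
  map_zero' := Subtype.ext (LinearMap.ext fun x => zero_mul x)
  map_add' f g := Subtype.ext (LinearMap.ext fun x => add_mul f g x)

/-- A vector field as a differential operator of order one. -/
def ofVec (θ : Derivation K O O) : DiffOp K O :=
  ⟨(θ : O →ₗ[K] O), Algebra.subset_adjoin (Or.inr ⟨θ, rfl⟩)⟩

/-- `𝒟` is a (left) module over the functions: `f • P = f ∘ P`. -/
instance instModuleFun : Module O (DiffOp K O) := Module.compHom (DiffOp K O) (ofFun K)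

theorem smul_eq (f : O) (P : DiffOp K O) : f • P = ofFun K f * P := rfl

end DiffOp

/-! # Differential graded `𝒟`-algebras -/

/-- An object of `DG𝒟A`: a differential non-negatively graded graded-commutative unital algebra
over `𝒟`. It is a graded-commutative unital `O`-algebra `⨁ₙ gr n`, whose `O`-module structure is
extended to a left `𝒟`-module structure (`tower`) preserving the degree, such that vector fields
act as derivations of the product, together with a `𝒟`-linear differential `d` of degree `-1`
that is a graded derivation. -/
structure DGDA (K : Type v) (O : Type u) [Field K] [CommRing O] [Algebra K O] where
  carrier : Type w
  [ring : Ring carrier]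
  [algebra : Algebra O carrier]
  [dmodule : Module (DiffOp K O) carrier]
  [tower : IsScalarTower O (DiffOp K O) carrier]
  gr : ℕ → Submodule (DiffOp K O) carrier
  [graded : GradedRing gr]
  mul_comm' : ∀ {m n : ℕ} {a b : carrier}, a ∈ gr m → b ∈ gr n →
    a * b = (-1) ^ (m * n) * (b * a)
  vec_mul : ∀ (θ : Derivation K O O) (a b : carrier),
    DiffOp.ofVec K θ • (a * b) = (DiffOp.ofVec K θ • a) * b + a * (DiffOp.ofVec K θ • b)
  d : carrier →ₗ[DiffOp K O] carrier
  d_mem : ∀ {n : ℕ} {a : carrier}, a ∈ gr (n + 1) → d a ∈ gr n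
  d_zero : ∀ {a : carrier}, a ∈ gr 0 → d a = 0
  d_d : ∀ a : carrier, d (d a) = 0
  d_mul : ∀ {m : ℕ} {a : carrier}, a ∈ gr m → ∀ b : carrier,
    d (a * b) = d a * b + (-1) ^ m * (a * d b)

attribute [instance] DGDA.ring DGDA.algebra DGDA.dmodule DGDA.tower DGDA.graded

section Basics

variable {K : Type v} {O : Type u} [Field K] [CommRing O] [Algebra K O]

namespace DGDA

/-- `A` is a `𝒟`-algebra (an object of `𝒟A ⊂ DG𝒟A`): it is concentrated in degree zero and has
zero differential. -/
def IsDAlgebra (A : DGDA.{v, u, w} K O) : Prop :=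
  (∀ n : ℕ, 0 < n → A.gr n = ⊥) ∧ A.d = 0

/-- Cycles of degree `n`. -/
def cycles (A : DGDA.{v, u, w} K O) (n : ℕ) : Submodule (DiffOp K O) A.carrier :=
  A.gr n ⊓ LinearMap.ker A.d

/-- Boundaries of degree `n`. -/
def boundaries (A : DGDA.{v, u, w} K O) (n : ℕ) : Submodule (DiffOp K O) A.carrier :=
  (A.gr (n + 1)).map A.d

/-- The `n`-th homology `𝒟`-module. -/
abbrev homology (A : DGDA.{v, u, w} K O) (n : ℕ) : Type w :=
  ↥(A.cycles n) ⧸ (A.boundaries n).submoduleOf (A.cycles n)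

end DGDA

/-- A morphism of `DG𝒟A`: a `𝒟`-linear unital ring homomorphism of degree zero that commutes
with the differentials. -/
structure DGDHom (A : DGDA.{v, u, w₁} K O) (B : DGDA.{v, u, w₂} K O) extends
    A.carrier →+* B.carrier where
  map_smul' : ∀ (P : DiffOp K O) (a : A.carrier), toFun (P • a) = P • toFun a
  map_gr' : ∀ {n : ℕ} {a : A.carrier}, a ∈ A.gr n → toFun a ∈ B.gr n
  map_d' : ∀ a : A.carrier, toFun (A.d a) = B.d (toFun a)

namespace DGDHom

variable {A : DGDA.{v, u, w₁} K O} {B : DGDA.{v, u, w₂} K O}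

instance instCoeFun : CoeFun (DGDHom A B) (fun _ => A.carrier → B.carrier) :=
  ⟨fun f => f.toRingHom⟩

/-- The underlying `𝒟`-linear map. -/
def toDLinear (f : DGDHom A B) : A.carrier →ₗ[DiffOp K O] B.carrier where
  toFun := f
  map_add' := f.toRingHom.map_add
  map_smul' := f.map_smul'

/-- The underlying `O`-linear map. -/
def toOLinear (f : DGDHom A B) : A.carrier →ₗ[O] B.carrier where
  toFun := f
  map_add' := f.toRingHom.map_add
  map_smul' r a := by
    have h := f.map_smul' (r • (1 : DiffOp K O)) a
    rw [smul_assoc, one_smul, smul_assoc, one_smul] at h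
    exact h

theorem cycles_le (f : DGDHom A B) (n : ℕ) :
    A.cycles n ≤ (B.cycles n).comap f.toDLinear := by
  intro a ha
  refine ⟨f.map_gr' ha.1, ?_⟩
  have h := f.map_d' a
  rw [LinearMap.mem_ker.1 ha.2] at h
  exact LinearMap.mem_ker.2 (h.symm.trans f.toRingHom.map_zero)

/-- The map induced on cycles. -/
def cyclesMap (f : DGDHom A B) (n : ℕ) : ↥(A.cycles n) →ₗ[DiffOp K O] ↥(B.cycles n) :=
  f.toDLinear.restrict (f.cycles_le n)

/-- The map induced on the `n`-th homology. -/
def homologyMap (f : DGDHom A B) (n : ℕ) : A.homology n →ₗ[DiffOp K O] B.homology n :=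
  Submodule.mapQ _ _ (f.cyclesMap n) (by
    rintro ⟨a, ha⟩ hb
    obtain ⟨c, hc, hca⟩ := hb
    exact ⟨f c, f.map_gr' hc, (f.map_d' c).symm.trans (congrArg f hca)⟩)

/-- A weak equivalence (quasi-isomorphism): an isomorphism in homology. -/
def IsQuasiIso (f : DGDHom A B) : Prop :=
  ∀ n : ℕ, Function.Bijective (f.homologyMap n)

/-- A fibration: a morphism that is surjective in all positive degrees. -/
def IsFibration (f : DGDHom A B) : Prop :=
  ∀ n : ℕ, 0 < n → ∀ b ∈ B.gr n, ∃ a ∈ A.gr n, f a = b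

/-- A trivial fibration. -/
def IsTrivialFibration (f : DGDHom A B) : Prop :=
  f.IsFibration ∧ f.IsQuasiIso

end DGDHom

/-! # Graded symmetric tensor algebras over `O` -/

/-- The graded-commutativity relations `x ⊙ y = (-1)^{mn} y ⊙ x`, `x` and `y` being homogeneous
of degrees `m` and `n`. -/
inductive GrSym.Rel {V : Type w} [AddCommGroup V] [Module O V] (𝒱 : ℕ → Submodule O V) :
    TensorAlgebra O V → TensorAlgebra O V → Prop
  | swap {m n : ℕ} {x y : V} (hx : x ∈ 𝒱 m) (hy : y ∈ 𝒱 n) :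
      GrSym.Rel 𝒱 (TensorAlgebra.ι O x * TensorAlgebra.ι O y)
        ((-1) ^ (m * n) * (TensorAlgebra.ι O y * TensorAlgebra.ι O x))

/-- The graded symmetric tensor algebra `𝒮V` over `O` of a graded `O`-module `V = ⨁ₙ 𝒱 n`
(the base field has characteristic zero, so that the squares of the odd elements vanish). -/
def GrSym {V : Type w} [AddCommGroup V] [Module O V] (𝒱 : ℕ → Submodule O V) : Type (max u w) :=
  RingQuot (GrSym.Rel 𝒱)

namespace GrSym

variable {V : Type w} [AddCommGroup V] [Module O V] (𝒱 : ℕ → Submodule O V)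

instance instRing : Ring (GrSym 𝒱) := inferInstanceAs (Ring (RingQuot (GrSym.Rel 𝒱)))

instance instAlgebra : Algebra O (GrSym 𝒱) :=
  inferInstanceAs (Algebra O (RingQuot (GrSym.Rel 𝒱)))

/-- The canonical map `V → 𝒮V`. -/
def ι : V →ₗ[O] GrSym 𝒱 :=
  (RingQuot.mkAlgHom O (GrSym.Rel 𝒱)).toLinearMap ∘ₗ TensorAlgebra.ι O

variable {𝒱}

/-- The extension of a degree-preserving `O`-linear map `V → R` to `𝒮V → R`,
`v₁ ⊙ ⋯ ⊙ vₖ ↦ f v₁ * ⋯ * f vₖ`. -/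
def lift {R : DGDA.{v, u, w₁} K O} (f : V →ₗ[O] R.carrier)
    (hf : ∀ (n : ℕ) (x : V), x ∈ 𝒱 n → f x ∈ R.gr n) : GrSym 𝒱 →ₐ[O] R.carrier :=
  RingQuot.liftAlgHom O ⟨TensorAlgebra.lift O f, by
    intro a b h
    obtain ⟨hx, hy⟩ := h
    simp only [map_mul, map_pow, map_neg, map_one, TensorAlgebra.lift_ι_apply]
    exact R.mul_comm' (hf _ _ hx) (hf _ _ hy)⟩

theorem lift_ι {R : DGDA.{v, u, w₁} K O} (f : V →ₗ[O] R.carrier)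
    (hf : ∀ (n : ℕ) (x : V), x ∈ 𝒱 n → f x ∈ R.gr n) (x : V) :
    lift f hf (ι 𝒱 x) = f x :=
  (RingQuot.liftAlgHom_mkAlgHom_apply O _ _ _).trans (TensorAlgebra.lift_ι_apply f x)

end GrSym

/-- The canonical map `B ⊗_O 𝒮V → R`, `b ⊗ (v₁ ⊙ ⋯ ⊙ vₖ) ↦ g b * f v₁ * ⋯ * f vₖ`, attached to
`O`-linear maps `g : B → R` and `f : V → R`, the latter preserving degrees. If `g` is a morphism
of graded `𝒟`-algebras and `f` is `𝒟`-linear, this is a morphism of graded `𝒟`-algebras (for the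
Koszul sign and the Leibniz action of vector fields on `B ⊗_O 𝒮V`), so that `R` is `B ⊗_O 𝒮V` as
a graded `𝒟`-algebra if and only if it is bijective. -/
def symExtMap {R : DGDA.{v, u, w₁} K O} {B : Type w₂} [AddCommGroup B] [Module O B]
    {V : Type w} [AddCommGroup V] [Module O V] {𝒱 : ℕ → Submodule O V}
    (g : B →ₗ[O] R.carrier) (f : V →ₗ[O] R.carrier)
    (hf : ∀ (n : ℕ) (x : V), x ∈ 𝒱 n → f x ∈ R.gr n) :
    B ⊗[O] GrSym 𝒱 →ₗ[O] R.carrier :=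
  LinearMap.mul' O R.carrier ∘ₗ TensorProduct.map g (GrSym.lift f hf).toLinearMap

theorem symExtMap_tmul {R : DGDA.{v, u, w₁} K O} {B : Type w₂} [AddCommGroup B] [Module O B]
    {V : Type w} [AddCommGroup V] [Module O V] {𝒱 : ℕ → Submodule O V}
    (g : B →ₗ[O] R.carrier) (f : V →ₗ[O] R.carrier)
    (hf : ∀ (n : ℕ) (x : V), x ∈ 𝒱 n → f x ∈ R.gr n) (b : B) (s : GrSym 𝒱) :
    symExtMap g f hf (b ⊗ₜ s) = g b * GrSym.lift f hf s := rfl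

/-! # Relative Sullivan `𝒟`-algebras -/

/-- The degree-`n` part of the free `𝒟`-module `⨁_α 𝒟 · v_α`, where `v_α` has degree `deg α`. -/
def freeGr (K : Type v) (O : Type u) [Field K] [CommRing O] [Algebra K O] {I : Type w}
    (deg : I → ℕ) (n : ℕ) : Submodule O (I →₀ DiffOp K O) :=
  Finsupp.supported (DiffOp K O) O {i | deg i = n}

/-- The `𝒟`-linear map `⨁_α 𝒟 · v_α → R` given by a family `(v_α)` in `R`, viewed as an
`O`-linear map. -/
def freeMap (R : DGDA.{v, u, w₁} K O) {I : Type w} (x : I → R.carrier) :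
    (I →₀ DiffOp K O) →ₗ[O] R.carrier :=
  (Finsupp.linearCombination (DiffOp K O) x).restrictScalars O

theorem freeMap_mem (R : DGDA.{v, u, w₁} K O) {I : Type w} (deg : I → ℕ) (x : I → R.carrier)
    (hx : ∀ i, x i ∈ R.gr (deg i)) (n : ℕ) (c : I →₀ DiffOp K O) (hc : c ∈ freeGr K O deg n) :
    freeMap R x c ∈ R.gr n := by
  refine Submodule.sum_mem _ fun i hi => Submodule.smul_mem _ _ ?_
  have h : deg i = n := hc hi
  exact h ▸ hx i

/-- The canonical map `A ⊗ 𝒮(⨁_α 𝒟 · v_α) → R` for a morphism `j : A → R` and homogeneous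
elements `v_α` of `R`. -/
def freeSymExtMap {A : DGDA.{v, u, w₁} K O} {R : DGDA.{v, u, w₂} K O} (j : DGDHom A R)
    {I : Type w} (deg : I → ℕ) (x : I → R.carrier) (hx : ∀ i, x i ∈ R.gr (deg i)) :
    A.carrier ⊗[O] GrSym (freeGr K O deg) →ₗ[O] R.carrier :=
  symExtMap j.toOLinear (freeMap R x) (freeMap_mem R deg x hx)

/-- The data that exhibit `j : A → R` as a relative Sullivan `𝒟`-algebra
`A → (A ⊗ 𝒮V, d)`, `a ↦ a ⊗ 1`: a homogeneous basis `(v_α)` of the free `𝒟`-module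
`V = ⨁_α 𝒟 · v_α`, indexed by a well-ordered set, such that `R = A ⊗ 𝒮V` as graded `𝒟`-algebra
(`bijective`) and `d v_α ∈ A ⊗ 𝒮V_{<α}` (`lowering`). -/
structure SullivanBasis {A : DGDA.{v, u, w₁} K O} {R : DGDA.{v, u, w₂} K O} (j : DGDHom A R) where
  index : Type w₃
  [linearOrder : LinearOrder index]
  [wellFounded : WellFoundedLT index]
  deg : index → ℕ
  gen : index → R.carrier
  gen_mem : ∀ α, gen α ∈ R.gr (deg α)
  bijective : Function.Bijective (freeSymExtMap j deg gen gen_mem)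
  lowering : ∀ α, R.d (gen α) ∈ LinearMap.range
    (freeSymExtMap j (fun β : Set.Iio α => deg β) (fun β : Set.Iio α => gen β)
      (fun β => gen_mem β))

attribute [instance] SullivanBasis.linearOrder SullivanBasis.wellFounded

namespace DGDHom

variable {A : DGDA.{v, u, u} K O} {R : DGDA.{v, u, u} K O} {Q : DGDA.{v, u, u} K O}

/-- `j : A → R` is a relative Sullivan `𝒟`-algebra. -/
def IsRelativeSullivan (j : DGDHom A R) : Prop :=
  Nonempty (SullivanBasis.{v, u, u, u, u} j)

/-- `j : A → R` is a minimal relative Sullivan `𝒟`-algebra: `α ≤ β` implies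
`deg v_α ≤ deg v_β`. -/
def IsMinimalRelativeSullivan (j : DGDHom A R) : Prop :=
  ∃ S : SullivanBasis.{v, u, u, u, u} j, ∀ α β, α ≤ β → S.deg α ≤ S.deg β

/-- `A → R = A ⊗ 𝒮V → Q` is a cofibrant replacement Koszul-Tate resolution of `φ : A → Q`: a
factorization of `φ` into a relative Sullivan `𝒟`-algebra `j` followed by a trivial
fibration `q`. -/
structure IsCofibrantReplacementKTR (φ : DGDHom A Q) (j : DGDHom A R) (q : DGDHom R Q) :
    Prop where
  sullivan : j.IsRelativeSullivan
  trivialFibration : q.IsTrivialFibration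
  factor : ∀ a, q (j a) = φ a

end DGDHom

/-! # Differential graded `A[𝒟]`-algebras -/

/-- A differential graded `A[𝒟]`-algebra: a differential graded `𝒟`-algebra which is also a
differential graded `A`-algebra, such that vector fields act as derivations on the `A`-action. -/
structure DGADA (A : DGDA.{v, u, w₁} K O) extends DGDA.{v, u, w₂} K O where
  [amodule : Module A.carrier carrier]
  [atower : IsScalarTower O A.carrier carrier]
  act_mul : ∀ (a : A.carrier) (b c : carrier), a • (b * c) = (a • b) * c
  act_mem : ∀ {m n : ℕ} {a : A.carrier} {c : carrier}, a ∈ A.gr m → c ∈ gr n →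
    a • c ∈ gr (m + n)
  act_d : ∀ {m : ℕ} {a : A.carrier}, a ∈ A.gr m → ∀ c : carrier,
    d (a • c) = A.d a • c + (-1) ^ m * (a • d c)
  act_vec : ∀ (θ : Derivation K O O) (a : A.carrier) (c : carrier),
    DiffOp.ofVec K θ • (a • c) = (DiffOp.ofVec K θ • a) • c + a • (DiffOp.ofVec K θ • c)

attribute [instance] DGADA.amodule DGADA.atower

/-- The differential graded `A[𝒟]`-algebra structure on `B` induced by a morphism `f : A → B`,
given by `a • b = f a * b`. -/
def DGADA.ofHom {A : DGDA.{v, u, w₁} K O} {B : DGDA.{v, u, w₂} K O} (f : DGDHom A B) :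
    DGADA.{v, u, w₁, w₂} A :=
  letI : Module A.carrier B.carrier := Module.compHom B.carrier f.toRingHom
  { B with
    amodule := Module.compHom B.carrier f.toRingHom
    atower := ⟨fun r a b => by
      change f (r • a) * b = r • (f a * b)
      have h : f (r • a) = r • f a := f.toOLinear.map_smul r a
      rw [h, smul_mul_assoc]⟩
    act_mul := fun a b c => (mul_assoc (f a) b c).symm
    act_mem := fun ha hc => SetLike.mul_mem_graded (f.map_gr' ha) hc
    act_d := fun {m a} ha c => by
      change B.d (f a * c) = f (A.d a) * c + (-1) ^ m * (f a * B.d c)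
      have h : f (A.d a) = B.d (f a) := f.map_d' a
      have h' : f a ∈ B.gr m := f.map_gr' ha
      rw [h, B.d_mul h']
    act_vec := fun θ a c => by
      change DiffOp.ofVec K θ • (f a * c) = f (DiffOp.ofVec K θ • a) * c
        + f a * (DiffOp.ofVec K θ • c)
      have h : f (DiffOp.ofVec K θ • a) = DiffOp.ofVec K θ • f a := f.map_smul' _ a
      rw [h, B.vec_mul] }

/-- A morphism of differential graded `𝒟`-algebras between differential graded
`A[𝒟]`-algebras is `A`-linear, hence a morphism of differential graded `A[𝒟]`-algebras. -/
def DGADA.IsALinear {A : DGDA.{v, u, w₁} K O} (C : DGADA.{v, u, w₁, w₂} A)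
    (E : DGADA.{v, u, w₁, w₃} A) (ψ : DGDHom C.toDGDA E.toDGDA) : Prop :=
  ∀ (a : A.carrier) (c : C.carrier), ψ (a • c) = a • ψ c

/-- The structure map `A → C`, `a ↦ a • 1`, of a differential graded `A[𝒟]`-algebra, viewed as an
`O`-linear map. -/
def DGADA.structureMap {A : DGDA.{v, u, w₁} K O} (C : DGADA.{v, u, w₁, w₂} A) :
    A.carrier →ₗ[O] C.carrier where
  toFun a := a • (1 : C.carrier)
  map_add' a b := add_smul a b _
  map_smul' r a := smul_assoc r a _

/-! # Sullivan type and `𝒟`-geometric Koszul-Tate resolutions -/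

/-- A differential graded `𝒟`-subalgebra. -/
structure DGDSub (R : DGDA.{v, u, w} K O) extends Subalgebra O R.carrier where
  smul_mem' : ∀ (P : DiffOp K O) {a : R.carrier}, a ∈ carrier → P • a ∈ carrier
  d_mem' : ∀ {a : R.carrier}, a ∈ carrier → R.d a ∈ carrier
  homogeneous' : ∀ (n : ℕ) {a : R.carrier}, a ∈ carrier →
    (DirectSum.decompose R.gr a n : R.carrier) ∈ carrier

/-- The degree-`n` part of a (graded) `𝒟`-submodule `V` of `R`. -/
def subGr {R : DGDA.{v, u, w} K O} (V : Submodule (DiffOp K O) R.carrier) (n : ℕ) :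
    Submodule O V :=
  ((R.gr n).comap V.subtype).restrictScalars O

/-- The canonical map `B ⊗ 𝒮V → R` for an `O`-linear map `B → R` and a graded `𝒟`-submodule `V`
of `R`. -/
def subSymExtMap {R : DGDA.{v, u, w₁} K O} {B : Type w₂} [AddCommGroup B] [Module O B]
    (g : B →ₗ[O] R.carrier) (V : Submodule (DiffOp K O) R.carrier) :
    B ⊗[O] GrSym (subGr V) →ₗ[O] R.carrier :=
  symExtMap g (V.subtype.restrictScalars O) (fun _ _ hx => hx)

/-- `C' = B ⊗ 𝒮V` inside `R`: `V` is a projective graded `𝒟`-submodule of the subalgebra `C'`, and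
the canonical map `B ⊗ 𝒮V → R` is an isomorphism onto `C'`. -/
structure IsSymExtension {R : DGDA.{v, u, w₁} K O} {B : Type w₂} [AddCommGroup B] [Module O B]
    (g : B →ₗ[O] R.carrier) (V : Submodule (DiffOp K O) R.carrier) (C' : DGDSub R) : Prop where
  projective : Module.Projective (DiffOp K O) V
  homogeneous : ∀ (n : ℕ) {a : R.carrier}, a ∈ V →
    (DirectSum.decompose R.gr a n : R.carrier) ∈ V
  le : ∀ {a : R.carrier}, a ∈ V → a ∈ C'.toSubalgebra
  injective : Function.Injective (subSymExtMap g V)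
  range_eq : LinearMap.range (subSymExtMap g V) = Subalgebra.toSubmodule C'.toSubalgebra

/-- The differential graded `A[𝒟]`-algebra `C` is of Sullivan type: it has an exhaustive increasing
filtration `C₀ ⊂ C₁ ⊂ ⋯` by differential graded `𝒟`-subalgebras such that the structure map goes
`C₋₁ := A → C₀`, that `C_k ≅ C_{k-1} ⊗ 𝒮V_k` for a projective graded `𝒟`-submodule `V_k` of
`C_k`, and that `d V_k ⊂ C_{k-1}`, for all `k ≥ 0`. -/
def DGADA.IsSullivanType {A : DGDA.{v, u, w₁} K O} (C : DGADA.{v, u, w₁, w₂} A) : Prop :=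
  ∃ (F : ℕ → DGDSub C.toDGDA) (V : ℕ → Submodule (DiffOp K O) C.carrier),
    (∀ k, (F k).toSubalgebra ≤ (F (k + 1)).toSubalgebra) ∧
    (∀ c : C.carrier, ∃ k, c ∈ (F k).toSubalgebra) ∧
    (∀ a : A.carrier, C.structureMap a ∈ (F 0).toSubalgebra) ∧
    IsSymExtension C.structureMap (V 0) (F 0) ∧
    (∀ x ∈ V 0, C.d x ∈ LinearMap.range C.structureMap) ∧
    (∀ k, IsSymExtension (F k).toSubalgebra.val.toLinearMap (V (k + 1)) (F (k + 1))) ∧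
    (∀ k, ∀ x ∈ V (k + 1), C.d x ∈ (F k).toSubalgebra)

/-- `ψ : C → B` is a `𝒟`-geometric Koszul-Tate resolution of `φ : A → B`: `C` is a differential
graded `A[𝒟]`-algebra of Sullivan type, and `ψ` is a morphism of differential graded
`A[𝒟]`-algebras (`B` being one through `φ`) that is a quasi-isomorphism. -/
structure IsDGeometricKTR {A : DGDA.{v, u, w₁} K O} {B : DGDA.{v, u, w₂} K O} (φ : DGDHom A B)
    (C : DGADA.{v, u, w₁, w₃} A) (ψ : DGDHom C.toDGDA B) : Prop where
  sullivanType : C.IsSullivanType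
  linear : DGADA.IsALinear C (DGADA.ofHom φ) ψ
  quasiIso : ψ.IsQuasiIso

end Basics

end

noncomputable section

/-! # Vector fields on a smooth affine variety -/

section Smooth

open KaehlerDifferential

variable (K : Type v) (O : Type u) [Field K] [CommRing O] [Algebra K O]

/-! Existence. The resolution is the free algebra `J ⊗ 𝒮V` on one generator for every triple of a
degree, a prospective boundary and a prospective image in `Q`. Every cycle `r` of the resolution
whose image is `d b` is then the boundary of a generator with image `b` (`exists_generator`). This
one property gives injectivity in homology, surjectivity in homology (take `r = 0`) and surjectivity
in positive degrees (take for `r` a generator lying over `d b`). The construction looks circular,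
because boundaries are elements of the algebra that the generators are to generate. The circle is
broken by syntax: `ResExpr` is an inductive type of formal expressions, whose boundary and image are
computed by recursion, and triples that do not fit together get boundary and image zero. Since the
differential lowers the degree, every well-ordering of the generators that refines the degree makes
the inclusion of `J` minimal Sullivan.

For `J ⊗ 𝒮V` to be an object of `DG𝒟A`, the Leibniz action of vector fields must extend to `𝒟`. As
`𝒟` is defined by operators on `O` and not by a presentation, it has to be shown that a combination
of functions and vector fields that vanishes on `O` vanishes on every module with a flat connection
(`Fil.eq_zero_of_fst`). This is an induction on the order: the commutators with functions vanish by
induction, while an Euler operator recovers the top-order part from these commutators, up to a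
nonzero integer factor and lower order.

Sullivan type. Filter `J ⊗ 𝒮V` by the degree of the generators: `C_k` is generated by those of
degree at most `k`, and `V_k` is the `𝒟`-span of those of degree exactly `k`. Then `d V_k ⊂ C_{k-1}`
for degree reasons. The isomorphism `C_{k-1} ⊗ 𝒮V_k ≅ C_k` rests on `splitMap_injective` and
`range_splitMap`. Projectivity of `V_k` (`projective_genSpan`) needs care: the free module `V` need
not embed in `J ⊗ 𝒮V`, since `O → J` may have a kernel. This kernel is an ideal stable under all
vector fields, and on a smooth variety such an ideal is generated by an idempotent `e`
(`exists_idempotent_of_stable`). Idempotents are central in `𝒟`, so `V_k` is a direct sum of copies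
of the summand `𝒟(1 - e)` of `𝒟`. -/

/-- On a smooth affine variety there are finitely many functions `x` and vector fields `θ_x`
with `dg = ∑ₓ θ_x(g) dx` for every function `g`. -/
theorem exists_dual_basis [Algebra.Smooth K O] : ∃ (s : Finset O) (θ : s → Derivation K O O),
    ∀ g : O, D K O g = ∑ x : s, θ x g • D K O (x : O) := by
  classical
  have hfg : (Submodule.span O (Set.range (D K O))).FG := by
    rw [span_range_derivation]; exact Module.Finite.fg_top
  -- Finitely many generators of the differentials can be chosen among the exact ones.
  obtain ⟨t, ht, hts⟩ := (Submodule.fg_span_iff_fg_span_finset_subset _).1 hfg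
  choose! c hc using fun y (hy : y ∈ t) => ht hy
  let s : Finset O := t.image c
  have hspan : Submodule.span O (Set.range fun x : s => D K O (x : O)) = ⊤ := by
    rw [eq_top_iff, ← span_range_derivation, hts, Submodule.span_le]
    intro y hy
    refine Submodule.subset_span ⟨⟨c y, Finset.mem_image_of_mem _ hy⟩, hc y hy⟩
  have hsurj : Function.Surjective
      (Fintype.linearCombination O (fun x : s => D K O (x : O))) := by
    rw [← LinearMap.range_eq_top, Fintype.range_linearCombination, hspan]
  -- The module of differentials is projective, so the surjection splits; the coordinates of the
  -- section, composed with the universal derivation, are the vector fields.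
  obtain ⟨σ, hσ⟩ := Module.projective_lifting_property _ (LinearMap.id : Ω[O⁄K] →ₗ[O] Ω[O⁄K]) hsurj
  refine ⟨s, fun x => ((LinearMap.proj x).comp σ).compDer (D K O), fun g => ?_⟩
  have h := LinearMap.congr_fun hσ (D K O g)
  simp only [LinearMap.comp_apply, Fintype.linearCombination_apply, LinearMap.id_apply] at h
  exact h.symm

variable {K O}

/-- Apply to the dual basis identity the `O`-linear functional on differentials that corresponds to
`η`. -/
theorem derivation_eq_sum {s : Finset O} {θ : s → Derivation K O O}
    (hθ : ∀ g : O, D K O g = ∑ x : s, θ x g • D K O (x : O)) (η : Derivation K O O) :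
    η = ∑ x : s, η (x : O) • θ x := by
  ext g
  have h := congrArg η.liftKaehlerDifferential (hθ g)
  simp only [map_sum, map_smul, Derivation.liftKaehlerDifferential_comp_D] at h
  rw [h]
  refine Eq.trans ?_ (congrFun (map_sum Derivation.coeFnAddMonoidHom
    (fun x : s => η (x : O) • θ x) Finset.univ) g).symm
  simp [mul_comm, Finset.sum_apply]

/-- An Euler vector field at a maximal ideal `m`, as an `m`-valued map on differentials. -/
theorem exists_euler [Algebra.Smooth K O] [CharZero K] (m : Ideal O) [m.IsMaximal] :
    ∃ E : Ω[O⁄K] →ₗ[O] O, (∀ ω, E ω ∈ m) ∧ ∀ g ∈ m, E (D K O g) - g ∈ m ^ 2 := by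
  let _ := Ideal.Quotient.field m
  -- The residue field is formally smooth over `K` because the characteristic is zero; hence the
  -- conormal map from `m/m²` to the differentials over the residue field has a retraction `l`.
  have hsm : Algebra.FormallySmooth K (O ⧸ m) := inferInstance
  have hsurj : Function.Surjective (algebraMap O (O ⧸ m)) := Ideal.Quotient.mk_surjective
  obtain ⟨l, hl⟩ := (Algebra.FormallySmooth.iff_split_injection (R := K) hsurj).1 hsm
  let I := RingHom.ker (algebraMap O (O ⧸ m))
  have hIm : I = m := Ideal.mk_ker
  -- Projectivity of the differentials lifts `l` through `m → m/m²`.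
  obtain ⟨E, hE⟩ := Module.projective_lifting_property I.toCotangent
    (l ∘ₗ TensorProduct.mk O (O ⧸ m) Ω[O⁄K] 1) I.toCotangent_surjective
  refine ⟨I.subtype ∘ₗ E, fun ω => hIm ▸ (E ω).2, fun g hg => ?_⟩
  have hg' : g ∈ I := hIm ▸ hg
  have h1 := LinearMap.congr_fun hE (D K O g)
  have h2 := LinearMap.congr_fun hl (I.toCotangent ⟨g, hg'⟩)
  simp only [LinearMap.comp_apply, LinearMap.id_apply, TensorProduct.mk_apply] at h1 h2
  have h3 := h1.trans h2
  rw [Ideal.toCotangent_eq] at h3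
  rwa [← hIm]

/-- The derivation `g ↦ E (dg)` induces the identity on `m/m²`, so by the Leibniz rule it is
multiplication by `n` on `mⁿ/mⁿ⁺¹`. -/
theorem euler_pow {m : Ideal O} {E : Ω[O⁄K] →ₗ[O] O} (hE : ∀ g ∈ m, E (D K O g) - g ∈ m ^ 2)
    (hEm : ∀ ω, E ω ∈ m) (n : ℕ) : ∀ g ∈ m ^ n, E (D K O g) - n * g ∈ m ^ (n + 1) := by
  induction n with
  | zero => intro g _; simpa using hEm _
  | succ n ih =>
    intro g hg
    rw [pow_succ] at hg
    refine Submodule.mul_induction_on hg (fun b hb a ha => ?_) (fun x y hx hy => ?_)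
    · have h1 : a * (E (D K O b) - n * b) ∈ m ^ (n + 1 + 1) := by
        rw [pow_succ' m (n + 1)]; exact Ideal.mul_mem_mul ha (ih b hb)
      have h2 : b * (E (D K O a) - a) ∈ m ^ (n + 1 + 1) := by
        rw [show n + 1 + 1 = n + 2 from rfl, pow_add m n 2]; exact Ideal.mul_mem_mul hb (hE a ha)
      have h3 : E (D K O (b * a)) - ((n + 1 : ℕ) : O) * (b * a)
          = b * (E (D K O a) - a) + a * (E (D K O b) - n * b) := by
        simp only [Derivation.leibniz, map_add, map_smul, smul_eq_mul]; push_cast; ring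
      rw [h3]; exact add_mem h2 h1
    · have h3 : E (D K O (x + y)) - ((n + 1 : ℕ) : O) * (x + y)
          = (E (D K O x) - ((n + 1 : ℕ) : O) * x) + (E (D K O y) - ((n + 1 : ℕ) : O) * y) := by
        simp only [map_add]; ring
      rw [h3]; exact add_mem hx hy

/-- An ideal of functions stable under all vector fields lies in all powers of every maximal ideal
containing it. -/
theorem le_pow_of_stable [Algebra.Smooth K O] [CharZero K] {a : Ideal O}
    (ha : ∀ (θ : Derivation K O O), ∀ g ∈ a, θ g ∈ a) (m : Ideal O) [m.IsMaximal] (ham : a ≤ m)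
    (n : ℕ) : a ≤ m ^ (n + 1) := by
  obtain ⟨s, θ, hθ⟩ := exists_dual_basis K O
  obtain ⟨E, hEm, hE⟩ := exists_euler (K := K) m
  induction n with
  | zero => simpa using ham
  | succ n ih =>
    intro g hg
    have h1 := euler_pow hE hEm (n + 1) g (ih hg)
    -- Expand `dg = ∑ θ_x(g) dx`: stability keeps `θ_x(g)` in the ideal, hence in `m ^ (n + 1)`, and
    -- `E (dx) ∈ m` contributes one more power.
    have h2 : E (D K O g) ∈ m ^ (n + 1 + 1) := by
      rw [hθ g, map_sum]
      refine Submodule.sum_mem _ fun x _ => ?_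
      rw [map_smul, smul_eq_mul, pow_succ]
      exact Ideal.mul_mem_mul (ih (ha _ _ hg)) (hEm _)
    have h3 : ((n + 1 : ℕ) : O) * g ∈ m ^ (n + 1 + 1) := by
      have := sub_mem h2 h1; rwa [sub_sub_cancel] at this
    have h4 : algebraMap K O ((n + 1 : ℕ) : K)⁻¹ * (((n + 1 : ℕ) : O) * g) = g := by
      have : ((n + 1 : ℕ) : O) = algebraMap K O ((n + 1 : ℕ) : K) := by simp
      rw [this, ← mul_assoc, ← map_mul, inv_mul_cancel₀ (Nat.cast_ne_zero.2 n.succ_ne_zero),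
        map_one, one_mul]
    rw [← h4]
    exact Ideal.mul_mem_left _ _ h3

/-- An ideal of functions stable under all vector fields is generated by an idempotent. -/
theorem exists_idempotent_of_stable [Algebra.Smooth K O] [CharZero K] {a : Ideal O}
    (ha : ∀ (θ : Derivation K O O), ∀ g ∈ a, θ g ∈ a) :
    ∃ e : O, IsIdempotentElem e ∧ a = Ideal.span {e} := by
  have : IsNoetherianRing O := Algebra.FiniteType.isNoetherianRing K O
  refine (Ideal.isIdempotentElem_iff_of_fg a (IsNoetherian.noetherian a)).1 ?_
  refine le_antisymm Ideal.mul_le_left fun f hf => ?_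
  let N : Ideal O := LinearMap.ker (LinearMap.mulLeft O f)
  -- A maximal ideal `m` containing both the annihilator of `f` and `a` would have `f` in all its
  -- powers. By Krull's intersection theorem some `1 - r` with `r ∈ m` would then kill `f`, hence
  -- lie in `m`, which is absurd.
  have hsup : N ⊔ a = ⊤ := by
    by_contra hne
    obtain ⟨m, hm, hle⟩ := Ideal.exists_le_maximal _ hne
    have hmem : f ∈ (⨅ i : ℕ, m ^ i • ⊤ : Submodule O O) := by
      refine (Submodule.mem_iInf _).2 fun i => ?_
      rw [smul_eq_mul, Ideal.mul_top]
      exact Ideal.pow_le_pow_right (Nat.le_succ i)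
        (le_pow_of_stable ha m (le_sup_right.trans hle) i hf)
    obtain ⟨r, hr⟩ := (Ideal.mem_iInf_smul_pow_eq_bot_iff m f).1 hmem
    have h1 : 1 - (r : O) ∈ N := by
      rw [LinearMap.mem_ker, LinearMap.mulLeft_apply]
      rw [smul_eq_mul] at hr
      rw [mul_sub, mul_one, mul_comm, hr, sub_self]
    have h2 : (1 : O) ∈ m := by
      have := add_mem (hle (Ideal.mem_sup_left h1)) r.2
      rwa [sub_add_cancel] at this
    exact hm.ne_top ((Ideal.eq_top_iff_one m).2 h2)
  obtain ⟨n, hn, b, hb, hnb⟩ := Submodule.mem_sup.1 ((Ideal.eq_top_iff_one _).1 hsup)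
  have h1 : f * n = 0 := hn
  have h2 : f = f * b := by
    conv_lhs => rw [← mul_one f, ← hnb, mul_add, h1, zero_add]
  rw [h2]
  exact Ideal.mul_mem_mul hf hb

end Smooth

end


noncomputable section

/-! # `𝒟`-modules from flat connections -/

section Connection

/-- A flat connection on an `O`-module: an `O`-linear action of the vector fields that satisfies
the Leibniz rule and is compatible with the brackets. -/
structure FlatConnection (K : Type v) (O : Type u) [Field K] [CommRing O] [Algebra K O]
    (M : Type w) [AddCommGroup M] [Module O M] where
  nabla : Derivation K O O → AddMonoid.End M
  nabla_add : ∀ θ η m, nabla (θ + η) m = nabla θ m + nabla η m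
  nabla_smul : ∀ (f : O) θ m, nabla (f • θ) m = f • nabla θ m
  leibniz : ∀ θ (f : O) m, nabla θ (f • m) = θ f • m + f • nabla θ m
  flat : ∀ θ η m, nabla ⁅θ, η⁆ m = nabla θ (nabla η m) - nabla η (nabla θ m)

namespace FlatConnection

variable {K : Type v} {O : Type u} [Field K] [CommRing O] [Algebra K O]
  {M : Type w} [AddCommGroup M] [Module O M] (C : FlatConnection K O M)

/-- Pairs of a `K`-linear operator on `O` and an additive operator on `M`. -/
abbrev Op (K : Type v) (O : Type u) [Field K] [CommRing O] [Algebra K O]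
    (M : Type w) [AddCommGroup M] : Type (max u w) :=
  Module.End K O × AddMonoid.End M

variable (K M) in
/-- A function as a pair of operators. -/
def fn : O →+* Op K O M where
  toFun f := (LinearMap.mulLeft K f, DistribSMul.toAddMonoidHom M f)
  map_one' := Prod.ext (LinearMap.ext fun x => one_mul x) (AddMonoidHom.ext fun x => one_smul O x)
  map_mul' f g := Prod.ext (LinearMap.ext fun x => mul_assoc f g x)
    (AddMonoidHom.ext fun x => mul_smul f g x)
  map_zero' := Prod.ext (LinearMap.ext fun x => zero_mul x)
    (AddMonoidHom.ext fun x => zero_smul O x)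
  map_add' f g := Prod.ext (LinearMap.ext fun x => add_mul f g x)
    (AddMonoidHom.ext fun x => add_smul f g x)

/-- A vector field as a pair of operators. -/
def vec (θ : Derivation K O O) : Op K O M := ((θ : O →ₗ[K] O), C.nabla θ)

theorem vec_mul_fn (θ : Derivation K O O) (f : O) :
    C.vec θ * fn K M f = fn K M (θ f) + fn K M f * C.vec θ := by
  refine Prod.ext (LinearMap.ext fun x => ?_) (AddMonoidHom.ext fun x => C.leibniz θ f x)
  change θ (f * x) = θ f * x + f * θ x
  rw [Derivation.leibniz, smul_eq_mul, smul_eq_mul, mul_comm x, add_comm]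

theorem vec_mul_vec (θ η : Derivation K O O) :
    C.vec θ * C.vec η = C.vec η * C.vec θ + C.vec ⁅θ, η⁆ := by
  refine Prod.ext (LinearMap.ext fun x => ?_) (AddMonoidHom.ext fun x => ?_)
  · change θ (η x) = η (θ x) + ⁅θ, η⁆ x
    rw [Derivation.commutator_apply]; abel
  · change C.nabla θ (C.nabla η x) = C.nabla η (C.nabla θ x) + C.nabla ⁅θ, η⁆ x
    rw [C.flat]; abel

theorem vec_add (θ η : Derivation K O O) : C.vec (θ + η) = C.vec θ + C.vec η :=
  Prod.ext rfl (AddMonoidHom.ext fun x => C.nabla_add θ η x)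

theorem vec_smul (f : O) (θ : Derivation K O O) : C.vec (f • θ) = fn K M f * C.vec θ :=
  Prod.ext (LinearMap.ext fun _ => rfl) (AddMonoidHom.ext fun x => C.nabla_smul f θ x)

theorem vec_sum {ι : Type*} (s : Finset ι) (f : ι → O) (θ : ι → Derivation K O O) :
    C.vec (∑ i ∈ s, f i • θ i) = ∑ i ∈ s, fn K M (f i) * C.vec (θ i) := by
  let V : Derivation K O O →+ Op K O M := AddMonoidHom.mk' C.vec C.vec_add
  exact (map_sum V _ s).trans (Finset.sum_congr rfl fun i _ => C.vec_smul _ _)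

/-- Operators of order `< n`. -/
inductive Fil : ℕ → Op K O M → Prop
  | zero : Fil 0 0
  | ofFn (f : O) : Fil 1 (fn K M f)
  | add {n a b} : Fil n a → Fil n b → Fil n (a + b)
  | succ {n a} : Fil n a → Fil (n + 1) a
  | mulVec {n a} (θ : Derivation K O O) : Fil n a → Fil (n + 1) (a * C.vec θ)

variable {C}

theorem Fil.eq_zero {n : ℕ} {a : Op K O M} (h : C.Fil n a) (hn : n = 0) : a = 0 := by
  induction h with
  | zero => rfl
  | add _ _ h1 h2 => rw [h1 hn, h2 hn, add_zero]
  | ofFn => omega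
  | succ => omega
  | mulVec => omega

theorem Fil.zero' (n : ℕ) : C.Fil n 0 := by
  induction n with
  | zero => exact .zero
  | succ n ih => exact ih.succ

theorem Fil.eq_fn {n : ℕ} {a : Op K O M} (h : C.Fil n a) (hn : n = 1) : ∃ f, a = fn K M f := by
  induction h with
  | zero => omega
  | add _ _ h1 h2 =>
    obtain ⟨f, rfl⟩ := h1 hn
    obtain ⟨g, rfl⟩ := h2 hn
    exact ⟨f + g, (map_add _ _ _).symm⟩
  | ofFn f => exact ⟨f, rfl⟩
  | succ h => exact ⟨0, by rw [h.eq_zero (by omega), map_zero]⟩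
  | mulVec θ h => exact ⟨0, by rw [h.eq_zero (by omega), map_zero, zero_mul]⟩

theorem Fil.fn_mul {n : ℕ} {a : Op K O M} (h : C.Fil n a) (f : O) : C.Fil n (fn K M f * a) := by
  induction h with
  | zero => rw [mul_zero]; exact .zero
  | ofFn g => rw [← map_mul]; exact .ofFn _
  | add _ _ h1 h2 => rw [mul_add]; exact h1.add h2
  | succ _ h1 => exact h1.succ
  | mulVec θ _ h1 => rw [← mul_assoc]; exact h1.mulVec θ

theorem Fil.neg {n : ℕ} {a : Op K O M} (h : C.Fil n a) : C.Fil n (-a) := by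
  have h1 : fn K M (-1) * a = -a := by
    rw [map_neg, map_one]; exact neg_one_mul a
  exact h1 ▸ h.fn_mul (-1)

theorem Fil.sub {n : ℕ} {a b : Op K O M} (h : C.Fil n a) (h' : C.Fil n b) : C.Fil n (a - b) := by
  rw [sub_eq_add_neg]; exact h.add h'.neg

theorem Fil.mul_fn {n : ℕ} {a : Op K O M} (h : C.Fil n a) (f : O) : C.Fil n (a * fn K M f) := by
  induction h generalizing f with
  | zero => rw [zero_mul]; exact .zero
  | ofFn g => rw [← map_mul]; exact .ofFn _
  | add _ _ h1 h2 => rw [add_mul]; exact (h1 f).add (h2 f)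
  | succ _ h1 => exact (h1 f).succ
  | mulVec θ _ h1 =>
    rw [mul_assoc, vec_mul_fn, mul_add, ← mul_assoc]
    exact (h1 _).succ.add ((h1 f).mulVec θ)

theorem Fil.sum {ι : Type*} {n : ℕ} (s : Finset ι) {a : ι → Op K O M}
    (h : ∀ i, C.Fil n (a i)) : C.Fil n (∑ i ∈ s, a i) := by
  classical
  induction s using Finset.induction_on with
  | empty => rw [Finset.sum_empty]; exact .zero' n
  | insert i s hi ih => rw [Finset.sum_insert hi]; exact (h i).add ih

theorem Fil.mono {m n : ℕ} {a : Op K O M} (h : C.Fil m a) (hmn : m ≤ n) : C.Fil n a := by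
  induction hmn with
  | refl => exact h
  | step _ ih => exact ih.succ

theorem Fil.mul {m n : ℕ} {a b : Op K O M} (ha : C.Fil m a) (hb : C.Fil n b) :
    C.Fil (m + n) (a * b) := by
  induction hb with
  | zero => rw [mul_zero]; exact .zero' _
  | ofFn g => exact (ha.mul_fn g).succ
  | add _ _ h1 h2 => rw [mul_add]; exact h1.add h2
  | succ _ h1 => exact h1.succ
  | mulVec θ _ h1 => rw [← mul_assoc]; exact h1.mulVec θ

/-- Each vector field contributes `[θ, f] = θ(f)`, a function, in place of an operator of order one.
The truncated subtraction is harmless, since `Fil 0` contains only zero. -/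
theorem Fil.comm_fn {n : ℕ} {a : Op K O M} (h : C.Fil n a) (f : O) :
    C.Fil (n - 1) (a * fn K M f - fn K M f * a) := by
  induction h with
  | zero => simpa using Fil.zero
  | ofFn g => rw [← map_mul, ← map_mul, mul_comm, sub_self]; exact .zero' _
  | add _ _ h1 h2 =>
    rw [add_mul, mul_add, add_sub_add_comm]; exact h1.add h2
  | succ _ h1 => exact h1.mono (by omega)
  | @mulVec n a θ ha h1 =>
    have h2 : a * C.vec θ * fn K M f - fn K M f * (a * C.vec θ)
        = a * fn K M (θ f) + (a * fn K M f - fn K M f * a) * C.vec θ := by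
      rw [mul_assoc, vec_mul_fn]; simp only [mul_add, sub_mul, mul_assoc]; abel
    rw [h2]
    obtain _ | n := n
    · rw [ha.eq_zero rfl]; simpa using Fil.zero
    · exact (ha.mul_fn _).add (h1.mulVec θ)

/-! ### The Euler operator and faithfulness of the action on functions -/

section Euler

variable {s : Finset O} {θ : s → Derivation K O O}

variable (C θ) in
/-- The operator `a ↦ ∑ₓ [a, x] θ_x`, which multiplies the principal symbols by the order. -/
def eulerOp (a : Op K O M) : Op K O M :=
  ∑ x : s, (a * fn K M (x : O) - fn K M (x : O) * a) * C.vec (θ x)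

theorem eulerOp_add (a b : Op K O M) : C.eulerOp θ (a + b) = C.eulerOp θ a + C.eulerOp θ b := by
  simp only [eulerOp, ← Finset.sum_add_distrib]
  exact Finset.sum_congr rfl fun x _ => by simp only [add_mul, mul_add, sub_mul, mul_assoc]; abel

/-- On principal symbols the Euler operator is `∑ ∂/∂ξ_x · ξ_x`, which multiplies a symbol of degree
`n - 1` by `n - 1`; the induction adds one vector field at a time. -/
theorem Fil.euler (hθ : ∀ η : Derivation K O O, η = ∑ x : s, η (x : O) • θ x)
    {n : ℕ} {a : Op K O M} (h : C.Fil n a) :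
    C.Fil (n - 1) ((n - 1) • a - C.eulerOp θ a) := by
  induction h with
  | zero => simpa [eulerOp] using Fil.zero
  | ofFn g =>
    have h0 : C.eulerOp θ (fn K M g) = 0 :=
      Finset.sum_eq_zero fun x _ => by rw [← map_mul, ← map_mul, mul_comm, sub_self, zero_mul]
    rw [h0]; simpa using Fil.zero
  | add _ _ h1 h2 => rw [eulerOp_add, nsmul_add, add_sub_add_comm]; exact h1.add h2
  | @succ n a ha h1 =>
    obtain _ | n := n
    · rw [ha.eq_zero rfl]; simpa [eulerOp] using Fil.zero
    · have : (n + 1 + 1 - 1) • a - C.eulerOp θ a = a + ((n + 1 - 1) • a - C.eulerOp θ a) := by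
        rw [Nat.add_sub_cancel, Nat.add_sub_cancel, succ_nsmul]; abel
      rw [this]
      exact ha.add h1.succ
  | @mulVec n b η hb h1 =>
    -- Here `[b η, x] = b η(x) + [b, x] η`. The first terms sum to `b η` by the dual basis identity;
    -- in the others, moving `η` past `θ_x` costs a bracket, which is again a vector field and so
    -- only a term of lower order.
    have h2 : C.eulerOp θ (b * C.vec η) = b * C.vec η + C.eulerOp θ b * C.vec η
        + ∑ x : s, (b * fn K M (x : O) - fn K M (x : O) * b)
          * C.vec ⁅η, θ x⁆ := by
      have h3 : b * C.vec η = ∑ x : s, b * (fn K M (η (x : O)) * C.vec (θ x)) := by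
        conv_lhs => rw [hθ η, vec_sum, Finset.mul_sum]
      rw [h3, eulerOp, eulerOp, Finset.sum_mul,
        ← Finset.sum_add_distrib, ← Finset.sum_add_distrib, ← h3]
      refine Finset.sum_congr rfl fun x _ => ?_
      have h4 : b * C.vec η * fn K M (x : O)
          = b * fn K M (η (x : O))
            + b * fn K M (x : O) * C.vec η := by
        rw [mul_assoc, vec_mul_fn, mul_add, mul_assoc]
      have h5 : C.vec ⁅η, θ x⁆ = C.vec η * C.vec (θ x) - C.vec (θ x) * C.vec η := by
        rw [vec_mul_vec C η]; abel
      rw [h4, h5]; simp only [add_mul, mul_sub, sub_mul, mul_assoc]; abel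
    obtain _ | n := n
    · rw [hb.eq_zero rfl]; simpa [eulerOp] using Fil.zero
    · have h6 : (n + 1 + 1 - 1) • (b * C.vec η) - C.eulerOp θ (b * C.vec η)
          = ((n + 1 - 1) • b - C.eulerOp θ b) * C.vec η
            - ∑ x : s, (b * fn K M (x : O) - fn K M (x : O) * b)
              * C.vec ⁅η, θ x⁆ := by
        rw [h2, Nat.add_sub_cancel, Nat.add_sub_cancel, succ_nsmul, sub_mul, smul_mul_assoc]
        abel
      rw [h6]
      exact (h1.mulVec η).sub (Fil.sum _ fun x => (hb.comm_fn _).mulVec _)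

/-- An operator built from functions and vector fields that vanishes on `O` vanishes on `M`. -/
theorem Fil.eq_zero_of_fst [CharZero K]
    (hθ : ∀ η : Derivation K O O, η = ∑ x : s, η (x : O) • θ x) (n : ℕ) :
    ∀ a : Op K O M, C.Fil n a → a.1 = 0 → a = 0 := by
  induction n with
  | zero => exact fun a ha _ => ha.eq_zero rfl
  | succ n ih =>
    intro a ha h0
    -- The commutators have lower order and still vanish on `O`, so the induction hypothesis kills
    -- them, and with them the Euler operator at `a`.
    have h1 : ∀ f : O, a * fn K M f - fn K M f * a = 0 := fun f =>
      ih _ (ha.comm_fn f) (by rw [Prod.fst_sub, Prod.fst_mul, Prod.fst_mul, h0]; simp)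
    have h2 : C.eulerOp θ a = 0 := Finset.sum_eq_zero fun x _ => by rw [h1, zero_mul]
    obtain _ | n := n
    · obtain ⟨f, rfl⟩ := ha.eq_fn rfl
      have : f = 0 := by
        have := LinearMap.congr_fun h0 1
        simpa [fn] using this
      rw [this, map_zero]
    -- With the Euler term gone, `(n + 1) • a` itself has lower order; it vanishes by induction, and
    -- `n + 1` is invertible in characteristic zero.
    · have h3 := ha.euler hθ
      rw [h2, sub_zero] at h3
      have h4 := ih _ h3 (by rw [Prod.smul_fst, h0, smul_zero])
      rw [Nat.add_sub_cancel] at h4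
      have h5 : fn K M (algebraMap K O ((n + 1 : ℕ) : K)⁻¹) * ((n + 1) • a) = a := by
        have h6 : (n + 1) • a = fn K M (algebraMap K O ((n + 1 : ℕ) : K)) * a := by
          rw [map_natCast, map_natCast, nsmul_eq_mul]
        rw [h6, ← mul_assoc, ← map_mul, ← map_mul, inv_mul_cancel₀ (Nat.cast_ne_zero.2 n.succ_ne_zero),
          map_one, map_one, one_mul]
      rw [← h5, h4, mul_zero]

end Euler

/-- The generators of `𝒟` lift to pairs, and the pairs of finite order are closed under sums and
products. That the lift is unique is `Fil.ext_fst`, so choosing one gives a ring homomorphism. -/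
theorem exists_lift (C : FlatConnection K O M) (P : DiffOp K O) :
    ∃ a : Op K O M, (∃ n, C.Fil n a) ∧ a.1 = P.1 := by
  obtain ⟨P, hP⟩ := P
  induction hP using Algebra.adjoin_induction with
  | mem x hx =>
    rcases hx with ⟨f, rfl⟩ | ⟨θ, rfl⟩
    · exact ⟨fn K M f, ⟨1, .ofFn f⟩, rfl⟩
    -- `Fil n` bounds the order strictly by `n`, whence the index 2 for a vector field.
    · exact ⟨C.vec θ, ⟨2, by simpa using (Fil.ofFn (C := C) 1).mulVec θ⟩, rfl⟩
  | algebraMap r =>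
    refine ⟨fn K M (algebraMap K O r), ⟨1, .ofFn _⟩, LinearMap.ext fun x => ?_⟩
    exact (Algebra.smul_def r x).symm
  | add x y hx hy h1 h2 =>
    obtain ⟨a, ⟨m, ha⟩, hax⟩ := h1
    obtain ⟨b, ⟨n, hb⟩, hby⟩ := h2
    exact ⟨a + b, ⟨max m n, (ha.mono (le_max_left _ _)).add (hb.mono (le_max_right _ _))⟩,
      congrArg₂ (· + ·) hax hby⟩
  | mul x y hx hy h1 h2 =>
    obtain ⟨a, ⟨m, ha⟩, hax⟩ := h1
    obtain ⟨b, ⟨n, hb⟩, hby⟩ := h2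
    exact ⟨a * b, ⟨m + n, ha.mul hb⟩, congrArg₂ (· * ·) hax hby⟩

theorem Fil.ext_fst [CharZero K] [Algebra.Smooth K O] {a b : Op K O M} (ha : ∃ n, C.Fil n a)
    (hb : ∃ n, C.Fil n b) (h : a.1 = b.1) : a = b := by
  obtain ⟨m, ha⟩ := ha
  obtain ⟨n, hb⟩ := hb
  obtain ⟨s, θ, hθ⟩ := exists_dual_basis K O
  refine sub_eq_zero.1 (Fil.eq_zero_of_fst (derivation_eq_sum hθ) (max m n) _
    ((ha.mono (le_max_left _ _)).sub (hb.mono (le_max_right _ _))) ?_)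
  rw [Prod.fst_sub, h, sub_self]

variable [CharZero K] [Algebra.Smooth K O]

/-- The action of the differential operators on a module with a flat connection. -/
def toRingHom (C : FlatConnection K O M) : DiffOp K O →+* AddMonoid.End M where
  toFun P := (C.exists_lift P).choose.2
  map_one' := by
    have h := (C.exists_lift 1).choose_spec
    have h1 : C.Fil 1 (fn K M (1 : O)) := .ofFn 1
    rw [map_one] at h1
    rw [Fil.ext_fst h.1 ⟨1, h1⟩ h.2]; rfl
  map_mul' P Q := by
    have h := (C.exists_lift (P * Q)).choose_spec
    obtain ⟨⟨m, hP⟩, hP'⟩ := (C.exists_lift P).choose_spec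
    obtain ⟨⟨n, hQ⟩, hQ'⟩ := (C.exists_lift Q).choose_spec
    rw [Fil.ext_fst h.1 ⟨m + n, hP.mul hQ⟩ (h.2.trans (congrArg₂ (· * ·) hP' hQ').symm)]; rfl
  map_zero' := by
    have h := (C.exists_lift 0).choose_spec
    rw [Fil.ext_fst h.1 ⟨0, .zero⟩ h.2]; rfl
  map_add' P Q := by
    have h := (C.exists_lift (P + Q)).choose_spec
    obtain ⟨⟨m, hP⟩, hP'⟩ := (C.exists_lift P).choose_spec
    obtain ⟨⟨n, hQ⟩, hQ'⟩ := (C.exists_lift Q).choose_spec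
    rw [Fil.ext_fst h.1
      ⟨max m n, (hP.mono (le_max_left _ _)).add (hQ.mono (le_max_right _ _))⟩
      (h.2.trans (congrArg₂ (· + ·) hP' hQ').symm)]; rfl

theorem toRingHom_ofFun (C : FlatConnection K O M) (f : O) (m : M) :
    C.toRingHom (DiffOp.ofFun K f) m = f • m := by
  have h := (C.exists_lift (DiffOp.ofFun K f)).choose_spec
  exact congrArg (fun a : Op K O M => a.2 m) (Fil.ext_fst h.1 ⟨1, .ofFn f⟩ h.2)

theorem toRingHom_ofVec (C : FlatConnection K O M) (θ : Derivation K O O) (m : M) :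
    C.toRingHom (DiffOp.ofVec K θ) m = C.nabla θ m := by
  have h := (C.exists_lift (DiffOp.ofVec K θ)).choose_spec
  exact congrArg (fun a : Op K O M => a.2 m)
    (Fil.ext_fst h.1 ⟨2, by simpa using (Fil.ofFn (C := C) 1).mulVec θ⟩ h.2)

end FlatConnection

end Connection

end


noncomputable section

/-! # Generation of `𝒟` by functions and vector fields -/

namespace DiffOp

variable {K : Type v} {O : Type u} [Field K] [CommRing O] [Algebra K O]

theorem induction {p : DiffOp K O → Prop} (hf : ∀ f, p (ofFun K f)) (hv : ∀ θ, p (ofVec K θ))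
    (hadd : ∀ P Q, p P → p Q → p (P + Q)) (hmul : ∀ P Q, p P → p Q → p (P * Q))
    (P : DiffOp K O) : p P := by
  obtain ⟨P, hP⟩ := P
  induction hP using Algebra.adjoin_induction with
  | mem x hx =>
    rcases hx with ⟨f, rfl⟩ | ⟨θ, rfl⟩
    · exact hf f
    · exact hv θ
  | algebraMap r =>
    have h : ofFun K (algebraMap K O r) = ⟨_, Subalgebra.algebraMap_mem _ r⟩ :=
      Subtype.ext (LinearMap.ext fun x => (Algebra.smul_def r x).symm)
    exact h ▸ hf (algebraMap K O r)
  | add x y hx hy h1 h2 => exact hadd _ _ h1 h2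
  | mul x y hx hy h1 h2 => exact hmul _ _ h1 h2

section Module

variable {M : Type*} [AddCommGroup M] [Module O M] [Module (DiffOp K O) M]
  [IsScalarTower O (DiffOp K O) M]

variable (K) in
theorem ofFun_smul (f : O) (m : M) : ofFun K f • m = f • m := by
  have h := smul_assoc f (1 : DiffOp K O) m
  rwa [smul_eq, mul_one, one_smul] at h

theorem ofVec_smul_smul (θ : Derivation K O O) (f : O) (m : M) :
    ofVec K θ • (f • m) = θ f • m + f • (ofVec K θ • m) := by
  have h : ofVec K θ * ofFun K f = ofFun K (θ f) + ofFun K f * ofVec K θ := by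
    refine Subtype.ext (LinearMap.ext fun x => ?_)
    change θ (f * x) = θ f * x + f * θ x
    rw [Derivation.leibniz, smul_eq_mul, smul_eq_mul, mul_comm x, add_comm]
  rw [← ofFun_smul K f m, ← mul_smul, h, add_smul, mul_smul, ofFun_smul, ofFun_smul]

theorem ofVec_add (θ η : Derivation K O O) : ofVec K (θ + η) = ofVec K θ + ofVec K η := rfl

theorem ofVec_smul (f : O) (θ : Derivation K O O) : ofVec K (f • θ) = f • ofVec K θ := rfl

theorem ofVec_bracket (θ η : Derivation K O O) :
    ofVec K ⁅θ, η⁆ = ofVec K θ * ofVec K η - ofVec K η * ofVec K θ := rfl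

/-- An additive map is `𝒟`-linear if it is `O`-linear and commutes with the vector fields. -/
theorem map_smul_of_vec {N : Type*} [AddCommGroup N] [Module O N] [Module (DiffOp K O) N]
    [IsScalarTower O (DiffOp K O) N] (φ : M →+ N) (hf : ∀ (f : O) m, φ (f • m) = f • φ m)
    (hv : ∀ (θ : Derivation K O O) m, φ (ofVec K θ • m) = ofVec K θ • φ m) (P : DiffOp K O) :
    ∀ m, φ (P • m) = P • φ m := by
  induction P using induction with
  | hf f => intro m; rw [ofFun_smul, ofFun_smul, hf]
  | hv θ => exact hv θ
  | hadd P Q h1 h2 => intro m; rw [add_smul, add_smul, map_add, h1, h2]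
  | hmul P Q h1 h2 => intro m; rw [mul_smul, mul_smul, h1, h2]

/-- A set closed under addition, functions and vector fields is closed under `𝒟`. -/
theorem smul_mem_of_vec {s : Set M} (hadd : ∀ {m n}, m ∈ s → n ∈ s → m + n ∈ s)
    (hf : ∀ (f : O) {m}, m ∈ s → f • m ∈ s)
    (hv : ∀ (θ : Derivation K O O) {m}, m ∈ s → ofVec K θ • m ∈ s) (P : DiffOp K O) :
    ∀ {m}, m ∈ s → P • m ∈ s := by
  induction P using induction with
  | hf f => intro m hm; rw [ofFun_smul]; exact hf f hm
  | hv θ => exact hv θ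
  | hadd P Q h1 h2 => intro m hm; rw [add_smul]; exact hadd (h1 hm) (h2 hm)
  | hmul P Q h1 h2 => intro m hm; rw [mul_smul]; exact h1 (h2 hm)

end Module

end DiffOp

/-! # Universal property of graded symmetric algebras -/

namespace GrSym

variable {O : Type u} [CommRing O] {V : Type w} [AddCommGroup V] [Module O V]
  {𝒱 : ℕ → Submodule O V}

/-- The extension of an `O`-linear map `V → B` with graded commuting values to `𝒮V → B`. -/
def liftAlg {B : Type*} [Ring B] [Algebra O B] (f : V →ₗ[O] B)
    (hf : ∀ ⦃m n x y⦄, x ∈ 𝒱 m → y ∈ 𝒱 n → f x * f y = (-1) ^ (m * n) * (f y * f x)) :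
    GrSym 𝒱 →ₐ[O] B :=
  RingQuot.liftAlgHom O ⟨TensorAlgebra.lift O f, by
    intro a b h
    obtain ⟨hx, hy⟩ := h
    simp only [map_mul, map_pow, map_neg, map_one, TensorAlgebra.lift_ι_apply]
    exact hf hx hy⟩

theorem liftAlg_ι {B : Type*} [Ring B] [Algebra O B] (f : V →ₗ[O] B)
    (hf : ∀ ⦃m n x y⦄, x ∈ 𝒱 m → y ∈ 𝒱 n → f x * f y = (-1) ^ (m * n) * (f y * f x)) (x : V) :
    liftAlg f hf (ι 𝒱 x) = f x :=
  (RingQuot.liftAlgHom_mkAlgHom_apply O _ _ _).trans (TensorAlgebra.lift_ι_apply f x)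

theorem ι_mul_ι {m n : ℕ} {x y : V} (hx : x ∈ 𝒱 m) (hy : y ∈ 𝒱 n) :
    ι 𝒱 x * ι 𝒱 y = (-1) ^ (m * n) * (ι 𝒱 y * ι 𝒱 x) := by
  have h := RingQuot.mkAlgHom_rel O (Rel.swap hx hy)
  simp only [map_mul, map_pow, map_neg, map_one] at h
  exact h

theorem induction {p : GrSym 𝒱 → Prop} (hr : ∀ r, p (algebraMap O _ r)) (hι : ∀ x, p (ι 𝒱 x))
    (hadd : ∀ a b, p a → p b → p (a + b)) (hmul : ∀ a b, p a → p b → p (a * b))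
    (a : GrSym 𝒱) : p a := by
  obtain ⟨a, rfl⟩ := RingQuot.mkAlgHom_surjective O (Rel 𝒱) a
  induction a using TensorAlgebra.induction with
  | algebraMap r => rw [AlgHom.commutes]; exact hr r
  | ι x => exact hι x
  | mul a b h1 h2 => rw [map_mul]; exact hmul _ _ h1 h2
  | add a b h1 h2 => rw [map_add]; exact hadd _ _ h1 h2

end GrSym

/-! # Free extensions -/

section Basics

variable {K : Type v} {O : Type u} [Field K] [CommRing O] [Algebra K O]

/-! ### Algebras in degree zero, and functions under vector fields -/

namespace DGDA.IsDAlgebra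

variable {J : DGDA.{v, u, w} K O}


theorem mem_gr_zero (hJ : J.IsDAlgebra) (a : J.carrier) : a ∈ J.gr 0 := by
  classical
  rw [← DirectSum.sum_support_decompose J.gr a]
  refine Submodule.sum_mem _ fun i _ => ?_
  obtain rfl | hi := Nat.eq_zero_or_pos i
  · exact (DirectSum.decompose J.gr a 0).2
  · have h := (DirectSum.decompose J.gr a i).2
    have h0 := (Submodule.eq_bot_iff _).1 (hJ.1 i hi) _ h
    rw [h0]; exact zero_mem _

theorem mul_comm (hJ : J.IsDAlgebra) (a b : J.carrier) : a * b = b * a := by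
  simpa using J.mul_comm' (hJ.mem_gr_zero a) (hJ.mem_gr_zero b)

end DGDA.IsDAlgebra

theorem DGDA.vec_one (R : DGDA.{v, u, w} K O) (θ : Derivation K O O) :
    DiffOp.ofVec K θ • (1 : R.carrier) = 0 := by
  have h := R.vec_mul θ 1 1
  simpa using h

theorem DGDA.vec_algebraMap (R : DGDA.{v, u, w} K O) (θ : Derivation K O O) (f : O) :
    DiffOp.ofVec K θ • algebraMap O R.carrier f = algebraMap O R.carrier (θ f) := by
  rw [Algebra.algebraMap_eq_smul_one, DiffOp.ofVec_smul_smul, R.vec_one, smul_zero, add_zero,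
    Algebra.algebraMap_eq_smul_one]

end Basics

end


noncomputable section

/-! # Twisted dual numbers -/

/-- The ring of pairs with multiplication `(x, y) (x', y') = (x x', y x' + τ(x) y')`, so that
`τ`-derivations `δ` correspond to ring homomorphisms `x ↦ (x, δ x)`. -/
def TwistedDual {R : Type*} [Ring R] (_τ : R →+* R) : Type _ := R × R

namespace TwistedDual

variable {R : Type*} [Ring R] (τ : R →+* R)

instance : AddCommGroup (TwistedDual τ) := inferInstanceAs (AddCommGroup (R × R))

variable {τ} in
/-- The pair `(x, y)`. -/
def mk (x y : R) : TwistedDual τ := (x, y)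

instance : Mul (TwistedDual τ) := ⟨fun a b => mk (a.1 * b.1) (a.2 * b.1 + τ a.1 * b.2)⟩

instance : One (TwistedDual τ) := ⟨mk 1 0⟩

variable {τ}

@[ext] theorem ext {a b : TwistedDual τ} (h1 : a.1 = b.1) (h2 : a.2 = b.2) : a = b :=
  Prod.ext h1 h2

@[simp] theorem fst_mk (x y : R) : (mk x y : TwistedDual τ).1 = x := rfl
@[simp] theorem snd_mk (x y : R) : (mk x y : TwistedDual τ).2 = y := rfl
@[simp] theorem fst_add (a b : TwistedDual τ) : (a + b).1 = a.1 + b.1 := rfl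
@[simp] theorem snd_add (a b : TwistedDual τ) : (a + b).2 = a.2 + b.2 := rfl
@[simp] theorem fst_neg (a : TwistedDual τ) : (-a).1 = -a.1 := rfl
@[simp] theorem snd_neg (a : TwistedDual τ) : (-a).2 = -a.2 := rfl
@[simp] theorem fst_zero : (0 : TwistedDual τ).1 = 0 := rfl
@[simp] theorem snd_zero : (0 : TwistedDual τ).2 = 0 := rfl
@[simp] theorem fst_one : (1 : TwistedDual τ).1 = 1 := rfl
@[simp] theorem snd_one : (1 : TwistedDual τ).2 = 0 := rfl
@[simp] theorem fst_mul (a b : TwistedDual τ) : (a * b).1 = a.1 * b.1 := rfl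
@[simp] theorem snd_mul (a b : TwistedDual τ) : (a * b).2 = a.2 * b.1 + τ a.1 * b.2 := rfl

instance : Ring (TwistedDual τ) :=
  { (inferInstance : AddCommGroup (TwistedDual τ)), (inferInstance : Mul (TwistedDual τ)),
    (inferInstance : One (TwistedDual τ)) with
    left_distrib := fun a b c => ext (mul_add _ _ _) (by simp [mul_add]; abel)
    right_distrib := fun a b c => ext (add_mul _ _ _) (by simp [add_mul]; abel)
    zero_mul := fun a => ext (zero_mul _) (by simp)
    mul_zero := fun a => ext (mul_zero _) (by simp)
    mul_assoc := fun a b c => ext (mul_assoc _ _ _) (by simp [add_mul, mul_add, mul_assoc, add_assoc])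
    one_mul := fun a => ext (one_mul _) (by simp)
    mul_one := fun a => ext (mul_one _) (by simp)
    neg_add_cancel := fun a => neg_add_cancel a
    zsmul := fun n a => n • a
    zsmul_zero' := fun a => zero_zsmul a
    zsmul_succ' := fun n a => SubNegMonoid.zsmul_succ' n a
    zsmul_neg' := fun n a => SubNegMonoid.zsmul_neg' n a }

end TwistedDual

theorem neg_one_pow_mul_comm {R : Type*} [Ring R] (n : ℕ) (x : R) :
    (-1) ^ n * x = x * (-1) ^ n :=
  ((Commute.neg_one_left x).pow_left n).eq

section Basics

variable {K : Type v} {O : Type u} [Field K] [CommRing O] [Algebra K O]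

/-! # Free extensions of a `𝒟`-algebra -/

/-- The algebra `J ⊗ 𝒮V` for the free graded `𝒟`-module `V = ⨁_α 𝒟 · v_α`. -/
abbrev FreeExt (J : DGDA.{v, u, w₁} K O) {I : Type w} (deg : I → ℕ) : Type (max u w w₁) :=
  J.carrier ⊗[O] GrSym (freeGr K O deg)

namespace FreeExt

variable {J : DGDA.{v, u, w₁} K O} {I : Type w} {deg : I → ℕ}

variable (deg) in
/-- The inclusion of `J`. -/
def base : J.carrier →ₐ[O] FreeExt J deg := Algebra.TensorProduct.includeLeft

variable (J deg) in
/-- The inclusion of `V`. -/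
def var : (I →₀ DiffOp K O) →ₗ[O] FreeExt J deg :=
  (Algebra.TensorProduct.includeRight : GrSym (freeGr K O deg) →ₐ[O] FreeExt J deg).toLinearMap ∘ₗ
    GrSym.ι _

theorem base_apply (a : J.carrier) : base deg a = a ⊗ₜ 1 := rfl

theorem var_apply (x : I →₀ DiffOp K O) : var J deg x = 1 ⊗ₜ GrSym.ι _ x := rfl

theorem var_mul_var {m n : ℕ} {x y : I →₀ DiffOp K O} (hx : x ∈ freeGr K O deg m)
    (hy : y ∈ freeGr K O deg n) :
    var J deg x * var J deg y = (-1) ^ (m * n) * (var J deg y * var J deg x) := by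
  let i : GrSym (freeGr K O deg) →ₐ[O] FreeExt J deg := Algebra.TensorProduct.includeRight
  have h := congrArg i (GrSym.ι_mul_ι hx hy)
  simp only [map_mul, map_pow, map_neg, map_one] at h
  exact h

theorem induction {p : FreeExt J deg → Prop} (hb : ∀ a, p (base deg a))
    (hv : ∀ i P, p (var J deg (Finsupp.single i P)))
    (hadd : ∀ a b, p a → p b → p (a + b)) (hmul : ∀ a b, p a → p b → p (a * b))
    (a : FreeExt J deg) : p a := by
  have h0 : p 0 := by simpa using hb 0
  have hs : ∀ s : GrSym (freeGr K O deg), p (1 ⊗ₜ s) := by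
    intro s
    induction s using GrSym.induction with
    | hr r =>
      rw [Algebra.algebraMap_eq_smul_one, ← TensorProduct.smul_tmul]
      exact hb _
    | hι x =>
      induction x using Finsupp.induction_linear with
      | zero => rw [map_zero, TensorProduct.tmul_zero]; exact h0
      | add x y h1 h2 => rw [map_add, TensorProduct.tmul_add]; exact hadd _ _ h1 h2
      | single i P => exact hv i P
    | hadd a b h1 h2 => rw [TensorProduct.tmul_add]; exact hadd _ _ h1 h2
    | hmul a b h1 h2 =>
      rw [← one_mul (1 : J.carrier), ← Algebra.TensorProduct.tmul_mul_tmul]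
      exact hmul _ _ h1 h2
  induction a using TensorProduct.induction_on with
  | zero => exact h0
  | tmul a s =>
    have h : a ⊗ₜ[O] s = base deg a * (1 ⊗ₜ s) := by
      rw [base_apply, Algebra.TensorProduct.tmul_mul_tmul, mul_one, one_mul]
    rw [h]; exact hmul _ _ (hb a) (hs s)
  | add a b h1 h2 => exact hadd _ _ h1 h2

theorem base_mul_comm (hJ : J.IsDAlgebra) (a : J.carrier) (x : FreeExt J deg) :
    base deg a * x = x * base deg a := by
  induction x using induction with
  | hb b => rw [← map_mul, hJ.mul_comm, map_mul]
  | hv i P =>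
    rw [base_apply, var_apply, Algebra.TensorProduct.tmul_mul_tmul,
      Algebra.TensorProduct.tmul_mul_tmul]
    simp
  | hadd x y h1 h2 => rw [mul_add, h1, h2, add_mul]
  | hmul x y h1 h2 => rw [← mul_assoc, h1, mul_assoc, h2, mul_assoc]

theorem ringHom_ext {B : Type*} [Ring B] {F G : FreeExt J deg →+* B}
    (hb : ∀ a, F (base deg a) = G (base deg a)) (hv : ∀ x, F (var J deg x) = G (var J deg x)) :
    F = G := by
  refine RingHom.ext fun a => ?_
  induction a using induction with
  | hb a => exact hb a
  | hv i P => exact hv _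
  | hadd x y h1 h2 => rw [map_add, map_add, h1, h2]
  | hmul x y h1 h2 => rw [map_mul, map_mul, h1, h2]

/-- The universal property of `J ⊗ 𝒮V` among `O`-algebras. -/
def liftAlg {B : Type*} [Ring B] [Algebra O B] (g : J.carrier →ₐ[O] B)
    (f : (I →₀ DiffOp K O) →ₗ[O] B)
    (hf : ∀ ⦃m n x y⦄, x ∈ freeGr K O deg m → y ∈ freeGr K O deg n →
      f x * f y = (-1) ^ (m * n) * (f y * f x))
    (hgf : ∀ a x, Commute (g a) (f x)) : FreeExt J deg →ₐ[O] B :=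
  Algebra.TensorProduct.lift g (GrSym.liftAlg f hf) (by
    intro a s
    induction s using GrSym.induction with
    | hr r => rw [AlgHom.commutes]; exact (Algebra.commutes r (g a)).symm
    | hι x => rw [GrSym.liftAlg_ι]; exact hgf a x
    | hadd s t h1 h2 => rw [map_add]; exact h1.add_right h2
    | hmul s t h1 h2 => rw [map_mul]; exact h1.mul_right h2)

section liftAlg

variable {B : Type*} [Ring B] [Algebra O B] {g : J.carrier →ₐ[O] B}
    {f : (I →₀ DiffOp K O) →ₗ[O] B}
    {hf : ∀ ⦃m n x y⦄, x ∈ freeGr K O deg m → y ∈ freeGr K O deg n →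
      f x * f y = (-1) ^ (m * n) * (f y * f x)}
    {hgf : ∀ a x, Commute (g a) (f x)}

theorem liftAlg_tmul (a : J.carrier) (s : GrSym (freeGr K O deg)) :
    liftAlg g f hf hgf (a ⊗ₜ s) = g a * GrSym.liftAlg f hf s :=
  Algebra.TensorProduct.lift_tmul ..

theorem liftAlg_base (a : J.carrier) : liftAlg g f hf hgf (base deg a) = g a := by
  rw [base_apply, liftAlg_tmul, map_one, mul_one]

theorem liftAlg_var (x : I →₀ DiffOp K O) : liftAlg g f hf hgf (var J deg x) = f x := by
  rw [var_apply, liftAlg_tmul, map_one, one_mul, GrSym.liftAlg_ι]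

end liftAlg

/-- The universal property of `J ⊗ 𝒮V` among rings. -/
theorem exists_ringHom {B : Type*} [Ring B] (g : J.carrier →+* B)
    (f : (I →₀ DiffOp K O) →+ B)
    (hsmul : ∀ (r : O) x, f (r • x) = g (algebraMap O _ r) * f x)
    (hcentral : ∀ (r : O) b, g (algebraMap O _ r) * b = b * g (algebraMap O _ r))
    (hf : ∀ ⦃m n x y⦄, x ∈ freeGr K O deg m → y ∈ freeGr K O deg n →
      f x * f y = (-1) ^ (m * n) * (f y * f x))
    (hgf : ∀ a x, Commute (g a) (f x)) :
    ∃ F : FreeExt J deg →+* B, (∀ a, F (base deg a) = g a) ∧ ∀ x, F (var J deg x) = f x := by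
  -- `B` carries no `O`-structure beforehand: `O` acts through `g`. In twisted dual numbers a
  -- function then acts by `(r, δ r)`, which accommodates derivations that are not `O`-linear.
  let alg : Algebra O B := (g.comp (algebraMap O J.carrier)).toAlgebra' hcentral
  let g' : J.carrier →ₐ[O] B := { g with commutes' := fun r => rfl }
  let f' : (I →₀ DiffOp K O) →ₗ[O] B := { f with map_smul' := hsmul }
  exact ⟨(liftAlg g' f' hf hgf).toRingHom, liftAlg_base, liftAlg_var⟩

/-- Extension of twisted derivations to `J ⊗ 𝒮V`. -/
theorem exists_twistedDerivation (hJ : J.IsDAlgebra) (τ : FreeExt J deg →+* FreeExt J deg)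
    (hτ : ∀ a, τ (base deg a) = base deg a) (δJ : J.carrier →+ FreeExt J deg)
    (hmul : ∀ a b, δJ (a * b) = δJ a * base deg b + base deg a * δJ b)
    (hcomm : ∀ a x, δJ a * x = τ x * δJ a) (δV : (I →₀ DiffOp K O) →+ FreeExt J deg)
    (hsmul : ∀ (r : O) x, δV (r • x) = δJ (algebraMap O _ r) * var J deg x + r • δV x)
    (hrel : ∀ ⦃m n x y⦄, x ∈ freeGr K O deg m → y ∈ freeGr K O deg n →
      δV x * var J deg y + τ (var J deg x) * δV y
        = (-1) ^ (m * n) * (δV y * var J deg x + τ (var J deg y) * δV x)) :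
    ∃ δ : FreeExt J deg →+ FreeExt J deg, (∀ x y, δ (x * y) = δ x * y + τ x * δ y) ∧
      (∀ a, δ (base deg a) = δJ a) ∧ ∀ x, δ (var J deg x) = δV x := by
  have hone : δJ 1 = 0 := by
    have := hmul 1 1
    simpa using this
  let g : J.carrier →+* TwistedDual τ :=
    { toFun := fun a => .mk (base deg a) (δJ a)
      map_one' := TwistedDual.ext (map_one _) hone
      map_zero' := TwistedDual.ext (map_zero _) (map_zero _)
      map_add' := fun a b => TwistedDual.ext (map_add _ _ _) (map_add _ _ _)
      map_mul' := fun a b => TwistedDual.ext (map_mul _ _ _) (by simp [hmul, hτ]) }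
  let f : (I →₀ DiffOp K O) →+ TwistedDual τ :=
    { toFun := fun x => .mk (var J deg x) (δV x)
      map_zero' := TwistedDual.ext (map_zero _) (map_zero _)
      map_add' := fun a b => TwistedDual.ext (map_add _ _ _) (map_add _ _ _) }
  have hf1 : ∀ x, (f x).1 = var J deg x := fun _ => rfl
  have hf2 : ∀ x, (f x).2 = δV x := fun _ => rfl
  have hg : ∀ a b, g a * b = b * g a := fun a b =>
    TwistedDual.ext (base_mul_comm hJ _ _) (by
      change δJ a * b.1 + τ (base deg a) * b.2 = b.2 * base deg a + τ b.1 * δJ a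
      rw [hτ, hcomm, base_mul_comm hJ, add_comm])
  obtain ⟨F, hFb, hFv⟩ := exists_ringHom (deg := deg) g f (fun r x => by
      refine TwistedDual.ext ?_ ?_
      · change var J deg (r • x) = base deg (algebraMap O _ r) * var J deg x
        rw [AlgHom.commutes, map_smul, Algebra.smul_def]
      · change δV (r • x) = δJ (algebraMap O _ r) * var J deg x
          + τ (base deg (algebraMap O _ r)) * δV x
        rw [hsmul, hτ, AlgHom.commutes, Algebra.smul_def r (δV x)]) (fun r => hg _)
    (fun m n x y hx hy => by
      have h1 := var_mul_var (J := J) hx hy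
      have h2 := hrel hx hy
      rcases Nat.even_or_odd (m * n) with h | h <;> rw [h.neg_one_pow] at h1 h2 ⊢
      · exact TwistedDual.ext (by simpa [hf1] using h1) (by simpa [hf1, hf2] using h2)
      · exact TwistedDual.ext (by simpa [hf1] using h1) (by simpa [hf1, hf2] using h2)) (fun a x => hg a _)
  let fst : TwistedDual τ →+* FreeExt J deg :=
    { toFun := Prod.fst, map_one' := rfl, map_zero' := rfl, map_add' := fun _ _ => rfl
      map_mul' := fun _ _ => rfl }
  -- The first component is a ring endomorphism fixing all generators, hence the identity; so `F`
  -- has the form `x ↦ (x, δ x)`.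
  have hfst : ∀ x, (F x).1 = x := RingHom.congr_fun (f := fst.comp F) (g := RingHom.id _)
    (ringHom_ext (fun a => congrArg Prod.fst (hFb a)) (fun x => congrArg Prod.fst (hFv x)))
  refine ⟨{ toFun := fun x => (F x).2, map_zero' := by rw [map_zero]; rfl
            map_add' := fun x y => by rw [map_add]; rfl }, fun x y => ?_, fun a => ?_, fun x => ?_⟩
  · change (F (x * y)).2 = (F x).2 * y + τ x * (F y).2
    rw [map_mul, TwistedDual.snd_mul, hfst, hfst]
  · exact congrArg Prod.snd (hFb a)
  · exact congrArg Prod.snd (hFv x)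

theorem twistedDerivation_ext {τ : FreeExt J deg →+* FreeExt J deg}
    {δ δ' : FreeExt J deg →+ FreeExt J deg} (h : ∀ x y, δ (x * y) = δ x * y + τ x * δ y)
    (h' : ∀ x y, δ' (x * y) = δ' x * y + τ x * δ' y)
    (hb : ∀ a, δ (base deg a) = δ' (base deg a)) (hv : ∀ x, δ (var J deg x) = δ' (var J deg x))
    (x : FreeExt J deg) : δ x = δ' x := by
  induction x using induction with
  | hb a => exact hb a
  | hv i P => exact hv _
  | hadd x y h1 h2 => rw [map_add, map_add, h1, h2]
  | hmul x y h1 h2 => rw [h, h', h1, h2]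

end FreeExt

end Basics

end


noncomputable section

section Basics

variable {K : Type v} {O : Type u} [Field K] [CommRing O] [Algebra K O]

/-! ### Degree parts of the free `𝒟`-module -/

instance DiffOp.instTower : IsScalarTower O (DiffOp K O) (DiffOp K O) :=
  ⟨fun f P Q => mul_assoc (DiffOp.ofFun K f) P Q⟩

theorem single_mem_freeGr {I : Type w} (deg : I → ℕ) (i : I) (P : DiffOp K O) :
    Finsupp.single i P ∈ freeGr K O deg (deg i) :=
  Finsupp.single_mem_supported O P rfl

theorem smul_mem_freeGr {I : Type w} {deg : I → ℕ} {n : ℕ} (P : DiffOp K O)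
    {x : I →₀ DiffOp K O} (hx : x ∈ freeGr K O deg n) : P • x ∈ freeGr K O deg n :=
  fun _ hi => hx (Finsupp.support_smul hi)

theorem freeGr_induction {I : Type w} {deg : I → ℕ} {n : ℕ} {p : (I →₀ DiffOp K O) → Prop}
    (h0 : p 0) (hadd : ∀ x y, p x → p y → p (x + y))
    (hs : ∀ i P, deg i = n → p (Finsupp.single i P)) {x : I →₀ DiffOp K O}
    (hx : x ∈ freeGr K O deg n) : p x := by
  classical
  rw [← Finsupp.sum_single x]
  exact Finset.sum_induction _ p hadd h0 fun i hi => hs i _ (hx hi)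

namespace FreeExt

variable {J : DGDA.{v, u, w₁} K O} {I : Type w} {deg : I → ℕ}

/-! ### The grading -/

/-- The elements of degree `n`. -/
inductive Homog : ℕ → FreeExt J deg → Prop
  | zero (n) : Homog n 0
  | ofBase (a) : Homog 0 (base deg a)
  | ofVar (i P) : Homog (deg i) (var J deg (Finsupp.single i P))
  | add {n a b} : Homog n a → Homog n b → Homog n (a + b)
  | mul {m n a b} : Homog m a → Homog n b → Homog (m + n) (a * b)

theorem Homog.mul_base {n : ℕ} {a : FreeExt J deg} (h : Homog n a) (b : J.carrier) :
    Homog n (a * FreeExt.base deg b) := h.mul (.ofBase b)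

theorem Homog.zsmul {n : ℕ} {a : FreeExt J deg} (h : Homog n a) (k : ℤ) : Homog n (k • a) := by
  have := h.mul_base k
  rwa [map_intCast, ← zsmul_eq_mul'] at this

theorem Homog.sum {ι : Type*} {n : ℕ} (s : Finset ι) {a : ι → FreeExt J deg}
    (h : ∀ i ∈ s, Homog n (a i)) : Homog n (∑ i ∈ s, a i) :=
  Finset.sum_induction _ (Homog n) (fun _ _ => .add) (.zero n) h

theorem Homog.var_mem {n : ℕ} {x : I →₀ DiffOp K O} (hx : x ∈ freeGr K O deg n) :
    Homog n (FreeExt.var J deg x) := by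
  refine freeGr_induction (p := fun x => Homog n (FreeExt.var J deg x)) ?_
    (fun x y h1 h2 => ?_) (fun i P hi => ?_) hx
  · rw [map_zero]; exact .zero n
  · rw [map_add]; exact h1.add h2
  · exact hi ▸ .ofVar i P

variable (J deg) in
/-- The map `∑ vₙ ↦ ∑ vₙ Xⁿ` on generators. -/
def coactVar : (I →₀ DiffOp K O) →ₗ[O] Polynomial (FreeExt J deg) :=
  Finsupp.lsum O fun i => ((Polynomial.monomial (deg i)).restrictScalars O) ∘ₗ var J deg ∘ₗ
    Finsupp.lsingle i

theorem coactVar_single (i : I) (P : DiffOp K O) : coactVar J deg (Finsupp.single i P) =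
    Polynomial.monomial (deg i) (var J deg (Finsupp.single i P)) := by
  simp [coactVar]

theorem coactVar_of_mem {n : ℕ} {x : I →₀ DiffOp K O} (hx : x ∈ freeGr K O deg n) :
    coactVar J deg x = Polynomial.monomial n (var J deg x) := by
  refine freeGr_induction
    (p := fun x => coactVar J deg x = Polynomial.monomial n (var J deg x)) ?_
    (fun x y h1 h2 => ?_) (fun i P hi => ?_) hx
  · simp
  · simp only [map_add, h1, h2]
  · rw [coactVar_single, hi]

theorem zsmul_sign {R : Type*} [Ring R] (n : ℕ) (x : R) : (-1) ^ n * x = ((-1 : ℤ) ^ n) • x := by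
  simp [zsmul_eq_mul]

variable (J deg) in
/-- The coaction `∑ aₙ ↦ ∑ aₙ Xⁿ`. -/
def coact (hJ : J.IsDAlgebra) : FreeExt J deg →ₐ[O] Polynomial (FreeExt J deg) :=
  liftAlg (Polynomial.CAlgHom.comp (base deg)) (coactVar J deg)
    (fun m n x y hx hy => by
      rw [coactVar_of_mem hx, coactVar_of_mem hy, Polynomial.monomial_mul_monomial,
        Polynomial.monomial_mul_monomial, var_mul_var hx hy, zsmul_sign, zsmul_sign, map_zsmul,
        add_comm])
    (fun a x => by
      induction x using Finsupp.induction_linear with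
      | zero => rw [map_zero]; exact Commute.zero_right _
      | add x y h1 h2 => rw [map_add]; exact h1.add_right h2
      | single i P =>
        rw [coactVar_single]
        change Polynomial.C _ * _ = _ * Polynomial.C _
        rw [Polynomial.C_mul_monomial, Polynomial.monomial_mul_C]
        exact congrArg _ (base_mul_comm hJ a _))

section coact

variable (hJ : J.IsDAlgebra)

theorem coact_base (a : J.carrier) : coact J deg hJ (base deg a) = Polynomial.C (base deg a) :=
  liftAlg_base a

theorem coact_var (x : I →₀ DiffOp K O) : coact J deg hJ (var J deg x) = coactVar J deg x :=
  liftAlg_var x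

/-- This makes the degree of a nonzero homogeneous element well defined, which the closure
conditions in `Homog` alone do not show. -/
theorem Homog.coact {n : ℕ} {a : FreeExt J deg} (h : Homog n a) :
    coact J deg hJ a = Polynomial.monomial n a := by
  induction h with
  | zero n => simp
  | ofBase a => rw [coact_base]; rfl
  | ofVar i P => rw [coact_var, coactVar_single]
  | add _ _ h1 h2 => rw [map_add, h1, h2, map_add]
  | mul _ _ h1 h2 => rw [map_mul, h1, h2, Polynomial.monomial_mul_monomial]

theorem homog_coeff_coact (a : FreeExt J deg) :
    ∀ n, Homog n ((FreeExt.coact J deg hJ a).coeff n) := by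
  induction a using FreeExt.induction with
  | hb a =>
    intro n
    rw [coact_base, Polynomial.coeff_C]
    split_ifs with h
    · exact h ▸ .ofBase a
    · exact .zero n
  | hv i P =>
    intro n
    rw [coact_var, coactVar_single, Polynomial.coeff_monomial]
    split_ifs with h
    · exact h ▸ .ofVar i P
    · exact .zero n
  | hadd a b h1 h2 => intro n; rw [map_add, Polynomial.coeff_add]; exact (h1 n).add (h2 n)
  | hmul a b h1 h2 =>
    intro n
    rw [map_mul, Polynomial.coeff_mul]
    refine Homog.sum _ fun ij hij => ?_
    rw [← Finset.HasAntidiagonal.mem_antidiagonal.1 hij]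
    exact (h1 _).mul (h2 _)

/-- Evaluation at `X = 1` after the coaction is a ring endomorphism fixing the generators. -/
theorem sum_coeff_coact (a : FreeExt J deg) :
    ∑ n ∈ (coact J deg hJ a).support, (coact J deg hJ a).coeff n = a := by
  let e : Polynomial (FreeExt J deg) →+* FreeExt J deg :=
    Polynomial.eval₂RingHom' (RingHom.id _) 1 (fun a => Commute.one_right a)
  have h : (e.comp (coact J deg hJ).toRingHom) = RingHom.id _ := by
    refine ringHom_ext (fun a => ?_) (fun x => ?_)
    · change e (coact J deg hJ _) = _
      rw [coact_base]
      exact Polynomial.eval₂_C _ _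
    · change e (coact J deg hJ _) = _
      rw [coact_var]
      induction x using Finsupp.induction_linear with
      | zero => simp
      | add x y h1 h2 => rw [map_add, map_add, h1, h2, map_add]; rfl
      | single i P =>
        rw [coactVar_single]
        exact (Polynomial.eval₂_monomial _ _).trans (by simp)
  have h1 := RingHom.congr_fun h a
  refine Eq.trans ?_ h1
  change _ = Polynomial.eval₂ _ _ _
  rw [Polynomial.eval₂_eq_sum, Polynomial.sum]
  simp

/-- The elements of `J ⊗ 𝒮V` are sums of homogeneous elements. -/
theorem homog_induction (hJ : J.IsDAlgebra) {p : FreeExt J deg → Prop} (h : ∀ n a, Homog n a → p a)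
    (hadd : ∀ a b, p a → p b → p (a + b)) (a : FreeExt J deg) : p a := by
  rw [← sum_coeff_coact hJ a]
  exact Finset.sum_induction _ p hadd (h 0 0 (.zero 0)) fun n _ => h n _ (homog_coeff_coact hJ a n)

variable (J deg) in
/-- The automorphism `a ↦ (-1)^{|a|} a`. -/
def sign : FreeExt J deg →+* FreeExt J deg :=
  (Polynomial.eval₂RingHom' (RingHom.id _) (-1) (fun a => (Commute.neg_one_right a))).comp
    (coact J deg hJ).toRingHom

theorem Homog.sign {n : ℕ} {a : FreeExt J deg} (h : Homog n a) :
    sign J deg hJ a = ((-1 : ℤ) ^ n) • a := by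
  change Polynomial.eval₂ _ _ (FreeExt.coact J deg hJ a) = _
  rw [h.coact, Polynomial.eval₂_monomial, RingHom.id_apply, ← neg_one_pow_mul_comm, zsmul_sign]

theorem sign_base (a : J.carrier) : sign J deg hJ (base deg a) = base deg a := by
  rw [(Homog.ofBase a).sign hJ]; simp

theorem sign_sign (a : FreeExt J deg) : sign J deg hJ (sign J deg hJ a) = a := by
  refine homog_induction hJ (p := fun a => sign J deg hJ (sign J deg hJ a) = a)
    (fun n a ha => ?_) (fun a b h1 h2 => ?_) a
  · rw [ha.sign, map_zsmul, ha.sign, smul_smul, ← mul_pow]; simp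
  · rw [map_add, map_add, h1, h2]

end coact

/-! ### Graded commutativity -/

/-- A sign rule against generators propagates to products because the exponents add. It serves
twice: for a generator `a`, and then for arbitrary homogeneous `a`. -/
theorem homog_comm_aux {m : ℕ} {a : FreeExt J deg}
    (hb : ∀ b, a * base deg b = base deg b * a)
    (hv : ∀ i P, a * var J deg (Finsupp.single i P)
      = ((-1 : ℤ) ^ (m * deg i)) • (var J deg (Finsupp.single i P) * a))
    {n : ℕ} {b : FreeExt J deg} (h : Homog n b) :
    a * b = ((-1 : ℤ) ^ (m * n)) • (b * a) := by
  induction h with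
  | zero n => simp
  | ofBase b => simp [hb]
  | ofVar i P => exact hv i P
  | add _ _ h1 h2 => rw [mul_add, h1, h2, add_mul, smul_add]
  | @mul n n' b b' _ _ h1 h2 =>
    rw [← mul_assoc, h1, smul_mul_assoc, mul_assoc, h2, mul_smul_comm, smul_smul, mul_add, pow_add,
      mul_assoc]

theorem Homog.mul_comm (hJ : J.IsDAlgebra) {m n : ℕ} {a b : FreeExt J deg} (ha : Homog m a)
    (hb : Homog n b) : a * b = ((-1 : ℤ) ^ (m * n)) • (b * a) := by
  have key : ∀ i P, var J deg (Finsupp.single i P) * a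
      = ((-1 : ℤ) ^ (deg i * m)) • (a * var J deg (Finsupp.single i P)) := by
    intro i P
    refine homog_comm_aux (fun b => (base_mul_comm hJ b _).symm) (fun k Q => ?_) ha
    rw [var_mul_var (single_mem_freeGr deg i P) (single_mem_freeGr deg k Q), zsmul_sign]
  refine homog_comm_aux (fun b => (base_mul_comm hJ b _).symm) (fun k Q => ?_) hb
  rw [key, smul_smul, Nat.mul_comm (deg k) m, ← mul_pow]
  simp

end FreeExt

end Basics

end


noncomputable section

section Basics

variable {K : Type v} {O : Type u} [Field K] [CommRing O] [Algebra K O]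

namespace FreeExt

variable {J : DGDA.{v, u, w₁} K O} {I : Type w} {deg : I → ℕ}

/-! ### The action of the differential operators -/

theorem derivation_ext {δ δ' : FreeExt J deg →+ FreeExt J deg}
    (h : ∀ x y, δ (x * y) = δ x * y + x * δ y) (h' : ∀ x y, δ' (x * y) = δ' x * y + x * δ' y)
    (hb : ∀ a, δ (base deg a) = δ' (base deg a)) (hv : ∀ x, δ (var J deg x) = δ' (var J deg x))
    (x : FreeExt J deg) : δ x = δ' x :=
  twistedDerivation_ext (τ := RingHom.id _) h h' hb hv x

theorem Homog.osmul {n : ℕ} {a : FreeExt J deg} (h : Homog n a) (f : O) : Homog n (f • a) := by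
  have := h.mul_base (algebraMap O _ f)
  rwa [AlgHom.commutes, ← Algebra.commutes, ← Algebra.smul_def] at this

section Vec

variable [hJ : Fact J.IsDAlgebra]

/-- An untwisted derivation that is not `O`-linear: its value on functions is `θ` itself. `𝒟`
preserves degrees in `V`, so the commutativity relations are respected. -/
theorem exists_vecAction (θ : Derivation K O O) :
    ∃ δ : FreeExt J deg →+ FreeExt J deg, (∀ x y, δ (x * y) = δ x * y + x * δ y) ∧
      (∀ a, δ (base deg a) = base deg (DiffOp.ofVec K θ • a)) ∧
      ∀ x, δ (var J deg x) = var J deg (DiffOp.ofVec K θ • x) := by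
  refine exists_twistedDerivation hJ.out (RingHom.id _) (fun _ => rfl)
    ((base deg).toLinearMap.toAddMonoidHom.comp (DistribSMul.toAddMonoidHom _ (DiffOp.ofVec K θ)))
    (fun a b => ?_) (fun a x => base_mul_comm hJ.out _ x)
    ((var J deg).toAddMonoidHom.comp (DistribSMul.toAddMonoidHom _ (DiffOp.ofVec K θ)))
    (fun r x => ?_) (fun m n x y hx hy => ?_)
  · change base deg (DiffOp.ofVec K θ • (a * b)) = base deg (DiffOp.ofVec K θ • a) * base deg b
      + base deg a * base deg (DiffOp.ofVec K θ • b)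
    rw [J.vec_mul, map_add, map_mul, map_mul]
  · change var J deg (DiffOp.ofVec K θ • (r • x)) = base deg (DiffOp.ofVec K θ • algebraMap O _ r)
      * var J deg x + r • var J deg (DiffOp.ofVec K θ • x)
    rw [DiffOp.ofVec_smul_smul, map_add, map_smul, map_smul, J.vec_algebraMap, AlgHom.commutes,
      ← Algebra.smul_def]
  · change var J deg (DiffOp.ofVec K θ • x) * var J deg y
      + var J deg x * var J deg (DiffOp.ofVec K θ • y) = (-1) ^ (m * n) *
        (var J deg (DiffOp.ofVec K θ • y) * var J deg x
          + var J deg y * var J deg (DiffOp.ofVec K θ • x))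
    rw [var_mul_var (smul_mem_freeGr _ hx) hy, var_mul_var hx (smul_mem_freeGr _ hy), ← mul_add,
      add_comm]

/-- The action of a vector field. -/
def vecAction (θ : Derivation K O O) : FreeExt J deg →+ FreeExt J deg :=
  (exists_vecAction θ).choose

theorem vecAction_mul (θ : Derivation K O O) (x y : FreeExt J deg) :
    vecAction θ (x * y) = vecAction θ x * y + x * vecAction θ y :=
  (exists_vecAction θ).choose_spec.1 x y

theorem vecAction_base (θ : Derivation K O O) (a : J.carrier) :
    vecAction θ (base deg a) = base deg (DiffOp.ofVec K θ • a) :=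
  (exists_vecAction θ).choose_spec.2.1 a

theorem vecAction_var (θ : Derivation K O O) (x : I →₀ DiffOp K O) :
    vecAction θ (var J deg x) = var J deg (DiffOp.ofVec K θ • x) :=
  (exists_vecAction θ).choose_spec.2.2 x

theorem vecAction_smul (θ : Derivation K O O) (f : O) (x : FreeExt J deg) :
    vecAction θ (f • x) = θ f • x + f • vecAction θ x := by
  rw [Algebra.smul_def, ← AlgHom.commutes (base deg) f, vecAction_mul, vecAction_base,
    J.vec_algebraMap, AlgHom.commutes, AlgHom.commutes, ← Algebra.smul_def, ← Algebra.smul_def]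

variable (J deg) in
/-- The flat connection on `J ⊗ 𝒮V`. -/
def connection : FlatConnection K O (FreeExt J deg) where
  nabla := vecAction
  nabla_add θ η := derivation_ext (vecAction_mul _)
    (δ' := vecAction θ + vecAction η)
    (fun x y => by simp only [AddMonoidHom.add_apply, vecAction_mul, add_mul, mul_add]; abel)
    (fun a => by
      simp only [AddMonoidHom.add_apply, vecAction_base, DiffOp.ofVec_add, add_smul, map_add])
    (fun a => by
      simp only [AddMonoidHom.add_apply, vecAction_var, DiffOp.ofVec_add, add_smul, map_add])
  nabla_smul f θ := derivation_ext (vecAction_mul _)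
    (δ' := (DistribSMul.toAddMonoidHom _ f).comp (vecAction θ))
    (fun x y => by simp [vecAction_mul, smul_add])
    (fun a => by
      change _ = f • vecAction θ (base deg a)
      rw [vecAction_base, vecAction_base, DiffOp.ofVec_smul, smul_assoc, map_smul])
    (fun a => by
      change _ = f • vecAction θ (var J deg a)
      rw [vecAction_var, vecAction_var, DiffOp.ofVec_smul, smul_assoc, map_smul])
  leibniz := vecAction_smul
  flat θ η := derivation_ext (vecAction_mul _)
    (δ' := (vecAction θ).comp (vecAction η) - (vecAction η).comp (vecAction θ))
    (fun x y => by
      simp only [AddMonoidHom.sub_apply, AddMonoidHom.comp_apply, vecAction_mul, map_add, sub_mul,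
        mul_sub]
      abel)
    (fun a => by
      simp only [AddMonoidHom.sub_apply, AddMonoidHom.comp_apply, vecAction_base,
        DiffOp.ofVec_bracket, sub_smul, mul_smul, map_sub])
    (fun a => by
      simp only [AddMonoidHom.sub_apply, AddMonoidHom.comp_apply, vecAction_var,
        DiffOp.ofVec_bracket, sub_smul, mul_smul, map_sub])

variable [CharZero K] [Algebra.Smooth K O]

instance instModule : Module (DiffOp K O) (FreeExt J deg) :=
  Module.compHom _ (connection J deg).toRingHom

theorem ofVec_smul (θ : Derivation K O O) (x : FreeExt J deg) :
    DiffOp.ofVec K θ • x = vecAction θ x :=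
  (connection J deg).toRingHom_ofVec θ x

instance instTower : IsScalarTower O (DiffOp K O) (FreeExt J deg) :=
  ⟨fun f P x => by
    rw [DiffOp.smul_eq, mul_smul]
    exact (connection J deg).toRingHom_ofFun f _⟩

theorem vec_mul (θ : Derivation K O O) (x y : FreeExt J deg) :
    DiffOp.ofVec K θ • (x * y) = (DiffOp.ofVec K θ • x) * y + x * (DiffOp.ofVec K θ • y) := by
  simp only [ofVec_smul, vecAction_mul]

theorem smul_base (P : DiffOp K O) (a : J.carrier) : P • base deg a = base deg (P • a) :=
  (DiffOp.map_smul_of_vec (base deg).toLinearMap.toAddMonoidHom (fun f m => map_smul (base deg) f m)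
    (fun θ m => ((ofVec_smul θ _).trans (vecAction_base θ m)).symm) P a).symm

theorem smul_var (P : DiffOp K O) (x : I →₀ DiffOp K O) : P • var J deg x = var J deg (P • x) :=
  (DiffOp.map_smul_of_vec (var J deg).toAddMonoidHom (fun f m => map_smul (var J deg) f m)
    (fun θ m => ((ofVec_smul θ _).trans (vecAction_var θ m)).symm) P x).symm

theorem Homog.vec {n : ℕ} {a : FreeExt J deg} (h : Homog n a) (θ : Derivation K O O) :
    Homog n (DiffOp.ofVec K θ • a) := by
  induction h with
  | zero n => rw [smul_zero]; exact .zero n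
  | ofBase a => rw [smul_base]; exact .ofBase _
  | ofVar i P => rw [smul_var, Finsupp.smul_single]; exact .ofVar i _
  | add _ _ h1 h2 => rw [smul_add]; exact h1.add h2
  | mul ha hb h1 h2 => rw [vec_mul]; exact (h1.mul hb).add (ha.mul h2)

theorem Homog.smul {n : ℕ} {a : FreeExt J deg} (h : Homog n a) (P : DiffOp K O) :
    Homog n (P • a) :=
  DiffOp.smul_mem_of_vec (s := {a | Homog n a}) (fun h h' => Homog.add h h')
    (fun f m h => show Homog n (f • m) from Homog.osmul h f)
    (fun θ m h => show Homog n (DiffOp.ofVec K θ • m) from Homog.vec h θ) P h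

variable (J deg) in
/-- The grading by `𝒟`-submodules. -/
def gr (n : ℕ) : Submodule (DiffOp K O) (FreeExt J deg) where
  carrier := {a | Homog n a}
  add_mem' := .add
  zero_mem' := .zero n
  smul_mem' P _ h := h.smul P

/-- The coefficients of the coaction recover the homogeneous components of a sum, which gives
independence. -/
theorem isInternal_gr : DirectSum.IsInternal (gr J deg) := by
  classical
  refine ⟨(injective_iff_map_eq_zero _).2 fun x hx => ?_, fun a => ?_⟩
  · have key : ∀ (x : ⨁ n, gr J deg n) (n : ℕ),
        (coact J deg hJ.out (DirectSum.coeAddMonoidHom (gr J deg) x)).coeff n = x n := by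
      intro x n
      induction x using DirectSum.induction_on with
      | zero => simp
      | of i a =>
        rw [DirectSum.coeAddMonoidHom_of, Homog.coact hJ.out a.2, Polynomial.coeff_monomial]
        split_ifs with h
        · subst h; rw [DirectSum.of_eq_same]
        · rw [DirectSum.of_eq_of_ne _ _ _ (Ne.symm h)]; rfl
      | add x y h1 h2 => rw [map_add, map_add, Polynomial.coeff_add, h1, h2]; rfl
    refine DFinsupp.ext fun n => Subtype.ext ?_
    rw [← key x n, hx, map_zero]
    rfl
  · refine homog_induction hJ.out (p := fun a => ∃ x, DirectSum.coeAddMonoidHom (gr J deg) x = a)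
      (fun n a ha => ⟨DirectSum.of _ n ⟨a, ha⟩, DirectSum.coeAddMonoidHom_of _ _ _⟩) ?_ a
    rintro a b ⟨x, rfl⟩ ⟨y, rfl⟩
    exact ⟨x + y, map_add _ _ _⟩

instance instGradedRing : GradedRing (gr J deg) :=
  { isInternal_gr.chooseDecomposition with
    one_mem := by
      have := Homog.ofBase (deg := deg) (1 : J.carrier)
      rwa [map_one] at this
    mul_mem := fun _ _ _ _ => .mul }

end Vec

/-! ### Differentials -/

/-- Elements of degree `n - 1`. -/
def Lowered : ℕ → FreeExt J deg → Prop
  | 0, z => z = 0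
  | n + 1, z => Homog n z

theorem Lowered.zero' (n : ℕ) : Lowered n (0 : FreeExt J deg) := by
  cases n with
  | zero => rfl
  | succ n => exact .zero n

theorem Lowered.add {n : ℕ} {a b : FreeExt J deg} (ha : Lowered n a) (hb : Lowered n b) :
    Lowered n (a + b) := by
  cases n with
  | zero => rw [show a = 0 from ha, show b = 0 from hb]; exact add_zero _
  | succ n => exact Homog.add ha hb

theorem Lowered.mul_right {m n : ℕ} {a b : FreeExt J deg} (ha : Lowered m a) (hb : Homog n b) :
    Lowered (m + n) (a * b) := by
  cases m with
  | zero => rw [show a = 0 from ha, zero_mul]; exact .zero' _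
  | succ m => rw [show m + 1 + n = m + n + 1 by omega]; exact Homog.mul ha hb

theorem Lowered.mul_left {m n : ℕ} {a b : FreeExt J deg} (ha : Homog m a) (hb : Lowered n b) :
    Lowered (m + n) (a * b) := by
  cases n with
  | zero => rw [show b = 0 from hb, mul_zero]; exact .zero' _
  | succ n => exact Homog.mul ha hb

theorem Lowered.sign (hJ : J.IsDAlgebra) {n : ℕ} {a : FreeExt J deg} (h : Lowered n a) :
    FreeExt.sign J deg hJ a = -((-1 : ℤ) ^ n • a) := by
  cases n with
  | zero => rw [show a = 0 from h]; simp
  | succ n => rw [Homog.sign hJ h, pow_succ]; simp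

/-- The sign is that of `(m - 1) n`; the exponent `m n + n` has the same parity and avoids truncated
subtraction. -/
theorem Lowered.mul_comm (hJ : J.IsDAlgebra) {m n : ℕ} {a b : FreeExt J deg} (ha : Lowered m a)
    (hb : Homog n b) : a * b = ((-1 : ℤ) ^ (m * n + n)) • (b * a) := by
  cases m with
  | zero => rw [show a = 0 from ha]; simp
  | succ m =>
    rw [Homog.mul_comm hJ ha hb, show (m + 1) * n + n = m * n + 2 * n by ring, pow_add, pow_mul]
    simp

variable [hJ : Fact J.IsDAlgebra] [CharZero K] [Algebra.Smooth K O]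

theorem Lowered.smul {n : ℕ} {a : FreeExt J deg} (h : Lowered n a) (P : DiffOp K O) :
    Lowered n (P • a) := by
  cases n with
  | zero => rw [show a = 0 from h]; exact smul_zero _
  | succ n => exact Homog.smul h P

theorem Lowered.linearCombination {z : I → FreeExt J deg} (hz : ∀ i, Lowered (deg i) (z i)) {n : ℕ}
    {x : I →₀ DiffOp K O} (hx : x ∈ freeGr K O deg n) :
    Lowered n (Finsupp.linearCombination (DiffOp K O) z x) := by
  refine freeGr_induction (p := fun x => Lowered n (Finsupp.linearCombination (DiffOp K O) z x))
    ?_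
    (fun x y h1 h2 => ?_) (fun i P hi => ?_) hx
  · rw [map_zero]; exact .zero' n
  · rw [map_add]; exact h1.add h2
  · rw [Finsupp.linearCombination_single]; exact hi ▸ (hz i).smul P

/-- A graded derivation is a derivation twisted by the sign automorphism. As `V` is free over `𝒟`,
its values on the basis are arbitrary up to degree; only compatibility with the commutation
relations must be checked. -/
theorem exists_differential {z : I → FreeExt J deg} (hz : ∀ i, Lowered (deg i) (z i)) :
    ∃ δ : FreeExt J deg →+ FreeExt J deg,
      (∀ x y, δ (x * y) = δ x * y + sign J deg hJ.out x * δ y) ∧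
      (∀ a, δ (base deg a) = 0) ∧
      ∀ x, δ (var J deg x) = Finsupp.linearCombination (DiffOp K O) z x := by
  refine exists_twistedDerivation hJ.out (sign J deg hJ.out) (sign_base hJ.out) 0
    (fun a b => by simp) (fun a x => by simp)
    (Finsupp.linearCombination (DiffOp K O) z).toAddMonoidHom (fun r x => ?_)
    (fun m n x y hx hy => ?_)
  · rw [AddMonoidHom.zero_apply, zero_mul, zero_add]
    change Finsupp.linearCombination (DiffOp K O) z (r • x)
      = r • Finsupp.linearCombination (DiffOp K O) z x
    rw [← DiffOp.ofFun_smul K r x, map_smul, DiffOp.ofFun_smul]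
  · have hx' := Lowered.linearCombination hz hx
    have hy' := Lowered.linearCombination hz hy
    change Finsupp.linearCombination _ z x * _ + _ * Finsupp.linearCombination _ z y
      = _ * (Finsupp.linearCombination _ z y * _ + _ * Finsupp.linearCombination _ z x)
    rw [Homog.sign hJ.out (.var_mem hx), Homog.sign hJ.out (.var_mem hy),
      hx'.mul_comm hJ.out (.var_mem hy), hy'.mul_comm hJ.out (.var_mem hx), zsmul_sign, smul_add,
      smul_mul_assoc, smul_mul_assoc, smul_smul, smul_smul, ← pow_add, ← pow_add, add_comm,
      show m * n + (n * m + m) = m + 2 * (m * n) by ring, pow_add _ m, pow_mul _ 2]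
    simp

section differential

variable {z : I → FreeExt J deg} (hz : ∀ i, Lowered (deg i) (z i))

/-- The differential on `J ⊗ 𝒮V` with prescribed values on the generators. -/
def differential : FreeExt J deg →+ FreeExt J deg := (exists_differential hz).choose

theorem differential_mul (x y : FreeExt J deg) : differential hz (x * y) =
    differential hz x * y + sign J deg hJ.out x * differential hz y :=
  (exists_differential hz).choose_spec.1 x y

theorem differential_base (a : J.carrier) : differential hz (base deg a) = 0 :=
  (exists_differential hz).choose_spec.2.1 a

theorem differential_var (x : I →₀ DiffOp K O) :
    differential hz (var J deg x) = Finsupp.linearCombination (DiffOp K O) z x :=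
  (exists_differential hz).choose_spec.2.2 x

theorem differential_var_single (i : I) (P : DiffOp K O) :
    differential hz (var J deg (Finsupp.single i P)) = P • z i := by
  rw [differential_var, Finsupp.linearCombination_single]

theorem Homog.lowered_differential {n : ℕ} {a : FreeExt J deg} (h : Homog n a) :
    Lowered n (differential hz a) := by
  induction h with
  | zero n => rw [map_zero]; exact .zero' n
  | ofBase a => rw [differential_base]; rfl
  | ofVar i P => rw [differential_var_single]; exact (hz i).smul P
  | add _ _ h1 h2 => rw [map_add]; exact h1.add h2
  | mul ha hb h1 h2 =>
    rw [differential_mul, Homog.sign hJ.out ha]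
    exact (h1.mul_right hb).add (.mul_left (ha.zsmul _) h2)

theorem sign_differential (a : FreeExt J deg) :
    sign J deg hJ.out (differential hz a) = -differential hz (sign J deg hJ.out a) := by
  refine homog_induction hJ.out (p := fun a => sign J deg hJ.out (differential hz a)
    = -differential hz (sign J deg hJ.out a)) (fun n a ha => ?_) (fun a b h1 h2 => ?_) a
  · rw [(ha.lowered_differential hz).sign, ha.sign, map_zsmul]
  · rw [map_add, map_add, map_add, map_add, h1, h2, neg_add]

theorem sign_smul (P : DiffOp K O) (a : FreeExt J deg) :
    sign J deg hJ.out (P • a) = P • sign J deg hJ.out a := by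
  refine homog_induction hJ.out
    (p := fun a => sign J deg hJ.out (P • a) = P • sign J deg hJ.out a)
    (fun n a ha => ?_) (fun a b h1 h2 => ?_) a
  · rw [(ha.smul P).sign, ha.sign, smul_comm]
  · rw [smul_add, map_add, map_add, smul_add, h1, h2]

theorem differential_smul (P : DiffOp K O) (a : FreeExt J deg) :
    differential hz (P • a) = P • differential hz a := by
  refine DiffOp.map_smul_of_vec (differential hz) (fun f a => ?_) (fun θ a => ?_) P a
  · rw [Algebra.smul_def, ← AlgHom.commutes (base deg) f, differential_mul, differential_base,
      zero_mul, zero_add, sign_base, AlgHom.commutes, ← Algebra.smul_def]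
  · induction a using FreeExt.induction with
    | hb a => rw [smul_base, differential_base, differential_base, smul_zero]
    | hv i P => rw [smul_var, differential_var, differential_var, map_smul]
    | hadd a b h1 h2 => rw [smul_add, map_add, map_add, smul_add, h1, h2]
    | hmul a b h1 h2 =>
      rw [vec_mul, map_add, differential_mul, differential_mul, differential_mul, h1, h2, smul_add,
        vec_mul, vec_mul, sign_smul]
      abel

/-- The sign automorphism anticommutes with the differential, so the cross terms in the square
cancel: the square is an ordinary derivation and vanishes once it does on generators. -/
theorem differential_differential (hdz : ∀ i, differential hz (z i) = 0) (a : FreeExt J deg) :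
    differential hz (differential hz a) = 0 := by
  induction a using FreeExt.induction with
  | hb a => rw [differential_base, map_zero]
  | hv i P => rw [differential_var_single, differential_smul, hdz, smul_zero]
  | hadd a b h1 h2 => rw [map_add, map_add, h1, h2, add_zero]
  | hmul a b h1 h2 =>
    rw [differential_mul, map_add, differential_mul, differential_mul, h1, h2, sign_sign,
      sign_differential]
    simp

/-- The differential graded `𝒟`-algebra `(J ⊗ 𝒮V, d)`. -/
def toDGDA (hdz : ∀ i, differential hz (z i) = 0) : DGDA.{v, u, max u w w₁} K O where
  carrier := FreeExt J deg
  gr := gr J deg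
  mul_comm' {m n a b} ha hb := by
    rw [zsmul_sign]; exact Homog.mul_comm hJ.out ha hb
  vec_mul := vec_mul
  d := { differential hz with map_smul' := differential_smul hz }
  d_mem ha := Homog.lowered_differential hz ha
  d_zero ha := Homog.lowered_differential hz ha
  d_d := differential_differential hz hdz
  d_mul {m a} ha b := by
    change differential hz (a * b) = differential hz a * b + (-1) ^ m * (a * differential hz b)
    rw [differential_mul, Homog.sign hJ.out ha, zsmul_sign, smul_mul_assoc]

end differential

end FreeExt

end Basics

end


noncomputable section

section Basics

variable {K : Type v} {O : Type u} [Field K] [CommRing O] [Algebra K O]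

/-! ### Morphisms of `DG𝒟A` as maps of `O`-algebras -/

theorem DGDA.commute_of_mem_gr_zero (R : DGDA.{v, u, w} K O) {a : R.carrier} (ha : a ∈ R.gr 0)
    (b : R.carrier) : Commute a b := by
  classical
  rw [← DirectSum.sum_support_decompose R.gr b]
  refine Commute.sum_right _ _ _ fun i _ => ?_
  have h := R.mul_comm' ha (DirectSum.decompose R.gr b i).2
  rwa [zero_mul, pow_zero, one_mul] at h

theorem DGDHom.map_osmul {A : DGDA.{v, u, w₁} K O} {B : DGDA.{v, u, w₂} K O} (f : DGDHom A B)
    (r : O) (a : A.carrier) : f (r • a) = r • f a := f.toOLinear.map_smul r a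

/-- A morphism of `DG𝒟A` as a morphism of `O`-algebras. -/
def DGDHom.toAlgHom {A : DGDA.{v, u, w₁} K O} {B : DGDA.{v, u, w₂} K O} (f : DGDHom A B) :
    A.carrier →ₐ[O] B.carrier :=
  { f.toRingHom with
    commutes' := fun r => by
      change f (algebraMap O _ r) = _
      rw [Algebra.algebraMap_eq_smul_one, f.map_osmul, Algebra.algebraMap_eq_smul_one]
      exact congrArg (r • ·) f.toRingHom.map_one }

theorem freeMap_smul (R : DGDA.{v, u, w₁} K O) {I : Type w} (x : I → R.carrier) (P : DiffOp K O)
    (c : I →₀ DiffOp K O) : freeMap R x (P • c) = P • freeMap R x c :=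
  (Finsupp.linearCombination (DiffOp K O) x).map_smul P c

theorem freeMap_single (R : DGDA.{v, u, w₁} K O) {I : Type w} (x : I → R.carrier) (i : I)
    (P : DiffOp K O) : freeMap R x (Finsupp.single i P) = P • x i :=
  Finsupp.linearCombination_single (DiffOp K O) P i

namespace FreeExt

variable {J : DGDA.{v, u, w₁} K O} {R : DGDA.{v, u, w₂} K O} {I : Type w} {deg : I → ℕ}

/-! ### Morphisms out of free extensions -/

section liftHom

variable (hJ : J.IsDAlgebra) (j : DGDHom J R) (x : I → R.carrier) (hx : ∀ i, x i ∈ R.gr (deg i))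

/-- The algebra morphism `J ⊗ 𝒮V → R` given by a morphism `J → R` and the images of the
generators. -/
def liftHom : FreeExt J deg →ₐ[O] R.carrier :=
  liftAlg j.toAlgHom (freeMap R x)
    (fun _ _ _ _ h h' => R.mul_comm' (freeMap_mem R deg x hx _ _ h) (freeMap_mem R deg x hx _ _ h'))
    (fun a c => show Commute (j.toAlgHom a) (freeMap R x c) from
      R.commute_of_mem_gr_zero (j.map_gr' (hJ.mem_gr_zero a)) _)

theorem liftHom_base (a : J.carrier) : liftHom hJ j x hx (base deg a) = j a := liftAlg_base a

theorem liftHom_var (c : I →₀ DiffOp K O) : liftHom hJ j x hx (var J deg c) = freeMap R x c :=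
  liftAlg_var c

theorem liftHom_var_single (i : I) (P : DiffOp K O) :
    liftHom hJ j x hx (var J deg (Finsupp.single i P)) = P • x i := by
  rw [liftHom_var, freeMap_single]

theorem freeSymExtMap_eq (t : FreeExt J deg) :
    freeSymExtMap j deg x hx t = liftHom hJ j x hx t := by
  induction t using TensorProduct.induction_on with
  | zero => rw [map_zero, map_zero]
  | tmul a s => rfl
  | add a b h1 h2 => rw [map_add, map_add, h1, h2]

theorem liftHom_mem {n : ℕ} {t : FreeExt J deg} (h : Homog n t) : liftHom hJ j x hx t ∈ R.gr n := by
  induction h with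
  | zero n => rw [map_zero]; exact zero_mem _
  | ofBase a => rw [liftHom_base]; exact j.map_gr' (hJ.mem_gr_zero a)
  | ofVar i P => rw [liftHom_var_single]; exact Submodule.smul_mem _ _ (hx i)
  | add _ _ h1 h2 => rw [map_add]; exact add_mem h1 h2
  | mul _ _ h1 h2 => rw [map_mul]; exact SetLike.mul_mem_graded h1 h2

theorem decompose_liftHom (t : FreeExt J deg) (m : ℕ) :
    (DirectSum.decompose R.gr (liftHom hJ j x hx t) m : R.carrier)
      = liftHom hJ j x hx ((coact J deg hJ t).coeff m) := by
  refine homog_induction hJ (p := fun t =>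
    (DirectSum.decompose R.gr (liftHom hJ j x hx t) m : R.carrier)
      = liftHom hJ j x hx ((coact J deg hJ t).coeff m)) (fun n a ha => ?_) (fun a b h1 h2 => ?_) t
  · rw [ha.coact, Polynomial.coeff_monomial]
    split_ifs with h
    · exact DirectSum.decompose_of_mem_same _ (h ▸ liftHom_mem hJ j x hx ha)
    · rw [map_zero]
      exact DirectSum.decompose_of_mem_ne _ (liftHom_mem hJ j x hx ha) h
  · rw [map_add, DirectSum.decompose_add, map_add, Polynomial.coeff_add, map_add, ← h1, ← h2]
    rfl

theorem exists_homog_of_mem {m : ℕ} {t : FreeExt J deg} (ht : liftHom hJ j x hx t ∈ R.gr m) :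
    ∃ t', Homog m t' ∧ liftHom hJ j x hx t' = liftHom hJ j x hx t :=
  ⟨_, homog_coeff_coact hJ t m, by
    rw [← decompose_liftHom, DirectSum.decompose_of_mem_same _ ht]⟩

/-- Elements of degree `m` only involve generators of degree at most `m`. -/
theorem liftHom_mem_range {m : ℕ} {t : FreeExt J deg} (h : Homog m t) (S : Set I)
    (hS : ∀ i, deg i ≤ m → i ∈ S) : liftHom hJ j x hx t ∈
      (liftHom (deg := fun i : S => deg i) hJ j (fun i : S => x i) (fun i => hx i)).range := by
  induction h with
  | zero n => rw [map_zero]; exact zero_mem _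
  | ofBase a => exact ⟨base _ a, (liftHom_base ..).trans (liftHom_base ..).symm⟩
  | ofVar i P =>
    exact ⟨var _ _ (Finsupp.single ⟨i, hS i le_rfl⟩ P),
      (liftHom_var_single ..).trans (liftHom_var_single ..).symm⟩
  | add _ _ h1 h2 => rw [map_add]; exact add_mem (h1 hS) (h2 hS)
  | mul _ _ h1 h2 =>
    rw [map_mul]
    exact mul_mem (h1 fun i hi => hS i (hi.trans (Nat.le_add_right _ _)))
      (h2 fun i hi => hS i (hi.trans (Nat.le_add_left _ _)))

variable [Fact J.IsDAlgebra] [CharZero K] [Algebra.Smooth K O]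

theorem liftHom_smul (P : DiffOp K O) (t : FreeExt J deg) :
    liftHom hJ j x hx (P • t) = P • liftHom hJ j x hx t := by
  refine DiffOp.map_smul_of_vec (liftHom hJ j x hx).toLinearMap.toAddMonoidHom
    (fun f a => map_smul (liftHom hJ j x hx) f a) (fun θ a => ?_) P t
  change liftHom hJ j x hx (DiffOp.ofVec K θ • a) = DiffOp.ofVec K θ • liftHom hJ j x hx a
  induction a using FreeExt.induction with
  | hb a => rw [smul_base, liftHom_base, liftHom_base]; exact j.map_smul' _ _
  | hv i P => rw [smul_var, liftHom_var, liftHom_var, freeMap_smul]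
  | hadd a b h1 h2 => rw [smul_add, map_add, map_add, smul_add, h1, h2]
  | hmul a b h1 h2 => rw [vec_mul, map_add, map_mul, map_mul, map_mul, R.vec_mul, h1, h2]

end liftHom

/-! ### `(J ⊗ 𝒮V, d)` as a relative Sullivan algebra -/

section toDGDA

variable [hJ : Fact J.IsDAlgebra] [CharZero K] [Algebra.Smooth K O]
  {z : I → FreeExt J deg} (hz : ∀ i, Lowered (deg i) (z i)) (hdz : ∀ i, differential hz (z i) = 0)

/-- The inclusion `J → J ⊗ 𝒮V`. -/
def baseHom : DGDHom J (toDGDA hz hdz) :=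
  { (base deg : J.carrier →ₐ[O] FreeExt J deg).toRingHom with
    map_smul' := fun P a => (smul_base P a).symm
    map_gr' := fun {n a} ha => by
      obtain rfl | hn := Nat.eq_zero_or_pos n
      · exact Homog.ofBase a
      · have h0 := (Submodule.eq_bot_iff _).1 (hJ.out.1 n hn) _ ha
        rw [h0]
        change base deg 0 ∈ gr J deg n
        rw [map_zero]; exact zero_mem _
    map_d' := fun a => by
      change base deg (J.d a) = differential hz (base deg a)
      rw [hJ.out.2, LinearMap.zero_apply, map_zero, differential_base] }

/-- The morphism `J ⊗ 𝒮V → Q` given by a morphism `J → Q` and images of the generators that are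
compatible with the differentials. -/
def descHom {Q : DGDA.{v, u, w₂} K O} (φ : DGDHom J Q) (y : I → Q.carrier)
    (hy : ∀ i, y i ∈ Q.gr (deg i)) (hd : ∀ i, liftHom hJ.out φ y hy (z i) = Q.d (y i)) :
    DGDHom (toDGDA hz hdz) Q :=
  { (liftHom hJ.out φ y hy).toRingHom with
    map_smul' := liftHom_smul hJ.out φ y hy
    map_gr' := liftHom_mem hJ.out φ y hy
    map_d' := by
      refine homog_induction hJ.out (fun n a ha => ?_) (fun a b h1 h2 => ?_)
      · change liftHom hJ.out φ y hy (differential hz a) = Q.d (liftHom hJ.out φ y hy a)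
        induction ha with
        | zero n => simp only [map_zero]
        | ofBase a =>
          rw [differential_base, map_zero, liftHom_base]
          have h : φ (J.d a) = Q.d (φ a) := φ.map_d' a
          rw [← h, hJ.out.2, LinearMap.zero_apply]
          exact (map_zero φ.toRingHom).symm
        | ofVar i P =>
          rw [differential_var_single, liftHom_smul, liftHom_var_single, map_smul, hd]
        | add _ _ h1 h2 => simp only [map_add, h1, h2]
        | mul ha hb h1 h2 =>
          rw [differential_mul, map_mul, Q.d_mul (liftHom_mem hJ.out φ y hy ha), map_add, map_mul,
            map_mul, ha.sign, map_zsmul, h1, h2, zsmul_sign, smul_mul_assoc]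
      · exact ((congrArg _ (map_add _ _ _)).trans (map_add _ _ _)).trans
          ((congrArg₂ (· + ·) h1 h2).trans
            ((congrArg _ (map_add _ _ _)).trans (map_add _ _ _)).symm) }

theorem var_single_mem (i : I) :
    var J deg (Finsupp.single i 1) ∈ (toDGDA hz hdz).gr (deg i) := Homog.ofVar i 1

theorem liftHom_baseHom (t : FreeExt J deg) :
    liftHom hJ.out (baseHom hz hdz) (fun i => var J deg (Finsupp.single i 1))
      (var_single_mem hz hdz) t = t := by
  induction t using FreeExt.induction with
  | hb a => exact liftHom_base ..
  | hv i P =>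
    refine (liftHom_var_single ..).trans ((smul_var P (Finsupp.single i (1 : DiffOp K O))).trans ?_)
    rw [Finsupp.smul_single, smul_eq_mul, mul_one]
  | hadd a b h1 h2 => exact (map_add (liftHom ..) a b).trans (congrArg₂ (· + ·) h1 h2)
  | hmul a b h1 h2 => exact (map_mul (liftHom ..) a b).trans (congrArg₂ (· * ·) h1 h2)

/-- The generators of `J ⊗ 𝒮V` form a Sullivan basis. -/
def sullivanBasis [LinearOrder I] [WellFoundedLT I] (hdeg : ∀ α β : I, α ≤ β → deg α ≤ deg β) :
    SullivanBasis.{v, u, w₁, max u w w₁, w} (baseHom hz hdz) where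
  index := I
  deg := deg
  gen i := var J deg (Finsupp.single i 1)
  gen_mem := var_single_mem hz hdz
  bijective := by
    have h : (freeSymExtMap (baseHom hz hdz) deg (fun i => var J deg (Finsupp.single i 1))
      (var_single_mem hz hdz) : FreeExt J deg → FreeExt J deg) = id :=
      funext fun t => (freeSymExtMap_eq hJ.out _ _ _ t).trans (liftHom_baseHom hz hdz t)
    exact h ▸ Function.bijective_id
  lowering α := by
    have h1 : (toDGDA hz hdz).d (var J deg (Finsupp.single α 1)) = z α := by
      change differential hz _ = _
      rw [differential_var_single, one_smul]
    rw [h1]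
    have h2 := hz α
    cases hα : deg α with
    | zero =>
      rw [hα] at h2
      rw [show z α = 0 from h2]
      exact zero_mem _
    | succ n =>
      rw [hα] at h2
      -- `z α` has degree `n = deg α - 1`, so it involves only generators of degree at most `n`;
      -- these precede `α` since the order refines the degree.
      obtain ⟨t, ht⟩ := liftHom_mem_range hJ.out (baseHom hz hdz) _ (var_single_mem hz hdz) h2
        (Set.Iio α) (fun i hi => lt_of_not_ge fun hle => by have := hdeg _ _ hle; omega)
      refine ⟨t, (freeSymExtMap_eq hJ.out _ _ _ t).trans ?_⟩
      exact ht.trans (liftHom_baseHom hz hdz _)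

end toDGDA

end FreeExt

/-- Order lexicographically, first by degree and then by an arbitrary well-ordering. -/
theorem exists_wellOrder_monotone {I : Type w} (deg : I → ℕ) :
    ∃ _ : LinearOrder I, WellFoundedLT I ∧ ∀ α β : I, α ≤ β → deg α ≤ deg β := by
  obtain ⟨r, wo⟩ : ∃ r : LinearOrder I, @WellFoundedLT I r.toLT :=
    ⟨IsWellOrder.linearOrder WellOrderingRel, WellOrderingRel.isWellOrder.toIsWellFounded⟩
  let f : I → ℕ ×ₗ I := fun i => toLex (deg i, i)
  have hf : Function.Injective f := fun i k h => congrArg (fun p => (ofLex p).2) h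
  refine ⟨LinearOrder.lift' f hf, ⟨InvImage.wf f wellFounded_lt⟩, fun α β h => ?_⟩
  have h' : f α ≤ f β := h
  rcases (Prod.Lex.le_iff ..).1 h' with h1 | h1
  · exact le_of_lt h1
  · exact le_of_eq h1.1

end Basics

end


noncomputable section

/-! # Existence of resolutions -/

section Basics

variable {K : Type v} {O : Type u} [Field K] [CommRing O] [Algebra K O]

/-- Expressions for the elements of the resolution of a morphism `J → Q`: `var n t b` stands for a
generator of degree `n` whose boundary is (the value of) `t` and whose image is `b`. -/
inductive ResExpr (J Q : DGDA.{v, u, u} K O) : Type u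
  | base (a : J.carrier)
  | var (n : ℕ) (t : ResExpr J Q) (b : Q.gr n)
  | add (s t : ResExpr J Q)
  | mul (s t : ResExpr J Q)
  | act (P : DiffOp K O) (t : ResExpr J Q)

/-- The generators of the resolution. -/
structure ResCell (J Q : DGDA.{v, u, u} K O) : Type u where
  deg : ℕ
  bdry : ResExpr J Q
  image : Q.gr deg

namespace ResExpr

open FreeExt

variable {J Q : DGDA.{v, u, u} K O} [hJ : Fact J.IsDAlgebra] [CharZero K] [Algebra.Smooth K O]

/-- The value of an expression. -/
def eval : ResExpr J Q → FreeExt J (ResCell.deg (J := J) (Q := Q))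
  | base a => FreeExt.base _ a
  | var n t b => FreeExt.var J _ (Finsupp.single ⟨n, t, b⟩ 1)
  | add s t => eval s + eval t
  | mul s t => eval s * eval t
  | act P t => P • eval t

open Classical in
/-- The boundary and the image in `Q` of an expression. A generator `var n t b` for which `t` and
`b` do not fit together gets boundary and image zero. -/
def bdryImage (φ : DGDHom J Q) :
    ResExpr J Q → FreeExt J (ResCell.deg (J := J) (Q := Q)) × Q.carrier
  | base a => (0, φ a)
  | var n t b =>
    if Lowered n (eval t) ∧ (bdryImage φ t).1 = 0 ∧ (bdryImage φ t).2 = Q.d b then (eval t, b)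
    else (0, 0)
  | add s t => bdryImage φ s + bdryImage φ t
  | mul s t => ((bdryImage φ s).1 * eval t + sign J _ hJ.out (eval s) * (bdryImage φ t).1,
      (bdryImage φ s).2 * (bdryImage φ t).2)
  | act P t => (P • (bdryImage φ t).1, P • (bdryImage φ t).2)

theorem eval_surjective : Function.Surjective (eval (J := J) (Q := Q)) := by
  intro x
  induction x using FreeExt.induction with
  | hb a => exact ⟨base a, rfl⟩
  | hv c P =>
    refine ⟨act P (var c.deg c.bdry c.image), ?_⟩
    change P • FreeExt.var J _ (Finsupp.single c 1) = _
    rw [smul_var, Finsupp.smul_single, smul_eq_mul, mul_one]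
  | hadd a b h1 h2 =>
    obtain ⟨s, rfl⟩ := h1
    obtain ⟨t, rfl⟩ := h2
    exact ⟨add s t, rfl⟩
  | hmul a b h1 h2 =>
    obtain ⟨s, rfl⟩ := h1
    obtain ⟨t, rfl⟩ := h2
    exact ⟨mul s t, rfl⟩

end ResExpr

namespace ResCell

open FreeExt ResExpr

variable {J Q : DGDA.{v, u, u} K O} [hJ : Fact J.IsDAlgebra] [CharZero K] [Algebra.Smooth K O]
  (φ : DGDHom J Q)

/-- The boundary of a generator. -/
def bdryVal (c : ResCell J Q) : FreeExt J (ResCell.deg (J := J) (Q := Q)) :=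
  (bdryImage φ (.var c.deg c.bdry c.image)).1

/-- The image of a generator in `Q`. -/
def imageVal (c : ResCell J Q) : Q.carrier :=
  (bdryImage φ (.var c.deg c.bdry c.image)).2

theorem cases (c : ResCell J Q) :
    (Lowered c.deg (eval c.bdry) ∧ (bdryImage φ c.bdry).1 = 0 ∧
      (bdryImage φ c.bdry).2 = Q.d c.image ∧ bdryVal φ c = eval c.bdry ∧ imageVal φ c = c.image) ∨
    (bdryVal φ c = 0 ∧ imageVal φ c = 0) := by
  rw [bdryVal, imageVal, bdryImage]
  split_ifs with h
  · exact Or.inl ⟨h.1, h.2.1, h.2.2, rfl, rfl⟩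
  · exact Or.inr ⟨rfl, rfl⟩

theorem vals_of_admissible {n : ℕ} {t : ResExpr J Q} {b : Q.gr n} (h : Lowered n (eval t))
    (h1 : (bdryImage φ t).1 = 0) (h2 : (bdryImage φ t).2 = Q.d b) :
    bdryVal φ ⟨n, t, b⟩ = eval t ∧ imageVal φ ⟨n, t, b⟩ = b := by
  rw [bdryVal, imageVal, bdryImage, if_pos ⟨h, h1, h2⟩]
  exact ⟨rfl, rfl⟩

theorem lowered_bdryVal (c : ResCell J Q) : Lowered c.deg (bdryVal φ c) := by
  rcases cases φ c with h | h
  · rw [h.2.2.2.1]; exact h.1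
  · rw [h.1]; exact .zero' _

theorem imageVal_mem (c : ResCell J Q) : imageVal φ c ∈ Q.gr c.deg := by
  rcases cases φ c with h | h
  · rw [h.2.2.2.2]; exact c.image.2
  · rw [h.2]; exact zero_mem _

/-- The recursion for formal boundaries copies the Leibniz rule and `𝒟`-linearity, so it computes
the differential that was defined from it. Hence the admissibility test on triples, stated formally,
is a statement about actual cycles and images. -/
theorem differential_eval (t : ResExpr J Q) :
    differential (lowered_bdryVal φ) (eval t) = (bdryImage φ t).1 := by
  induction t with
  | base a => exact differential_base ..
  | var n t b _ => exact (differential_var_single ..).trans (one_smul _ _)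
  | add s t h1 h2 => rw [eval, map_add, h1, h2]; rfl
  | mul s t h1 h2 => rw [eval, differential_mul, h1, h2]; rfl
  | act P t h1 => rw [eval, differential_smul, h1]; rfl

theorem liftHom_eval (t : ResExpr J Q) :
    liftHom hJ.out φ (imageVal φ) (imageVal_mem φ) (eval t) = (bdryImage φ t).2 := by
  induction t with
  | base a => exact liftHom_base ..
  | var n t b _ => exact (liftHom_var_single ..).trans (one_smul _ _)
  | add s t h1 h2 => rw [eval, map_add, h1, h2]; rfl
  | mul s t h1 h2 => rw [eval, map_mul, h1, h2]; rfl
  | act P t h1 => rw [eval, liftHom_smul, h1]; rfl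

theorem differential_bdryVal (c : ResCell J Q) :
    differential (lowered_bdryVal φ) (bdryVal φ c) = 0 := by
  rcases cases φ c with h | h
  · rw [h.2.2.2.1, differential_eval, h.2.1]
  · rw [h.1, map_zero]

theorem liftHom_bdryVal (c : ResCell J Q) :
    liftHom hJ.out φ (imageVal φ) (imageVal_mem φ) (bdryVal φ c) = Q.d (imageVal φ c) := by
  rcases cases φ c with h | h
  · rw [h.2.2.2.1, h.2.2.2.2, liftHom_eval, h.2.2.1]
  · rw [h.1, h.2, map_zero, map_zero]

end ResCell

section Resolution

open FreeExt ResExpr ResCell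

variable {J Q : DGDA.{v, u, u} K O} [hJ : Fact J.IsDAlgebra] [CharZero K] [Algebra.Smooth K O]
  (φ : DGDHom J Q)

/-- The source of the resolution. -/
def resolution : DGDA.{v, u, u} K O := toDGDA (lowered_bdryVal φ) (differential_bdryVal φ)

/-- The resolution as a morphism to `Q`. -/
def resolutionHom : DGDHom (resolution φ) Q :=
  descHom (lowered_bdryVal φ) (differential_bdryVal φ) φ (imageVal φ) (imageVal_mem φ)
    (liftHom_bdryVal φ)

/-- Choose any expression `t` for `r`; the hypotheses say exactly that the triple `(n, t, b)` is
admissible. In degree zero `Lowered` forces `r = 0`, so every element of `Q.gr 0` is hit as well. -/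
theorem exists_generator {n : ℕ} (r : FreeExt J (ResCell.deg (J := J) (Q := Q)))
    (hr : Lowered n r) (b : Q.gr n) (hdr : differential (lowered_bdryVal φ) r = 0)
    (hb : liftHom hJ.out φ (imageVal φ) (imageVal_mem φ) r = Q.d b) :
    ∃ g ∈ (resolution φ).gr n, (resolution φ).d g = r ∧ resolutionHom φ g = b := by
  obtain ⟨t, rfl⟩ := eval_surjective (Q := Q) r
  rw [differential_eval] at hdr
  rw [liftHom_eval] at hb
  obtain ⟨h1, h2⟩ := vals_of_admissible φ hr hdr hb
  refine ⟨FreeExt.var J _ (Finsupp.single ⟨n, t, b⟩ 1),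
    Homog.ofVar (deg := ResCell.deg) (⟨n, t, b⟩ : ResCell J Q) 1, ?_, ?_⟩
  · exact (differential_var_single ..).trans ((one_smul _ _).trans h1)
  · exact (liftHom_var_single hJ.out φ (imageVal φ) (imageVal_mem φ) _ _).trans
      ((one_smul _ _).trans h2)

theorem exists_cycle {n : ℕ} (b : Q.gr n) (hb : Q.d b = 0) :
    ∃ g ∈ (resolution φ).gr n, (resolution φ).d g = 0 ∧ resolutionHom φ g = b :=
  exists_generator φ 0 (.zero' n) b (map_zero _) (by rw [map_zero, hb])

theorem resolutionHom_isFibration : (resolutionHom φ).IsFibration := by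
  intro n hn b hb
  obtain ⟨m, rfl⟩ : ∃ m, n = m + 1 := ⟨n - 1, by omega⟩
  -- First a cycle `g` over the cycle `d b`, then a generator with boundary `g` and image `b`.
  obtain ⟨g, hg, hdg, hgb⟩ := exists_cycle φ ⟨Q.d b, Q.d_mem hb⟩ (Q.d_d b)
  obtain ⟨g', hg', -, h⟩ := exists_generator φ (n := m + 1) g hg ⟨b, hb⟩ hdg hgb
  exact ⟨g', hg', h⟩

theorem resolutionHom_isQuasiIso : (resolutionHom φ).IsQuasiIso := by
  refine fun n => ⟨(injective_iff_map_eq_zero _).2 fun x hx => ?_, fun y => ?_⟩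
  · obtain ⟨⟨r, hr⟩, rfl⟩ := Submodule.Quotient.mk_surjective _ x
    have h1 := (Submodule.Quotient.mk_eq_zero _).1 hx
    obtain ⟨b, hb, hbr⟩ := h1
    obtain ⟨g, hg, hdg, -⟩ := exists_generator φ (n := n + 1) r hr.1 ⟨b, hb⟩
      (LinearMap.mem_ker.1 hr.2) hbr.symm
    exact (Submodule.Quotient.mk_eq_zero _).2 ⟨g, hg, hdg⟩
  · obtain ⟨⟨b, hb⟩, rfl⟩ := Submodule.Quotient.mk_surjective _ y
    obtain ⟨g, hg, hdg, hgb⟩ := exists_cycle φ ⟨b, hb.1⟩ (LinearMap.mem_ker.1 hb.2)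
    exact ⟨Submodule.Quotient.mk ⟨g, hg, LinearMap.mem_ker.2 hdg⟩,
      congrArg Submodule.Quotient.mk (Subtype.ext hgb)⟩

/-- Every morphism has a minimal cofibrant replacement Koszul-Tate resolution. -/
theorem exists_minimal_resolution :
    ∃ (R : DGDA.{v, u, u} K O) (j : DGDHom J R) (q : DGDHom R Q),
      DGDHom.IsCofibrantReplacementKTR φ j q ∧ j.IsMinimalRelativeSullivan := by
  obtain ⟨_, _, hdeg⟩ := exists_wellOrder_monotone (ResCell.deg (J := J) (Q := Q))
  let S := sullivanBasis (lowered_bdryVal φ) (differential_bdryVal φ) hdeg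
  exact ⟨resolution φ, baseHom (lowered_bdryVal φ) (differential_bdryVal φ), resolutionHom φ,
    ⟨⟨S⟩, ⟨resolutionHom_isFibration φ, resolutionHom_isQuasiIso φ⟩,
    fun a => liftHom_base hJ.out φ (imageVal φ) (imageVal_mem φ) a⟩,
    S, hdeg⟩

end Resolution

end Basics

end


noncomputable section

section Basics

variable {K : Type v} {O : Type u} [Field K] [CommRing O] [Algebra K O]

/-! # Idempotent functions and projectivity -/

theorem Derivation.map_idempotent (θ : Derivation K O O) {e : O} (he : IsIdempotentElem e) :
    θ e = 0 := by
  have h1 : θ e = e * θ e + e * θ e := by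
    conv_lhs => rw [← he.eq, Derivation.leibniz, smul_eq_mul]
  have h2 : e * θ e = e * θ e + e * θ e := by
    conv_lhs => rw [h1, mul_add, ← mul_assoc, he.eq]
  have h3 : e * θ e = 0 := by simpa using h2
  rw [h1, h3, add_zero]

/-- Vector fields kill idempotents, so multiplication by one commutes with the generators of `𝒟`. -/
theorem DiffOp.ofFun_idempotent_comm {e : O} (he : IsIdempotentElem e) (P : DiffOp K O) :
    P * ofFun K e = ofFun K e * P := by
  induction P using DiffOp.induction with
  | hf f => rw [← map_mul, mul_comm, map_mul]
  | hv θ =>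
    refine Subtype.ext (LinearMap.ext fun x => ?_)
    change θ (e * x) = e * θ x
    rw [Derivation.leibniz, θ.map_idempotent he, smul_zero, add_zero, smul_eq_mul]
  | hadd P Q h1 h2 => rw [add_mul, mul_add, h1, h2]
  | hmul P Q h1 h2 => rw [mul_assoc, h2, ← mul_assoc, h1, mul_assoc]

/-- The functions acting by zero on a `𝒟`-algebra form an ideal generated by an idempotent. -/
theorem DGDA.exists_idempotent [CharZero K] [Algebra.Smooth K O] (J : DGDA.{v, u, w} K O) :
    ∃ e : O, IsIdempotentElem e ∧ ∀ f : O, algebraMap O J.carrier f = 0 ↔ (1 - e) * f = 0 := by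
  obtain ⟨e, he, hspan⟩ := exists_idempotent_of_stable (K := K)
    (a := RingHom.ker (algebraMap O J.carrier)) (fun θ g hg => by
      rw [RingHom.mem_ker] at hg ⊢
      rw [← J.vec_algebraMap, hg, smul_zero])
  refine ⟨e, he, fun f => ?_⟩
  rw [← RingHom.mem_ker, hspan, Ideal.mem_span_singleton']
  constructor
  · rintro ⟨a, rfl⟩
    rw [mul_comm a, ← mul_assoc, sub_mul, he.eq, one_mul, sub_self, zero_mul]
  · intro h
    exact ⟨f, by rw [sub_mul, one_mul, sub_eq_zero] at h; rw [mul_comm, ← h]⟩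

/-! ### Detection of generators, and subsets of generators -/

namespace FreeExt

variable {J : DGDA.{v, u, w₁} K O} {R : DGDA.{v, u, w₂} K O} {I : Type w} {deg : I → ℕ}

theorem base_injective : Function.Injective (base (J := J) deg) :=
  Function.LeftInverse.injective (g := liftAlg (AlgHom.id O J.carrier) 0
    (fun _ _ _ _ _ _ => by simp) (fun _ _ => Commute.zero_right _)) fun a => liftAlg_base a

/-- The value at `f` of the `i`-th component, as a map on `V`. -/
def evalCoeff (i : I) (f : O) : (I →₀ DiffOp K O) →ₗ[O] O where
  toFun c := (c i).1 f
  map_add' _ _ := rfl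
  map_smul' _ _ := rfl

/-- The functional `c ↦ (c i)(f)` on `V` extends to an algebra map from `𝒮V` to the dual numbers
over `O`, with values of square zero. Its second component, tensored with `J`, sends `1 ⊗ c` to the
image of `(c i)(f)` in `J`. -/
theorem algebraMap_eq_zero_of_var {c : I →₀ DiffOp K O} (h : var J deg c = 0) (i : I) (f : O) :
    algebraMap O J.carrier ((c i).1 f) = 0 := by
  let F : GrSym (freeGr K O deg) →ₐ[O] TrivSqZeroExt O O :=
    GrSym.liftAlg ((TrivSqZeroExt.inrHom O O) ∘ₗ evalCoeff i f) (fun m n x y _ _ => by simp)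
  have h1 := congrArg (TensorProduct.rid O J.carrier ∘
    TensorProduct.map LinearMap.id (TrivSqZeroExt.sndHom O O ∘ₗ F.toLinearMap)) h
  have h2 : F (GrSym.ι _ c) = TrivSqZeroExt.inr ((c i).1 f) := GrSym.liftAlg_ι _ _ c
  rw [var_apply, Function.comp_apply, TensorProduct.map_tmul, LinearMap.comp_apply,
    AlgHom.toLinearMap_apply, h2] at h1
  simpa [Algebra.algebraMap_eq_smul_one] using h1

theorem lmapDomain_mem_freeGr (S : Set I) {n : ℕ} {x : S →₀ DiffOp K O}
    (hx : x ∈ freeGr K O (fun i : S => deg i) n) :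
    Finsupp.lmapDomain (DiffOp K O) O Subtype.val x ∈ freeGr K O deg n := by
  refine freeGr_induction (p := fun x =>
    Finsupp.lmapDomain (DiffOp K O) O Subtype.val x ∈ freeGr K O deg n) ?_
    (fun x y h1 h2 => ?_) (fun i P hi => ?_) hx
  · rw [map_zero]; exact zero_mem _
  · rw [map_add]; exact add_mem h1 h2
  · rw [Finsupp.lmapDomain_apply, Finsupp.mapDomain_single]
    exact hi ▸ single_mem_freeGr deg (i : I) P

theorem lsubtypeDomain_mem_freeGr (S : Set I) {n : ℕ} {x : I →₀ DiffOp K O}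
    (hx : x ∈ freeGr K O deg n) :
    Finsupp.lsubtypeDomain (R := O) S x ∈ freeGr K O (fun i : S => deg i) n := by
  intro i hi
  have hi' : Finsupp.lsubtypeDomain (R := O) S x i ≠ 0 :=
    Finsupp.mem_support_iff.1 (Finset.mem_coe.1 hi)
  exact hx (Finset.mem_coe.2 (Finsupp.mem_support_iff.2 hi'))

theorem lsubtypeDomain_lmapDomain (S : Set I) (x : S →₀ DiffOp K O) :
    Finsupp.lsubtypeDomain (R := O) S (Finsupp.lmapDomain (DiffOp K O) O Subtype.val x) = x := by
  ext i : 1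
  exact Finsupp.mapDomain_apply Subtype.val_injective x i

theorem lsubtypeDomain_lmapDomain_of_disjoint {S T : Set I} (h : Disjoint S T)
    (x : S →₀ DiffOp K O) :
    Finsupp.lsubtypeDomain (R := O) T (Finsupp.lmapDomain (DiffOp K O) O Subtype.val x) = 0 := by
  ext i : 1
  refine Finsupp.mapDomain_of_notMem_range x _ ?_
  rintro ⟨k, hk⟩
  exact Set.disjoint_left.1 h k.2 (hk ▸ i.2)

/-- The inclusion of the free extension on a subset of the generators. -/
def incl (hJ : J.IsDAlgebra) (S : Set I) :
    FreeExt J (fun i : S => deg i) →ₐ[O] FreeExt J deg :=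
  liftAlg (base deg) (var J deg ∘ₗ Finsupp.lmapDomain (DiffOp K O) O Subtype.val)
    (fun _ _ _ _ hx hy => var_mul_var (lmapDomain_mem_freeGr S hx) (lmapDomain_mem_freeGr S hy))
    (fun a _ => base_mul_comm hJ a _)

/-- The retraction onto the free extension on a subset of the generators. -/
def retr (hJ : J.IsDAlgebra) (S : Set I) :
    FreeExt J deg →ₐ[O] FreeExt J (fun i : S => deg i) :=
  liftAlg (base _) (var J _ ∘ₗ Finsupp.lsubtypeDomain (R := O) S)
    (fun _ _ _ _ hx hy =>
      var_mul_var (lsubtypeDomain_mem_freeGr S hx) (lsubtypeDomain_mem_freeGr S hy))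
    (fun a _ => base_mul_comm hJ a _)

section

variable (hJ : J.IsDAlgebra) (S : Set I)

theorem incl_base (a : J.carrier) : incl (deg := deg) hJ S (base _ a) = base deg a :=
  liftAlg_base a

theorem incl_var (x : S →₀ DiffOp K O) : incl (deg := deg) hJ S (var J _ x) =
    var J deg (Finsupp.lmapDomain (DiffOp K O) O Subtype.val x) :=
  liftAlg_var x

theorem incl_injective : Function.Injective (incl (deg := deg) hJ S) := by
  refine Function.LeftInverse.injective (g := retr hJ S) (RingHom.congr_fun
    (f := (retr hJ S).toRingHom.comp (incl hJ S).toRingHom) (g := RingHom.id _)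
    (ringHom_ext (fun a => ?_) (fun x => ?_)))
  · change retr hJ S (incl hJ S (base _ a)) = _
    rw [incl_base]
    exact liftAlg_base a
  · change retr hJ S (incl hJ S (var J _ x)) = _
    rw [incl_var]
    refine (liftAlg_var _).trans ?_
    rw [LinearMap.comp_apply, lsubtypeDomain_lmapDomain]
    rfl

theorem liftHom_incl (j : DGDHom J R) (x : I → R.carrier) (hx : ∀ i, x i ∈ R.gr (deg i))
    (t : FreeExt J (fun i : S => deg i)) : liftHom hJ j x hx (incl hJ S t) =
      liftHom (deg := fun i : S => deg i) hJ j (fun i : S => x i) (fun i => hx i) t := by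
  induction t using FreeExt.induction with
  | hb a => rw [incl_base, liftHom_base, liftHom_base]
  | hv i P =>
    rw [incl_var, liftHom_var_single, Finsupp.lmapDomain_apply, Finsupp.mapDomain_single,
      liftHom_var_single]
  | hadd a b h1 h2 => rw [map_add, map_add, map_add, h1, h2]
  | hmul a b h1 h2 => rw [map_mul, map_mul, map_mul, h1, h2]

end

end FreeExt

end Basics

end


noncomputable section

section Basics

variable {K : Type v} {O : Type u} [Field K] [CommRing O] [Algebra K O]

namespace FreeExt

variable {J : DGDA.{v, u, w₁} K O} {R : DGDA.{v, u, w₂} K O} {I : Type w} {deg : I → ℕ}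

/-! ### Splitting the generators -/

/-- The automorphism `a ↦ (-1)^{n|a|} a`. -/
theorem exists_signPow (hJ : J.IsDAlgebra) (n : ℕ) :
    ∃ σ : FreeExt J deg →ₐ[O] FreeExt J deg, (∀ a, σ (base deg a) = base deg a) ∧
      ∀ m x, x ∈ freeGr K O deg m → σ (var J deg x) = ((-1 : ℤ) ^ (m * n)) • var J deg x := by
  rcases Nat.even_or_odd n with h | h
  · exact ⟨AlgHom.id O _, fun _ => rfl, fun m x _ => by
      rw [(h.mul_left m).neg_one_pow, one_smul]; rfl⟩
  · refine ⟨{ sign J deg hJ with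
      commutes' := fun r => ?_ }, sign_base hJ, fun m x hx => ?_⟩
    · change sign J deg hJ (algebraMap O _ r) = _
      rw [← AlgHom.commutes (base deg) r, sign_base]
    · refine ((Homog.var_mem hx).sign hJ).trans ?_
      rw [Nat.mul_comm, pow_mul, h.neg_one_pow]

section splitting

variable {S T : Set I} {n : ℕ}

/-- The tensor product of the free extensions on two sets of generators. -/
abbrev SplitExt (J : DGDA.{v, u, w₁} K O) (deg : I → ℕ) (S T : Set I) : Type _ :=
  FreeExt J (fun i : S => deg i) ⊗[O] GrSym (freeGr K O fun i : T => deg i)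

variable (J deg S T) in
/-- Left multiplication on the first factor. -/
def mulFst : FreeExt J (fun i : S => deg i) →ₐ[O] Module.End O (SplitExt J deg S T) :=
  (Module.End.rTensorAlgHom O _ _).comp (Algebra.lmul O _)

variable (J deg S T) in
/-- Left multiplication on the second factor. -/
def mulSnd : GrSym (freeGr K O fun i : T => deg i) →ₐ[O] Module.End O (SplitExt J deg S T) :=
  (Module.End.lTensorAlgHom O _ _).comp (Algebra.lmul O _)

theorem mulFst_tmul (a b : FreeExt J (fun i : S => deg i)) (s) :
    mulFst J deg S T a (b ⊗ₜ s) = (a * b) ⊗ₜ s := rfl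

theorem mulFst_mulSnd (a r) :
    mulFst J deg S T a * mulSnd J deg S T r = mulSnd J deg S T r * mulFst J deg S T a :=
  TensorProduct.ext' fun _ _ => rfl

theorem lsubtypeDomain_eq_zero (hT : ∀ i ∈ T, deg i = n) {m : ℕ} (hm : m ≠ n)
    {x : I →₀ DiffOp K O} (hx : x ∈ freeGr K O deg m) :
    Finsupp.lsubtypeDomain (R := O) T x = 0 := by
  ext i : 1
  by_contra h
  have h1 : deg (i : I) = m := hx (Finset.mem_coe.2 (Finsupp.mem_support_iff.2 h))
  exact hm (h1 ▸ hT i i.2)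

/-- The sign rule for `a + w κ`, where `κ` supplies the sign of moving `w` across `a`. -/
theorem swap_twistedSum {E : Type*} [Ring E] {a a' w w' κ : E} {p q n : ℕ}
    (e1 : a * a' = (-1) ^ (p * q) * (a' * a)) (e2 : w * w' = (-1) ^ (p * q) * (w' * w))
    (e3 : κ * a = (-1) ^ (p * n) * a * κ) (e4 : κ * a' = (-1) ^ (q * n) * a' * κ)
    (e5 : κ * w = w * κ) (e6 : κ * w' = w' * κ) (e7 : a * w' = w' * a) (e8 : a' * w = w * a')
    (hp : p ≠ n → w = 0) (hq : q ≠ n → w' = 0) :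
    (a + w * κ) * (a' + w' * κ) = (-1) ^ (p * q) * ((a' + w' * κ) * (a + w * κ)) := by
  have h : ∀ (k : ℕ) (z : E), (-1) ^ k * z = ((-1 : ℤ) ^ k) • z := fun k z => by
    rw [zsmul_eq_mul]; push_cast; rfl
  rw [h, smul_mul_assoc] at e3 e4
  rw [h] at e1 e2 ⊢
  have g1 : w * κ * a' = ((-1 : ℤ) ^ (p * q)) • (a' * (w * κ)) := by
    by_cases h : p = n
    · rw [mul_assoc, e4, mul_smul_comm, ← mul_assoc, ← mul_assoc, e8, h, Nat.mul_comm]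
    · rw [hp h]; simp
  have g2 : a * (w' * κ) = ((-1 : ℤ) ^ (p * q)) • (w' * κ * a) := by
    by_cases h : q = n
    · rw [mul_assoc, e3, mul_smul_comm, smul_smul, ← mul_assoc, ← mul_assoc, e7, h, ← mul_pow]
      simp
    · rw [hq h]; simp
  have g3 : w * κ * (w' * κ) = ((-1 : ℤ) ^ (p * q)) • (w' * κ * (w * κ)) := by
    have h1 : w * κ * (w' * κ) = w * w' * (κ * κ) := by
      rw [mul_assoc, ← mul_assoc κ, e6, mul_assoc, ← mul_assoc]
    have h2 : w' * κ * (w * κ) = w' * w * (κ * κ) := by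
      rw [mul_assoc, ← mul_assoc κ, e5, mul_assoc, ← mul_assoc]
    rw [h1, h2, e2, smul_mul_assoc]
  simp only [add_mul, mul_add, smul_add]
  rw [e1, g1, g2, g3]
  abel

set_option maxHeartbeats 1000000 in
/-- `J ⊗ 𝒮V` acts on `(J ⊗ 𝒮V_S) ⊗ 𝒮V_T`. -/
theorem exists_splitAction (hJ : J.IsDAlgebra) (hT : ∀ i ∈ T, deg i = n) :
    ∃ (σ : FreeExt J (fun i : S => deg i) →ₐ[O] _)
    (F : FreeExt J deg →ₐ[O] Module.End O (SplitExt J deg S T)),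
    (∀ a, F (base deg a) = mulFst J deg S T (base _ a)) ∧
    ∀ x, F (var J deg x) = mulFst J deg S T (var J _ (Finsupp.lsubtypeDomain (R := O) S x)) +
      mulSnd J deg S T (GrSym.ι _ (Finsupp.lsubtypeDomain (R := O) T x)) *
        σ.toLinearMap.rTensor _ := by
  obtain ⟨σ, hσb, hσv⟩ := exists_signPow (deg := fun i : S => deg i) hJ n
  -- All generators in `T` have degree `n`, so a single operator `κ`, acting by `(-1)^{n|a|}` on the
  -- first factor, supplies the Koszul sign for moving any of them past `a`.
  let κ : Module.End O (SplitExt J deg S T) := σ.toLinearMap.rTensor _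
  have hκF : ∀ a, κ * mulFst J deg S T a = mulFst J deg S T (σ a) * κ := fun a =>
    TensorProduct.ext' fun b s => congrArg (· ⊗ₜ s) (map_mul σ a b)
  have hκS : ∀ r, κ * mulSnd J deg S T r = mulSnd J deg S T r * κ := fun a =>
    TensorProduct.ext' fun _ _ => rfl
  let f : (I →₀ DiffOp K O) →ₗ[O] Module.End O (SplitExt J deg S T) :=
    (mulFst J deg S T).toLinearMap ∘ₗ var J _ ∘ₗ Finsupp.lsubtypeDomain (R := O) S +
      LinearMap.mulRight O κ ∘ₗ (mulSnd J deg S T).toLinearMap ∘ₗ GrSym.ι _ ∘ₗ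
        Finsupp.lsubtypeDomain (R := O) T
  have hf : ∀ x, f x = mulFst J deg S T (var J _ (Finsupp.lsubtypeDomain (R := O) S x)) +
      mulSnd J deg S T (GrSym.ι _ (Finsupp.lsubtypeDomain (R := O) T x)) * κ := fun _ => rfl
  have hrel : ∀ ⦃p q x y⦄, x ∈ freeGr K O deg p → y ∈ freeGr K O deg q →
      f x * f y = (-1) ^ (p * q) * (f y * f x) := by
    intro p q x y hx hy
    have hxS := lsubtypeDomain_mem_freeGr S hx
    have hyS := lsubtypeDomain_mem_freeGr S hy
    have hxT := lsubtypeDomain_mem_freeGr T hx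
    have hyT := lsubtypeDomain_mem_freeGr T hy
    have hx0 := fun h => lsubtypeDomain_eq_zero hT (m := p) h hx
    have hy0 := fun h => lsubtypeDomain_eq_zero hT (m := q) h hy
    rw [hf, hf]
    generalize Finsupp.lsubtypeDomain (R := O) S x = xS at *
    generalize Finsupp.lsubtypeDomain (R := O) S y = yS at *
    generalize Finsupp.lsubtypeDomain (R := O) T x = xT at *
    generalize Finsupp.lsubtypeDomain (R := O) T y = yT at *
    refine swap_twistedSum (E := Module.End O (SplitExt J deg S T)) (n := n)
      ?_ ?_ ?_ ?_ (hκS _) (hκS _) (mulFst_mulSnd _ _) (mulFst_mulSnd _ _)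
      (fun h => ?_) (fun h => ?_)
    · rw [← map_mul, var_mul_var hxS hyS, map_mul, map_mul, map_pow, map_neg, map_one]
    · rw [← map_mul, GrSym.ι_mul_ι hxT hyT, map_mul, map_mul, map_pow, map_neg, map_one]
    · rw [hκF, hσv p xS hxS, ← zsmul_sign, map_mul, map_pow, map_neg, map_one]
    · rw [hκF, hσv q yS hyS, ← zsmul_sign, map_mul, map_pow, map_neg, map_one]
    · rw [hx0 h, map_zero, map_zero]
    · rw [hy0 h, map_zero, map_zero]
  have hcomm : ∀ a x, Commute ((mulFst J deg S T).comp (base _) a) (f x) := by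
    intro a x
    change Commute (mulFst J deg S T (base _ a)) (f x)
    rw [hf]
    refine Commute.add_right ?_ (Commute.mul_right ?_ ?_)
    · change _ * _ = _ * _
      rw [← map_mul, base_mul_comm hJ, map_mul]
    · exact mulFst_mulSnd _ _
    · exact (((hκF _).trans (by rw [hσb]))).symm
  exact ⟨σ, liftAlg (B := Module.End O (SplitExt J deg S T)) _ f hrel hcomm,
    fun a => liftAlg_base a, fun x => liftAlg_var x⟩

/-- The canonical map `(J ⊗ 𝒮V_S) ⊗ 𝒮V_T → J ⊗ 𝒮V`. -/
def splitMap (hJ : J.IsDAlgebra) : SplitExt J deg S T →ₗ[O] FreeExt J deg :=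
  LinearMap.mul' O _ ∘ₗ TensorProduct.map (incl hJ S).toLinearMap
    ((incl hJ T).comp Algebra.TensorProduct.includeRight).toLinearMap

theorem splitMap_tmul (hJ : J.IsDAlgebra) (a : FreeExt J (fun i : S => deg i)) (s) :
    splitMap (T := T) hJ (a ⊗ₜ s) = incl hJ S a * incl hJ T (1 ⊗ₜ s) := rfl

/-- Let `J ⊗ 𝒮V` act on the split tensor product, as left multiplication with Koszul signs would.
Applying the image of `a ⊗ s` to `1 ⊗ 1` gives back `a ⊗ s`, so evaluation at `1 ⊗ 1` is a left
inverse. -/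
theorem splitMap_injective (hJ : J.IsDAlgebra) (hST : Disjoint S T) (hT : ∀ i ∈ T, deg i = n) :
    Function.Injective (splitMap (deg := deg) (S := S) (T := T) hJ) := by
  obtain ⟨σ, F, hFb, hFv⟩ := exists_splitAction (S := S) (T := T) hJ hT
  have h1 : ∀ a, F (incl hJ S a) = mulFst J deg S T a := by
    intro a
    induction a using FreeExt.induction with
    | hb a => rw [incl_base, hFb]
    | hv i P =>
      rw [incl_var, hFv, lsubtypeDomain_lmapDomain, lsubtypeDomain_lmapDomain_of_disjoint hST,
        map_zero, map_zero, zero_mul, add_zero]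
    | hadd a b h1 h2 => rw [map_add, map_add, map_add, h1, h2]
    | hmul a b h1 h2 => rw [map_mul, map_mul, map_mul, h1, h2]
  have h2 : ∀ s s', F (incl hJ T (1 ⊗ₜ s)) (1 ⊗ₜ s') = 1 ⊗ₜ (s * s') := by
    intro s
    induction s using GrSym.induction with
    | hr r =>
      intro s'
      have : (1 : J.carrier) ⊗ₜ[O] algebraMap O (GrSym (freeGr K O fun i : T => deg i)) r
          = algebraMap O (FreeExt J (fun i : T => deg i)) r := by
        rw [Algebra.algebraMap_eq_smul_one, Algebra.algebraMap_eq_smul_one, TensorProduct.tmul_smul]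
        rfl
      rw [this, AlgHom.commutes, AlgHom.commutes, Module.algebraMap_end_apply, ← Algebra.smul_def,
        TensorProduct.tmul_smul]
    | hι x =>
      intro s'
      have h3 := hFv (Finsupp.lmapDomain (DiffOp K O) O Subtype.val x)
      rw [lsubtypeDomain_lmapDomain, lsubtypeDomain_lmapDomain_of_disjoint hST.symm, map_zero,
        map_zero, zero_add] at h3
      rw [← var_apply, incl_var, h3]
      change (σ 1) ⊗ₜ (GrSym.ι _ x * s') = _
      rw [map_one]
    | hadd a b h1 h2 =>
      intro s'
      rw [TensorProduct.tmul_add, map_add, map_add, LinearMap.add_apply, h1, h2, add_mul,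
        TensorProduct.tmul_add]
    | hmul a b h1 h2 =>
      intro s'
      rw [← one_mul (1 : J.carrier), ← Algebra.TensorProduct.tmul_mul_tmul, map_mul, map_mul,
        Module.End.mul_apply, h2, h1, mul_assoc]
  let ev : FreeExt J deg →ₗ[O] SplitExt J deg S T :=
    (LinearMap.applyₗ (R := O) ((1 : FreeExt J (fun i : S => deg i)) ⊗ₜ
      (1 : GrSym (freeGr K O fun i : T => deg i)))) ∘ₗ F.toLinearMap
  have h3 : ev ∘ₗ splitMap hJ = LinearMap.id := TensorProduct.ext' fun a s => by
    change F (splitMap hJ (a ⊗ₜ s)) (1 ⊗ₜ 1) = _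
    rw [splitMap_tmul, map_mul, Module.End.mul_apply, h2, h1, mulFst_tmul, mul_one, mul_one]
    rfl
  exact Function.LeftInverse.injective (g := ev) fun t => LinearMap.congr_fun h3 t

end splitting

end FreeExt

end Basics

end


noncomputable section

section Basics

variable {K : Type v} {O : Type u} [Field K] [CommRing O] [Algebra K O]

/-! ### The image of the splitting, and the Sullivan filtration -/

namespace FreeExt

variable {J : DGDA.{v, u, w₁} K O} {R : DGDA.{v, u, w₂} K O} {I : Type w} {deg : I → ℕ}

theorem Homog.incl (hJ : J.IsDAlgebra) (S : Set I) {n : ℕ} {a : FreeExt J (fun i : S => deg i)}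
    (ha : Homog n a) : Homog n (incl hJ S a) := by
  induction ha with
  | zero n => rw [map_zero]; exact .zero n
  | ofBase a => rw [incl_base]; exact .ofBase a
  | ofVar i P =>
    rw [incl_var, Finsupp.lmapDomain_apply, Finsupp.mapDomain_single]; exact .ofVar (i : I) P
  | add _ _ h1 h2 => rw [map_add]; exact h1.add h2
  | mul _ _ h1 h2 => rw [map_mul]; exact h1.mul h2

/-- The range contains `1` and is stable under left multiplication by all generators in `U`: those
in `S` enter the first factor directly, those in `T` are first moved past a homogeneous first factor
at the cost of a sign. -/
theorem range_splitMap (hJ : J.IsDAlgebra) {S T U : Set I} (hU : ∀ i, i ∈ U ↔ i ∈ S ∨ i ∈ T) :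
    LinearMap.range (splitMap (deg := deg) (S := S) (T := T) hJ) =
      LinearMap.range (incl (deg := deg) hJ U).toLinearMap := by
  have hle : ∀ {A : Set I}, (∀ i ∈ A, i ∈ U) →
      ∀ a, incl (deg := deg) hJ A a ∈ (incl hJ U).range := by
    intro A hA a
    induction a using FreeExt.induction with
    | hb a => exact ⟨base _ a, (incl_base ..).trans (incl_base ..).symm⟩
    | hv i P =>
      refine ⟨var _ _ (Finsupp.single ⟨i, hA i i.2⟩ P), ?_⟩
      change incl hJ U _ = _
      simp only [incl_var, Finsupp.lmapDomain_apply, Finsupp.mapDomain_single]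
    | hadd a b h1 h2 => rw [map_add]; exact add_mem h1 h2
    | hmul a b h1 h2 => rw [map_mul]; exact mul_mem h1 h2
  apply le_antisymm
  · rintro _ ⟨t, rfl⟩
    induction t using TensorProduct.induction_on with
    | zero => rw [map_zero]; exact zero_mem _
    | tmul a s =>
      rw [splitMap_tmul]
      obtain ⟨b, hb⟩ := mul_mem (hle (fun i hi => (hU i).2 (.inl hi)) a)
        (hle (fun i hi => (hU i).2 (.inr hi)) (1 ⊗ₜ s))
      exact ⟨b, hb⟩
    | add a b h1 h2 => rw [map_add]; exact add_mem h1 h2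
  have hS : ∀ a, ∀ r ∈ LinearMap.range (splitMap (deg := deg) (S := S) (T := T) hJ),
      incl hJ S a * r ∈ LinearMap.range (splitMap (deg := deg) (S := S) (T := T) hJ) := by
    rintro a _ ⟨t, rfl⟩
    induction t using TensorProduct.induction_on with
    | zero => rw [map_zero, mul_zero]; exact zero_mem _
    | tmul b s =>
      refine ⟨(a * b) ⊗ₜ s, ?_⟩
      rw [splitMap_tmul, splitMap_tmul, map_mul, mul_assoc]
    | add a b h1 h2 => rw [map_add, mul_add]; exact add_mem h1 h2
  have hT : ∀ (i : T) P, ∀ r ∈ LinearMap.range (splitMap (deg := deg) (S := S) (T := T) hJ),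
      var J deg (Finsupp.single (i : I) P) * r ∈
        LinearMap.range (splitMap (deg := deg) (S := S) (T := T) hJ) := by
    rintro i P _ ⟨t, rfl⟩
    induction t using TensorProduct.induction_on with
    | zero => rw [map_zero, mul_zero]; exact zero_mem _
    | tmul b s =>
      rw [splitMap_tmul]
      refine homog_induction hJ (p := fun b => var J deg (Finsupp.single (i : I) P) *
        (incl hJ S b * incl hJ T (1 ⊗ₜ s)) ∈
          LinearMap.range (splitMap (deg := deg) (S := S) (T := T) hJ))
        (fun n b hb => ?_) (fun a b h1 h2 => ?_) b
      · have h1 : incl hJ T ((1 : J.carrier) ⊗ₜ[O] (GrSym.ι _ (Finsupp.single i P) * s)) =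
            var J deg (Finsupp.single (i : I) P) * incl hJ T (1 ⊗ₜ s) := by
          rw [← one_mul (1 : J.carrier), ← Algebra.TensorProduct.tmul_mul_tmul, map_mul,
            ← var_apply, incl_var, Finsupp.lmapDomain_apply, Finsupp.mapDomain_single, one_mul]
        rw [← mul_assoc, Homog.mul_comm hJ (Homog.ofVar (i : I) P) (hb.incl hJ S),
          smul_mul_assoc, mul_assoc, ← h1, ← splitMap_tmul]
        exact zsmul_mem (LinearMap.mem_range_self _ _) _
      · rw [map_add, add_mul, mul_add]; exact add_mem h1 h2
    | add a b h1 h2 => rw [map_add, mul_add]; exact add_mem h1 h2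
  have key : ∀ a, ∀ r ∈ LinearMap.range (splitMap (deg := deg) (S := S) (T := T) hJ),
      incl hJ U a * r ∈ LinearMap.range (splitMap (deg := deg) (S := S) (T := T) hJ) := by
    intro a
    induction a using FreeExt.induction with
    | hb a => rw [incl_base, ← incl_base hJ S]; exact hS _
    | hv i P =>
      rw [incl_var, Finsupp.lmapDomain_apply, Finsupp.mapDomain_single]
      rcases (hU i).1 i.2 with h | h
      · have := hS (var J _ (Finsupp.single ⟨i, h⟩ P))
        rwa [incl_var, Finsupp.lmapDomain_apply, Finsupp.mapDomain_single] at this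
      · exact hT ⟨i, h⟩ P
    | hadd a b h1 h2 =>
      intro r hr
      rw [map_add, add_mul]; exact add_mem (h1 r hr) (h2 r hr)
    | hmul a b h1 h2 =>
      intro r hr
      rw [map_mul, mul_assoc]; exact h1 _ (h2 r hr)
  rintro _ ⟨a, rfl⟩
  have h := key a 1 ⟨1 ⊗ₜ 1, by rw [splitMap_tmul, map_one, one_mul]; exact map_one (incl hJ T)⟩
  rwa [mul_one] at h

/-! ### Subalgebras generated by subsets of the generators -/

section generated

variable (hJ : J.IsDAlgebra) (j : DGDHom J R) (x : I → R.carrier) (hx : ∀ i, x i ∈ R.gr (deg i))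

/-- The image of the free extension on a set of generators. -/
def genAlg (S : Set I) : Subalgebra O R.carrier :=
  (liftHom (deg := fun i : S => deg i) hJ j (fun i : S => x i) (fun i => hx i)).range

theorem base_mem_genAlg (S : Set I) (a : J.carrier) : j a ∈ genAlg hJ j x hx S :=
  ⟨base _ a, liftHom_base hJ j _ (fun i : S => hx i) a⟩

theorem smul_mem_genAlg {S : Set I} {i : I} (hi : i ∈ S) (P : DiffOp K O) :
    P • x i ∈ genAlg hJ j x hx S :=
  ⟨var _ _ (Finsupp.single ⟨i, hi⟩ P), liftHom_var_single hJ j _ (fun i : S => hx i) ⟨i, hi⟩ P⟩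

theorem genAlg_le {S : Set I} {A : Subalgebra O R.carrier} (hj : ∀ a, j a ∈ A)
    (hA : ∀ i ∈ S, ∀ P : DiffOp K O, P • x i ∈ A) : genAlg hJ j x hx S ≤ A := by
  rintro _ ⟨t, rfl⟩
  change liftHom (deg := fun i : S => deg i) hJ j (fun i : S => x i) (fun i => hx i) t ∈ _
  induction t using FreeExt.induction with
  | hb a => rw [liftHom_base]; exact hj a
  | hv i P => rw [liftHom_var_single]; exact hA i i.2 P
  | hadd a b h1 h2 => rw [map_add]; exact add_mem h1 h2
  | hmul a b h1 h2 => rw [map_mul]; exact mul_mem h1 h2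

theorem genAlg_mono {S U : Set I} (h : S ⊆ U) : genAlg hJ j x hx S ≤ genAlg hJ j x hx U :=
  genAlg_le hJ j x hx (base_mem_genAlg hJ j x hx U) fun _ hi => smul_mem_genAlg hJ j x hx (h hi)

variable (R) in
/-- The `𝒟`-submodule generated by a family. -/
def genSpan {T : Type*} (x : T → R.carrier) : Submodule (DiffOp K O) R.carrier :=
  LinearMap.range (Finsupp.linearCombination (DiffOp K O) x)

theorem genSpan_le {T : Type*} {x : T → R.carrier} {n : ℕ} (hx : ∀ i, x i ∈ R.gr n) :
    genSpan R x ≤ R.gr n := by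
  rintro _ ⟨c, rfl⟩
  exact Submodule.sum_mem _ fun i _ => Submodule.smul_mem _ _ (hx i)

theorem genSpan_le_genAlg (S : Set I) {v : R.carrier}
    (hv : v ∈ genSpan R (fun i : S => x i)) : v ∈ genAlg hJ j x hx S := by
  obtain ⟨c, rfl⟩ := hv
  exact ⟨var _ _ c, liftHom_var hJ j _ (fun i : S => hx i) c⟩

theorem ofFun_smul_eq (f : O) (y : R.carrier) : DiffOp.ofFun K f • y = f • y := by
  have h := smul_assoc f (1 : DiffOp K O) y
  rwa [one_smul, DiffOp.smul_eq, mul_one] at h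

/-- With `e` the idempotent generating the kernel of `O → J`, right multiplication by `1 - e` on the
free module descends to a section of the surjection onto the span. It kills the relations because
their coefficients take values in `e O`, and it does not change the image because `e` acts by zero
on `R`. -/
theorem projective_genSpan [CharZero K] [Algebra.Smooth K O]
    (hinj : Function.Injective (liftHom hJ j x hx)) :
    Module.Projective (DiffOp K O) (genSpan R x) := by
  obtain ⟨e, he, hker⟩ := DGDA.exists_idempotent J
  have he0 : ∀ y : R.carrier, e • y = 0 := fun y => by
    have h : algebraMap O J.carrier e = 0 :=
      (hker e).2 (by rw [sub_mul, he.eq, one_mul, sub_self])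
    rw [Algebra.smul_def, ← AlgHom.commutes j.toAlgHom, h, map_zero, zero_mul]
  let lc := Finsupp.linearCombination (DiffOp K O) x
  let m : (I →₀ DiffOp K O) →ₗ[DiffOp K O] (I →₀ DiffOp K O) :=
    Finsupp.mapRange.linearMap (LinearMap.toSpanSingleton _ _ (DiffOp.ofFun K (1 - e)))
  have hm : ∀ c i, m c i = c i * DiffOp.ofFun K (1 - e) := fun c i => rfl
  have h1 : lc ∘ₗ m = lc := by
    refine Finsupp.lhom_ext fun i P => ?_
    rw [LinearMap.comp_apply, Finsupp.mapRange.linearMap_apply, Finsupp.mapRange_single,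
      Finsupp.linearCombination_single, Finsupp.linearCombination_single,
      LinearMap.toSpanSingleton_apply, smul_eq_mul, mul_smul, ofFun_smul_eq, sub_smul, one_smul,
      he0, sub_zero]
  have h2 : LinearMap.ker lc ≤ LinearMap.ker m := by
    intro c hc
    have hvar : var J deg c = 0 := hinj (by rw [liftHom_var, map_zero]; exact hc)
    refine LinearMap.mem_ker.2 (Finsupp.ext fun i => ?_)
    -- Centrality turns right multiplication by `1 - e` into left multiplication, which can be
    -- tested on the values of the operator.
    rw [hm, DiffOp.ofFun_idempotent_comm he.one_sub]
    exact Subtype.ext (LinearMap.ext fun f => (hker _).1 (algebraMap_eq_zero_of_var hvar i f))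
  let s : LinearMap.range lc →ₗ[DiffOp K O] (I →₀ DiffOp K O) :=
    (LinearMap.ker lc).liftQ m h2 ∘ₗ lc.quotKerEquivRange.symm.toLinearMap
  have hs : ∀ c, s (lc.rangeRestrict c) = m c := fun c => by
    have : lc.quotKerEquivRange.symm (lc.rangeRestrict c) = (LinearMap.ker lc).mkQ c :=
      lc.quotKerEquivRange.symm_apply_eq.2 rfl
    change (LinearMap.ker lc).liftQ m h2 (lc.quotKerEquivRange.symm (lc.rangeRestrict c)) = _
    rw [this]
    exact Submodule.liftQ_apply ..
  refine Module.Projective.of_split s lc.rangeRestrict (LinearMap.ext ?_)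
  rintro ⟨_, c, rfl⟩
  refine Subtype.ext ?_
  change lc (s (lc.rangeRestrict c)) = lc c
  rw [hs]
  exact LinearMap.congr_fun h1 c

/-! ### Extensions by generators of a fixed degree -/

/-- The map `𝒮(⨁ 𝒟 · v_α) → 𝒮V` onto the symmetric algebra of the span of the `v_α`. -/
def symSpan : GrSym (freeGr K O deg) →ₐ[O] GrSym (subGr (genSpan R x)) :=
  GrSym.liftAlg (GrSym.ι _ ∘ₗ
      ((Finsupp.linearCombination (DiffOp K O) x).rangeRestrict).restrictScalars O)
    fun _ _ _ _ h h' => GrSym.ι_mul_ι (𝒱 := subGr (genSpan R x)) (freeMap_mem R deg x hx _ _ h)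
      (freeMap_mem R deg x hx _ _ h')

theorem symSpan_surjective : Function.Surjective (symSpan x hx) := by
  intro s
  induction s using GrSym.induction with
  | hr r => exact ⟨algebraMap O _ r, AlgHom.commutes _ r⟩
  | hι v =>
    obtain ⟨_, c, rfl⟩ := v
    exact ⟨GrSym.ι _ c, GrSym.liftAlg_ι ..⟩
  | hadd a b h1 h2 =>
    obtain ⟨a, rfl⟩ := h1
    obtain ⟨b, rfl⟩ := h2
    exact ⟨a + b, map_add _ a b⟩
  | hmul a b h1 h2 =>
    obtain ⟨a, rfl⟩ := h1
    obtain ⟨b, rfl⟩ := h2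
    exact ⟨a * b, map_mul _ a b⟩

theorem lift_symSpan (s : GrSym (freeGr K O deg)) :
    GrSym.lift ((genSpan R x).subtype.restrictScalars O) (fun _ _ h => h) (symSpan x hx s) =
      liftHom hJ j x hx (1 ⊗ₜ s) := by
  change _ = (liftHom hJ j x hx).comp Algebra.TensorProduct.includeRight s
  induction s using GrSym.induction with
  | hr r => rw [AlgHom.commutes, AlgHom.commutes, AlgHom.commutes]
  | hι c =>
    have h1 : symSpan x hx (GrSym.ι _ c) = GrSym.ι _ _ := GrSym.liftAlg_ι ..
    exact (congrArg _ h1).trans ((GrSym.lift_ι _ _ _).trans (liftHom_var hJ j x hx c).symm)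
  | hadd a b h1 h2 => rw [map_add, map_add, map_add, h1, h2]
  | hmul a b h1 h2 => rw [map_mul, map_mul, map_mul, h1, h2]

/-- Everything is transported from the splitting of the free extension along `χ`, which identifies
its first factor with `B` and maps the free generators onto their span in `R`. -/
theorem isSymExtension [CharZero K] [Algebra.Smooth K O]
    (hinj : Function.Injective (liftHom hJ j x hx)) {S T U : Set I} {n : ℕ} (hST : Disjoint S T)
    (hT : ∀ i ∈ T, deg i = n) (hU : ∀ i, i ∈ U ↔ i ∈ S ∨ i ∈ T) {B : Type w₃} [AddCommGroup B]
    [Module O B] (g : B →ₗ[O] R.carrier) (hg : Function.Injective g)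
    (hgS : LinearMap.range g = Subalgebra.toSubmodule (genAlg hJ j x hx S)) (C : DGDSub R)
    (hC : C.toSubalgebra = genAlg hJ j x hx U) :
    IsSymExtension g (genSpan R fun i : T => x i) C := by
  have hincl : ∀ A : Set I, Function.Injective
      (liftHom (deg := fun i : A => deg i) hJ j (fun i : A => x i) (fun i => hx i)) := by
    intro A a b h
    rw [← liftHom_incl hJ A j x hx, ← liftHom_incl hJ A j x hx] at h
    exact incl_injective hJ A (hinj h)
  let ΦS := liftHom (deg := fun i : S => deg i) hJ j (fun i : S => x i) (fun i => hx i)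
  let η : FreeExt J (fun i : S => deg i) ≃ₗ[O] B :=
    (LinearEquiv.ofInjective ΦS.toLinearMap (hincl S)).trans
      ((LinearEquiv.ofEq (LinearMap.range ΦS.toLinearMap) (LinearMap.range g) hgS.symm).trans
        (LinearEquiv.ofInjective g hg).symm)
  have hη : ∀ t, g (η t) = ΦS t := fun t =>
    congrArg Subtype.val ((LinearEquiv.ofInjective g hg).apply_symm_apply _)
  let π := symSpan (deg := fun i : T => deg i) (fun i : T => x i) (fun i => hx i)
  let χ := TensorProduct.map η.toLinearMap π.toLinearMap
  have hχ : Function.Surjective χ :=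
    TensorProduct.map_surjective η.surjective (symSpan_surjective _ _)
  have hcomp : subSymExtMap g (genSpan R fun i : T => x i) ∘ₗ χ =
      (liftHom hJ j x hx).toLinearMap ∘ₗ splitMap hJ := by
    refine TensorProduct.ext' fun a s => ?_
    change g (η a) * GrSym.lift _ _ (π s) = liftHom hJ j x hx (splitMap hJ (a ⊗ₜ s))
    rw [hη, lift_symSpan hJ j, splitMap_tmul, map_mul, liftHom_incl, liftHom_incl]
  refine ⟨projective_genSpan hJ j _ (fun i : T => hx i) (hincl T), fun m a ha => ?_,
    fun ha => ?_, ?_, ?_⟩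
  · have ha' := genSpan_le (fun i : T => hT i i.2 ▸ hx i) ha
    by_cases h : n = m
    · rw [DirectSum.decompose_of_mem_same _ (h ▸ ha')]; exact ha
    · rw [DirectSum.decompose_of_mem_ne _ ha' h]; exact zero_mem _
  · rw [hC]
    exact genAlg_mono hJ j x hx (fun i hi => (hU i).2 (.inr hi)) (genSpan_le_genAlg hJ j x hx T ha)
  -- Surjectivity of `χ` suffices: its composite with the map in question is injective, so that map
  -- is injective too, even where the free module does not embed in `R`.
  · intro u u' h
    obtain ⟨a, rfl⟩ := hχ u
    obtain ⟨b, rfl⟩ := hχ u'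
    have h' : liftHom hJ j x hx (splitMap hJ a) = liftHom hJ j x hx (splitMap hJ b) :=
      (LinearMap.congr_fun hcomp a).symm.trans (h.trans (LinearMap.congr_fun hcomp b))
    rw [splitMap_injective hJ hST hT (hinj h')]
  · rw [hC, ← LinearMap.range_comp_of_range_eq_top _ (LinearMap.range_eq_top.2 hχ), hcomp,
      LinearMap.range_comp, range_splitMap hJ hU, ← LinearMap.range_comp]
    have h : (liftHom hJ j x hx).toLinearMap ∘ₗ (incl hJ U).toLinearMap =
        (liftHom (deg := fun i : U => deg i) hJ j (fun i : U => x i) (fun i => hx i)).toLinearMap :=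
      LinearMap.ext fun t => liftHom_incl hJ U j x hx t
    exact congrArg LinearMap.range h

end generated

/-! ### The filtration by the degree of the generators -/

section filtration

variable (j : DGDHom J R) (x : I → R.carrier) (hx : ∀ i, x i ∈ R.gr (deg i))

theorem d_liftHom_mem [hJ : Fact J.IsDAlgebra] [CharZero K] [Algebra.Smooth K O]
    (hd : ∀ i, R.d (x i) ∈ (liftHom hJ.out j x hx).range) (t : FreeExt J deg) :
    R.d (liftHom hJ.out j x hx t) ∈ (liftHom hJ.out j x hx).range := by
  refine homog_induction hJ.out (p := fun t => R.d (liftHom hJ.out j x hx t) ∈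
    (liftHom hJ.out j x hx).range) (fun n a ha => ?_) (fun a b h1 h2 => ?_) t
  · induction ha with
    | zero n => rw [map_zero, map_zero]; exact zero_mem _
    | ofBase a =>
      rw [liftHom_base, show R.d (j a) = 0 from R.d_zero (j.map_gr' (hJ.out.mem_gr_zero a))]
      exact zero_mem _
    | ofVar i P =>
      rw [liftHom_var_single, map_smul]
      obtain ⟨t, ht⟩ := hd i
      exact ⟨P • t, (liftHom_smul ..).trans (congrArg (P • ·) ht)⟩
    | add _ _ h1 h2 => rw [map_add, map_add]; exact add_mem h1 h2
    | mul ha hb h1 h2 =>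
      rw [map_mul, R.d_mul (liftHom_mem hJ.out j x hx ha)]
      exact add_mem (mul_mem h1 ⟨_, rfl⟩) (mul_mem (pow_mem (neg_mem (one_mem _)) _)
        (mul_mem ⟨_, rfl⟩ h2))
  · rw [map_add, map_add]; exact add_mem h1 h2

/-- The differential graded `𝒟`-subalgebra generated by a set of generators. -/
def genSub [hJ : Fact J.IsDAlgebra] [CharZero K] [Algebra.Smooth K O] (S : Set I)
    (hd : ∀ i ∈ S, R.d (x i) ∈ genAlg hJ.out j x hx S) : DGDSub R where
  toSubalgebra := genAlg hJ.out j x hx S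
  smul_mem' P := by
    rintro _ ⟨t, rfl⟩
    exact ⟨P • t, liftHom_smul hJ.out j _ (fun i : S => hx i) P t⟩
  d_mem' := by
    rintro _ ⟨t, rfl⟩
    exact d_liftHom_mem j _ (fun i : S => hx i) (fun i => hd i i.2) t
  homogeneous' n := by
    rintro _ ⟨t, rfl⟩
    exact ⟨_, (decompose_liftHom hJ.out j _ (fun i : S => hx i) t n).symm⟩

variable {j x hx}

theorem mem_genAlg_of_mem_gr (hJ : J.IsDAlgebra)
    (hbij : Function.Bijective (liftHom hJ j x hx)) {m : ℕ}
    {r : R.carrier} (hr : r ∈ R.gr m) {S : Set I} (hS : ∀ i, deg i ≤ m → i ∈ S) :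
    r ∈ genAlg hJ j x hx S := by
  obtain ⟨t, rfl⟩ := hbij.2 r
  obtain ⟨t', ht', h⟩ := exists_homog_of_mem hJ j x hx hr
  rw [← h]
  exact liftHom_mem_range hJ j x hx ht' S hS

/-- An element of degree `k - 1` involves only generators of degree at most `k - 1`. -/
theorem d_mem_genAlg (hJ : J.IsDAlgebra)
    (hbij : Function.Bijective (liftHom hJ j x hx)) {k : ℕ} {r : R.carrier}
    (hr : r ∈ R.gr k) : R.d r ∈ genAlg hJ j x hx {i | deg i < k} := by
  cases k with
  | zero => rw [R.d_zero hr]; exact zero_mem _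
  | succ k => exact mem_genAlg_of_mem_gr hJ hbij (R.d_mem hr) fun i hi => Nat.lt_succ_of_le hi

/-- The filtration goes by degree, so it is indexed by `ℕ` whatever the order type of the basis, and
each step adjoins generators of one degree, as the splitting requires. -/
theorem isSullivanType [hJ : Fact J.IsDAlgebra] [CharZero K] [Algebra.Smooth K O]
    (hbij : Function.Bijective (liftHom hJ.out j x hx)) :
    (DGADA.ofHom j).IsSullivanType := by
  let S : ℕ → Set I := fun k => {i | deg i < k}
  have hS : ∀ {k l}, k ≤ l → S k ⊆ S l := fun h i hi => lt_of_lt_of_le hi h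
  -- The shift to `S (k + 1)` puts the generators of degree `k` into the `k`-th stage; `S 0` is
  -- empty and stands for the stage `-1`.
  let F : ℕ → DGDSub R := fun k => genSub j x hx (S (k + 1)) fun i hi =>
    genAlg_mono hJ.out j x hx (hS (le_of_lt hi)) (d_mem_genAlg hJ.out hbij (hx i))
  let V : ℕ → Submodule (DiffOp K O) R.carrier := fun k => genSpan R fun i : {i | deg i = k} => x i
  have hV : ∀ k, V k ≤ R.gr k := fun k => genSpan_le fun i => by
    have h : deg i = k := i.2
    have hxi := hx i
    rwa [h] at hxi
  have hdisj : ∀ k, Disjoint (S k) {i | deg i = k} := fun k =>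
    Set.disjoint_left.2 fun i h1 h2 => (ne_of_lt h1) h2
  have hunion : ∀ k i, i ∈ S (k + 1) ↔ i ∈ S k ∨ i ∈ {i | deg i = k} := fun k i =>
    Nat.lt_succ_iff_lt_or_eq
  have hstr : ∀ a, (DGADA.ofHom j).structureMap a = j a := fun a => mul_one (j a)
  have hj : ∀ a : J.carrier, j a = liftHom hJ.out j x hx (base deg a) :=
    fun a => (liftHom_base ..).symm
  refine ⟨F, V, fun k => genAlg_mono hJ.out j x hx (hS (Nat.le_succ _)), fun c => ?_, fun a => ?_,
    ?_, fun r hr => ?_, fun k => ?_, fun k r hr => d_mem_genAlg hJ.out hbij (hV _ hr)⟩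
  · obtain ⟨t, rfl⟩ := hbij.2 c
    refine homog_induction hJ.out (p := fun t => ∃ k, liftHom hJ.out j x hx t ∈
      genAlg hJ.out j x hx (S (k + 1))) (fun n a ha => ⟨n, ?_⟩) (fun a b h1 h2 => ?_) t
    · exact liftHom_mem_range hJ.out j x hx ha _ fun i hi => Nat.lt_succ_of_le hi
    · obtain ⟨k, hk⟩ := h1
      obtain ⟨l, hl⟩ := h2
      refine ⟨max k l, ?_⟩
      rw [map_add]
      exact add_mem (genAlg_mono hJ.out j x hx (hS (by omega)) hk)
        (genAlg_mono hJ.out j x hx (hS (by omega)) hl)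
  · rw [hstr]
    exact base_mem_genAlg hJ.out j x hx _ a
  · refine isSymExtension hJ.out j x hx hbij.1 (hdisj 0) (fun _ h => h) (hunion 0)
      (DGADA.ofHom j).structureMap (fun a b h => ?_) (le_antisymm ?_ ?_) (F 0) rfl
    · have h' : j a = j b := (hstr a).symm.trans (h.trans (hstr b))
      rw [hj, hj] at h'
      exact base_injective (hbij.1 h')
    · rintro _ ⟨a, rfl⟩
      have h : j a ∈ genAlg hJ.out j x hx (S 0) := base_mem_genAlg hJ.out j x hx _ a
      exact (hstr a).symm ▸ h
    -- No generator has negative degree, so the algebra generated by `S 0` is the image of `J`.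
    · intro r hr
      obtain ⟨a, ha⟩ := genAlg_le (A := j.toAlgHom.range) hJ.out j x hx (S := S 0)
        (fun a => ⟨a, rfl⟩) (fun i hi => absurd hi (Nat.not_lt_zero _)) hr
      exact ⟨a, (hstr a).trans ha⟩
  -- `V 0` lies in degree zero, where the differential vanishes.
  · exact ⟨0, (map_zero _).trans (R.d_zero (hV 0 hr)).symm⟩
  · exact isSymExtension hJ.out j x hx hbij.1 (hdisj (k + 1)) (fun _ h => h) (hunion (k + 1)) _
      Subtype.val_injective (Submodule.range_subtype _) (F (k + 1)) rfl

end filtration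

end FreeExt

theorem mainTheorem3 (K : Type v) (O : Type u) [Field K] [CharZero K] [CommRing O] [Algebra K O]
    [Algebra.Smooth K O] (J Q : DGDA.{v, u, u} K O) (hJ : J.IsDAlgebra) (φ : DGDHom J Q) :
    (∃ (R : DGDA.{v, u, u} K O) (j : DGDHom J R) (q : DGDHom R Q),
      DGDHom.IsCofibrantReplacementKTR φ j q ∧ j.IsMinimalRelativeSullivan) ∧
    ∀ (R : DGDA.{v, u, u} K O) (j : DGDHom J R) (q : DGDHom R Q),
      DGDHom.IsCofibrantReplacementKTR φ j q →
      IsDGeometricKTR φ (DGADA.ofHom j) q := by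
  have : Fact J.IsDAlgebra := ⟨hJ⟩
  refine ⟨exists_minimal_resolution φ, fun R j q h =>
    ⟨?_, fun a (c : R.carrier) => ?_, h.trivialFibration.2⟩⟩
  · obtain ⟨S⟩ := h.sullivan
    refine FreeExt.isSullivanType (x := S.gen) (hx := S.gen_mem) ?_
    have := S.bijective
    rwa [show (freeSymExtMap j S.deg S.gen S.gen_mem : _ → _) = _ from
      funext (FreeExt.freeSymExtMap_eq hJ j S.gen S.gen_mem)] at this
  · change q (j a * c) = φ a * q c
    rw [← h.factor a]
    exact q.toRingHom.map_mul _ _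

end Basics

end
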